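/- Let $n\ge 2$, and let $\overrightarrow{C_n}$ be the directed cycle on the vertex set $[n]=\{1,\dots,n\}$, labeled arbitrarily: for some ordering $v_1,\dots,v_n$ of $[n]$ its edges are $(v_1,v_2),(v_2,v_3),\dots,(v_{n-1},v_n),(v_n,v_1)$. Let $C_n$ be the underlying simple undirected graph. *Notation.* Read $\sigma\in\mathfrak S_n$ as the word $\sigma_1\sigma_2\cdots\sigma_n$. Let $\mathrm{inv}_{\overrightarrow{C_n}}(\sigma)$ be the number of directed edges $(a,b)$ of $\overrightarrow{C_n}$ such that $b$ precedes $a$ in $\sigma$. The rank of a letter $x$ is the length of the longest subword of $\sigma$ that ends in $x$ and in which any two consecutive letters are adjacent in $C_n$. A $C_n$-descent of $\sigma$ is an $i$ with $1\le i<n$ such that either $\mathrm{rank}(\sigma_i)>\mathrm{rank}(\sigma_{i+1})$, or the two ranks are equal and $\sigma_i>\sigma_{i+1}$. For a partition $\lambda=(\lambda_1\ge\cdots\ge\lambda_k)$ of $n$, let $N_{C_n,\lambda}$ be the set of all $\sigma\in\mathfrak S_n$ such that, when $\sigma$ is cut into contiguous segments $\alpha_1,\dots,\alpha_k$ of sizes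 $\lambda_1,\dots,\lambda_k$, every letter of a segment $\alpha_i$ other than its first one is adjacent in $C_n$ to an earlier letter of $\alpha_i$, and there is no $C_n$-descent $j$ of $\sigma$ with $\sigma_j$ and $\sigma_{j+1}$ in the same segment. Put $[m]_t=1+t+\cdots+t^{m-1}$ and let $A_m(t)=\sum_{\sigma\in\mathfrak S_m}t^{\#\{i\,:\,\sigma_i<\sigma_{i+1}\}}$ be the Eulerian polynomial. Let $z_\lambda=\prod_i m_i(\lambda)!\,i^{m_i(\lambda)}$, where $m_i(\lambda)$ is the multiplicity of the part $i$ in $\lambda$; let $p_\lambda$ denote the power sum symmetric functions, and let $\omega$ be the $\mathbb Q[t]$-algebra involution on symmetric functions over $\mathbb Q[t]$ that sends each complete homogeneous symmetric function $h_m$ to the elementary symmetric function $e_m$. Finally let $X_{\overrightarrow{C_n}}(\mathbf x,t)=\sum_\kappa t^{\mathrm{asc}(\kappa)}\prod_{u\in[n]}x_{\kappa(u)}$ be the chromatic quasisymmetric function, where $\kappa$ runs over the colorings of $[n]$ by positive integers that give adjacent vertices of $C_n$ different colors, and $\mathrm{asc}(\kappa)$ is the number of directed edges $(a,b)$ of $\overrightarrow{C_n}$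 with $\kappa(a)<\kappa(b)$. **Theorem.** (1) For every partition $\lambda=(\lambda_1,\dots,\lambda_k)$ of $n$ with $k\ge2$ parts, $$\sum_{\sigma\in N_{C_n,\lambda}}t^{\mathrm{inv}_{\overrightarrow{C_n}}(\sigma)}=n\,t\,A_{k-1}(t)\prod_{i=1}^k[\lambda_i]_t .$$ (2) For $\lambda=(n)$, $$\sum_{\sigma\in N_{C_n,(n)}}t^{\mathrm{inv}_{\overrightarrow{C_n}}(\sigma)}=n\,t\,[n-1]_t .$$ (3) $X_{\overrightarrow{C_n}}(\mathbf x,t)$ is a symmetric function with coefficients in $\mathbb Q[t]$, and in the unique expansion $\omega X_{\overrightarrow{C_n}}(\mathbf x,t)=\sum_{\lambda\vdash n}c_\lambda(t)\,z_\lambda^{-1}p_\lambda(\mathbf x)$ with $c_\lambda(t)\in\mathbb Q[t]$ the coefficient of $\frac1n p_n$ is $c_{(n)}(t)=n\,t\,[n-1]_t$, and for every other $\lambda=(\lambda_1,\dots,\lambda_k)\vdash n$ the coefficient of $z_\lambda^{-1}p_\lambda$ is $c_\lambda(t)=n\,t\,A_{k-1}(t)\prod_{i=1}^k[\lambda_i]_t$.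 -/

import Mathlib

open scoped Polynomial

namespace CycleChromatic

noncomputable section

/-! ### Symmetric functions -/

/-- The algebra `Λ_R` of symmetric functions with coefficients in `R`: formal power series of
bounded degree in countably many variables that are invariant under every permutation of the
variables. The variable with index `i : ℕ` plays the role of `x_{i+1}`. -/
def SymFunc (R : Type*) [CommRing R] : Subalgebra R (MvPowerSeries ℕ R) where
  carrier := {f | (∀ e : Equiv.Perm ℕ, MvPowerSeries.rename e f = f) ∧
    ∃ d : ℕ, ∀ m : ℕ →₀ ℕ, MvPowerSeries.coeff m f ≠ 0 → m.degree ≤ d}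
  mul_mem' := by
    classical
    rintro f g ⟨hf, d, hd⟩ ⟨hg, d', hd'⟩
    refine ⟨fun e => by rw [map_mul, hf, hg], d + d', fun m hm => ?_⟩
    rw [MvPowerSeries.coeff_mul] at hm
    obtain ⟨p, hp, hne⟩ := Finset.exists_ne_zero_of_sum_ne_zero hm
    rw [← Finset.HasAntidiagonal.mem_antidiagonal.1 hp, map_add]
    exact add_le_add (hd _ (left_ne_zero_of_mul hne)) (hd' _ (right_ne_zero_of_mul hne))
  add_mem' := by
    rintro f g ⟨hf, d, hd⟩ ⟨hg, d', hd'⟩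
    refine ⟨fun e => by rw [map_add, hf, hg], max d d', fun m hm => ?_⟩
    by_contra! h
    rw [max_lt_iff] at h
    apply hm
    rw [map_add, not_imp_comm.1 (hd m) (not_le.2 h.1), not_imp_comm.1 (hd' m) (not_le.2 h.2),
      add_zero]
  algebraMap_mem' r := by
    classical
    refine ⟨fun e => AlgHom.commutes _ r, 0, fun m hm => ?_⟩
    rw [MvPowerSeries.algebraMap_apply, MvPowerSeries.coeff_C] at hm
    have : m = 0 := by
      by_contra h
      simp [h] at hm
    simp [this]

theorem embDomain_degree {α β : Type*} (e : α ↪ β) (m : α →₀ ℕ) :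
    (m.embDomain e).degree = m.degree := by
  simp [Finsupp.degree_apply]

theorem rename_perm_eq_iff {R : Type*} [CommRing R] (f : MvPowerSeries ℕ R) :
    (∀ e : Equiv.Perm ℕ, MvPowerSeries.rename e f = f) ↔
      ∀ (e : Equiv.Perm ℕ) (m : ℕ →₀ ℕ),
        MvPowerSeries.coeff (m.embDomain e.toEmbedding) f = MvPowerSeries.coeff m f := by
  have key : ∀ (e : Equiv.Perm ℕ) (m : ℕ →₀ ℕ),
      MvPowerSeries.coeff (m.embDomain e.toEmbedding) (MvPowerSeries.rename e f)
        = MvPowerSeries.coeff m f := fun e m =>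
    MvPowerSeries.coeff_embDomain_rename e.toEmbedding f m
  constructor
  · intro h e m
    have := key e m
    rwa [h] at this
  · intro h e
    ext m
    have hm : (m.embDomain e.symm.toEmbedding).embDomain e.toEmbedding = m := by
      ext i
      obtain ⟨i, rfl⟩ := e.surjective i
      obtain ⟨i, rfl⟩ := e.symm.surjective i
      have h1 := Finsupp.embDomain_apply_self e.toEmbedding
        (m.embDomain e.symm.toEmbedding) (e.symm i)
      have h2 := Finsupp.embDomain_apply_self e.symm.toEmbedding m i
      simp only [Equiv.coe_toEmbedding] at h1 h2
      rw [h1, h2, Equiv.apply_symm_apply]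
    have h3 := key e (m.embDomain e.symm.toEmbedding)
    rw [← h e, hm] at h3
    exact h3

theorem embDomain_perm_apply (e : Equiv.Perm ℕ) (m : ℕ →₀ ℕ) (i : ℕ) :
    m.embDomain e.toEmbedding (e i) = m i :=
  Finsupp.embDomain_apply_self e.toEmbedding m i

/-- The symmetric function with prescribed coefficients: `a m` is the coefficient of `x^m`. -/
def SymFunc.mk {R : Type*} [CommRing R] (a : (ℕ →₀ ℕ) → R) (d : ℕ)
    (ha : ∀ (e : Equiv.Perm ℕ) (m : ℕ →₀ ℕ), a (m.embDomain e.toEmbedding) = a m)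
    (hd : ∀ m : ℕ →₀ ℕ, a m ≠ 0 → m.degree ≤ d) : SymFunc R :=
  ⟨(a : MvPowerSeries ℕ R), (rename_perm_eq_iff (R := R) a).2 ha, d, hd⟩

theorem SymFunc.coeff_mk {R : Type*} [CommRing R] (a : (ℕ →₀ ℕ) → R) (d : ℕ)
    (ha : ∀ (e : Equiv.Perm ℕ) (m : ℕ →₀ ℕ), a (m.embDomain e.toEmbedding) = a m)
    (hd : ∀ m : ℕ →₀ ℕ, a m ≠ 0 → m.degree ≤ d) (m : ℕ →₀ ℕ) :
    MvPowerSeries.coeff m (SymFunc.mk a d ha hd : MvPowerSeries ℕ R) = a m := rfl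

open Classical in
/-- The elementary symmetric function `e_k`: the sum of all squarefree monomials of degree `k`. -/
def esym (R : Type*) [CommRing R] (k : ℕ) : SymFunc R :=
  SymFunc.mk (fun m => if m.degree = k ∧ ∀ i, m i ≤ 1 then 1 else 0) k
    (by
      intro e m
      have : (∀ i, m.embDomain e.toEmbedding i ≤ 1) ↔ ∀ i, m i ≤ 1 := by
        rw [e.surjective.forall]
        simp only [embDomain_perm_apply]
      simp only [embDomain_degree, this])
    (by
      intro m hm
      by_contra h
      exact hm (if_neg fun hh => h hh.1.le))

/-- The complete homogeneous symmetric function `h_k`: the sum of all monomials of degree `k`. -/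
def hsym (R : Type*) [CommRing R] (k : ℕ) : SymFunc R :=
  SymFunc.mk (fun m => if m.degree = k then 1 else 0) k
    (by
      intro e m
      simp only [embDomain_degree])
    (by
      intro m hm
      by_contra h
      exact hm (if_neg fun hh => h hh.le))

open Classical in
/-- The power sum symmetric function `p_k = ∑ᵢ xᵢ ^ k` (for `k ≥ 1`). -/
def psym (R : Type*) [CommRing R] (k : ℕ) : SymFunc R :=
  SymFunc.mk (fun m => if ∃ i, m = Finsupp.single i k then 1 else 0) k
    (by
      intro e m
      have : (∃ i, m.embDomain e.toEmbedding = Finsupp.single i k) ↔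
          ∃ i, m = Finsupp.single i k := by
        rw [e.surjective.exists]
        refine exists_congr fun i => ?_
        have := Finsupp.embDomain_single e.toEmbedding i k
        rw [Equiv.coe_toEmbedding] at this
        rw [← this, Finsupp.embDomain_inj]
      simp only [this])
    (by
      intro m hm
      by_contra h
      exact hm (if_neg fun ⟨i, hi⟩ => h (by rw [hi]; simp)))

/-! ### The involution `ω` -/

theorem zero_of_killCompl {R : Type*} [CommRing R] (f : SymFunc R) (N : ℕ)
    (hf : ∀ m : ℕ →₀ ℕ, MvPowerSeries.coeff m (f : MvPowerSeries ℕ R) ≠ 0 → m.degree ≤ N)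
    (h : MvPowerSeries.killCompl Fin.valEmbedding (f : MvPowerSeries ℕ R) =
      (0 : MvPowerSeries (Fin N) R)) : f = 0 := by
  apply Subtype.ext
  ext m
  by_contra hm
  have hm' : MvPowerSeries.coeff m (f : MvPowerSeries ℕ R) ≠ 0 := hm
  have hcard : m.support.card ≤ N := by
    refine le_trans ?_ (hf m hm')
    rw [Finsupp.degree_apply, Finset.card_eq_sum_ones]
    exact Finset.sum_le_sum fun i hi => Nat.one_le_iff_ne_zero.2 (Finsupp.mem_support_iff.1 hi)
  obtain ⟨e, he⟩ := Equiv.Perm.exists_extending_pair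
    (fun i : m.support => (i : ℕ)) (fun i => (m.support.equivFin i : ℕ))
    Subtype.val_injective (Fin.val_injective.comp m.support.equivFin.injective)
  have h1 := (rename_perm_eq_iff _).1 f.2.1 e m
  apply hm'
  rw [← h1]
  have hr : m.embDomain e.toEmbedding ∈
      Set.range (Finsupp.embDomain (M := ℕ) (Fin.valEmbedding (n := N))) := by
    rw [Finsupp.mem_range_embDomain_iff, Finsupp.support_embDomain]
    intro j hj
    rw [Finset.mem_coe, Finset.mem_map] at hj
    obtain ⟨i, hi, rfl⟩ := hj
    have := he ⟨i, hi⟩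
    refine ⟨⟨m.support.equivFin ⟨i, hi⟩, lt_of_lt_of_le (Fin.is_lt _) hcard⟩, ?_⟩
    exact this.symm
  obtain ⟨m', hm'⟩ := hr
  rw [← hm', ← MvPowerSeries.coeff_killCompl, h, map_zero]

theorem coeff_esymm_fin {R : Type*} [CommRing R] (N k : ℕ) :
    MvPowerSeries.killCompl Fin.valEmbedding (esym R k : MvPowerSeries ℕ R) =
      (MvPolynomial.esymm (Fin N) R k : MvPowerSeries (Fin N) R) := by
  classical
  ext m
  rw [MvPowerSeries.coeff_killCompl, esym, SymFunc.coeff_mk, MvPolynomial.coeff_coe,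
    MvPolynomial.esymm_eq_sum_monomial, MvPolynomial.coeff_sum]
  simp only [MvPolynomial.coeff_monomial, embDomain_degree]
  have hall : (∀ i, m.embDomain Fin.valEmbedding i ≤ 1) ↔ ∀ i, m i ≤ 1 := by
    constructor
    · intro h i
      have := h (Fin.valEmbedding i)
      rwa [Finsupp.embDomain_apply_self] at this
    · intro h i
      by_cases hi : i ∈ Set.range (Fin.valEmbedding (n := N))
      · obtain ⟨i, rfl⟩ := hi
        rw [Finsupp.embDomain_apply_self]
        exact h i
      · rw [Finsupp.embDomain_of_notMem_range _ _ _ hi]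
        exact zero_le_one
  rw [hall]
  have hs : ∀ (t : Finset (Fin N)) (i : Fin N),
      (∑ i ∈ t, Finsupp.single i 1 : Fin N →₀ ℕ) i = if i ∈ t then 1 else 0 := by
    intro t i
    rw [Finsupp.finsetSum_apply]
    simp [Finsupp.single_apply]
  split_ifs with h
  · rw [Finset.sum_eq_single m.support, if_pos]
    · ext i
      rw [hs]
      have := h.2 i
      split_ifs with h2
      · have := Finsupp.mem_support_iff.1 h2
        omega
      · exact (Finsupp.notMem_support_iff.1 h2).symm
    · intro t _ hne
      apply if_neg
      rintro rfl
      apply hne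
      ext i
      rw [Finsupp.mem_support_iff, hs]
      simp
    · intro hn
      exfalso
      apply hn
      rw [Finset.mem_powersetCard_univ, ← h.1, Finsupp.degree_apply, Finset.card_eq_sum_ones]
      refine Finset.sum_congr rfl fun i hi => ?_
      have h1 := h.2 i
      have h2 := Finsupp.mem_support_iff.1 hi
      omega
  · symm
    apply Finset.sum_eq_zero
    intro t ht
    apply if_neg
    rintro rfl
    apply h
    constructor
    · rw [map_sum]
      simpa using ht
    · intro i
      rw [hs]
      split_ifs <;> omega

theorem esym_degree (R : Type*) [CommRing R] (k : ℕ) (m : ℕ →₀ ℕ)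
    (hm : MvPowerSeries.coeff m (esym R k : MvPowerSeries ℕ R) ≠ 0) : m.degree = k := by
  rw [esym, SymFunc.coeff_mk] at hm
  by_contra h
  exact hm (if_neg fun hh => h hh.1)

theorem degree_of_coeff_mul {R : Type*} [CommRing R] (f g : MvPowerSeries ℕ R) (a b : ℕ)
    (hf : ∀ m : ℕ →₀ ℕ, MvPowerSeries.coeff m f ≠ 0 → m.degree = a)
    (hg : ∀ m : ℕ →₀ ℕ, MvPowerSeries.coeff m g ≠ 0 → m.degree = b)
    (m : ℕ →₀ ℕ) (hm : MvPowerSeries.coeff m (f * g) ≠ 0) : m.degree = a + b := by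
  classical
  rw [MvPowerSeries.coeff_mul] at hm
  obtain ⟨p, hp, hne⟩ := Finset.exists_ne_zero_of_sum_ne_zero hm
  rw [← Finset.HasAntidiagonal.mem_antidiagonal.1 hp, map_add,
    hf _ (left_ne_zero_of_mul hne), hg _ (right_ne_zero_of_mul hne)]

theorem degree_of_coeff_prod_esym (R : Type*) [CommRing R] {ι : Type*} (t : Finset ι) (k : ι → ℕ)
    (s : ι → ℕ) (m : ℕ →₀ ℕ)
    (hm : MvPowerSeries.coeff m (∏ i ∈ t, (esym R (k i) : MvPowerSeries ℕ R) ^ s i) ≠ 0) :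
    m.degree = ∑ i ∈ t, s i * k i := by
  classical
  have one : ∀ m : ℕ →₀ ℕ, MvPowerSeries.coeff m (1 : MvPowerSeries ℕ R) ≠ 0 →
      m.degree = 0 := by
    intro m hm
    rw [MvPowerSeries.coeff_one] at hm
    have : m = 0 := by
      by_contra h
      exact hm (if_neg h)
    simp [this]
  have pow : ∀ (i : ι) (a : ℕ) (m : ℕ →₀ ℕ),
      MvPowerSeries.coeff m ((esym R (k i) : MvPowerSeries ℕ R) ^ a) ≠ 0 →
        m.degree = a * k i := by
    intro i a
    induction a with
    | zero => simpa using one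
    | succ a ih =>
      rw [pow_succ, add_mul, one_mul]
      exact degree_of_coeff_mul _ _ _ _ ih (esym_degree R _)
  induction t using Finset.induction_on generalizing m with
  | empty => simpa using one m hm
  | insert i t hi ih =>
    rw [Finset.prod_insert hi] at hm
    rw [Finset.sum_insert hi]
    exact degree_of_coeff_mul _ _ _ _ (pow i _) ih m hm

/-- The homomorphism `R[X_0, X_1, …] → Λ_R` that sends `X_i` to `e_{i+1}`. -/
def esymHom (R : Type*) [CommRing R] : MvPolynomial ℕ R →ₐ[R] SymFunc R :=
  MvPolynomial.aeval fun i => esym R (i + 1)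

theorem killCompl_aeval_esym {R : Type*} [CommRing R] (N : ℕ) (P : MvPolynomial (Fin N) R) :
    MvPowerSeries.killCompl Fin.valEmbedding
      ((MvPolynomial.aeval (fun i : Fin N => esym R (i + 1)) P : SymFunc R) :
        MvPowerSeries ℕ R) =
      ((MvPolynomial.aeval (fun i : Fin N => MvPolynomial.esymm (Fin N) R (i + 1)) P :
        MvPolynomial (Fin N) R) : MvPowerSeries (Fin N) R) := by
  have : ((MvPowerSeries.killCompl Fin.valEmbedding).comp (SymFunc R).val).comp
      (MvPolynomial.aeval (fun i : Fin N => esym R (i + 1))) =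
      (MvPolynomial.coeToMvPowerSeries.algHom R).comp
        (MvPolynomial.aeval (fun i : Fin N => MvPolynomial.esymm (Fin N) R (i + 1))) := by
    apply MvPolynomial.algHom_ext
    intro i
    simp [coeff_esymm_fin]
  have h := AlgHom.congr_fun this P
  simpa using h

theorem esymHom_injective (R : Type*) [CommRing R] : Function.Injective (esymHom R) := by
  rw [injective_iff_map_eq_zero]
  intro P hP
  obtain ⟨s, Q, rfl⟩ := MvPolynomial.exists_finset_rename P
  obtain ⟨N, hN⟩ : ∃ N, ∀ i ∈ s, i < N := ⟨s.sup id + 1, fun i hi =>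
    Nat.lt_succ_of_le (Finset.le_sup (f := id) hi)⟩
  set g : s → Fin N := fun i => ⟨i, hN i i.2⟩ with hg
  have hr : MvPolynomial.rename ((↑) : s → ℕ) Q =
      MvPolynomial.rename (Fin.val (n := N)) (MvPolynomial.rename g Q) := by
    rw [MvPolynomial.rename_rename]
    rfl
  rw [hr] at hP ⊢
  set P := MvPolynomial.rename g Q
  rw [esymHom, MvPolynomial.aeval_rename] at hP
  have h := killCompl_aeval_esym N P
  have hP' : MvPolynomial.aeval (fun i : Fin N => esym R (i + 1)) P = 0 := hP
  rw [hP', ZeroMemClass.coe_zero, map_zero] at h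
  have h0 : MvPolynomial.aeval (fun i : Fin N => MvPolynomial.esymm (Fin N) R (i + 1)) P = 0 :=
    MvPolynomial.coe_injective _ _ (by rw [← h, MvPolynomial.coe_zero])
  have : P = 0 := by
    apply (MvPolynomial.esymmAlgHom_fin_bijective R N).1
    rw [map_zero]
    apply Subtype.ext
    rw [MvPolynomial.esymmAlgHom_apply, h0]
    rfl
  rw [this, map_zero]

theorem exists_symmetric_polynomial {R : Type*} [CommRing R] (f : SymFunc R) (N : ℕ) :
    ∃ q : MvPolynomial (Fin N) R, q.IsSymmetric ∧
      (q : MvPowerSeries (Fin N) R) =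
        MvPowerSeries.killCompl Fin.valEmbedding (f : MvPowerSeries ℕ R) := by
  obtain ⟨hf, d, hd⟩ := f.2
  have hq : ((MvPowerSeries.truncTotal (d + 1) (MvPowerSeries.killCompl
      (Fin.valEmbedding (n := N)) (f : MvPowerSeries ℕ R)) : MvPolynomial (Fin N) R) :
        MvPowerSeries (Fin N) R) =
      MvPowerSeries.killCompl Fin.valEmbedding (f : MvPowerSeries ℕ R) := by
    ext m
    rw [MvPolynomial.coeff_coe, MvPowerSeries.coeff_truncTotal_eq_ite]
    split_ifs with h
    · rfl
    · by_contra hne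
      apply h
      rw [MvPowerSeries.coeff_killCompl] at hne
      have := hd _ (Ne.symm hne)
      rw [embDomain_degree] at this
      omega
  refine ⟨_, ?_, hq⟩
  intro e
  apply MvPolynomial.ext
  intro m
  have hm : (m.mapDomain e.symm).mapDomain e = m := by
    rw [← Finsupp.mapDomain_comp]
    simp
  conv_lhs => rw [← hm]
  rw [MvPolynomial.coeff_rename_mapDomain _ e.injective, ← MvPolynomial.coeff_coe,
    ← MvPolynomial.coeff_coe, hq, MvPowerSeries.coeff_killCompl, MvPowerSeries.coeff_killCompl]
  obtain ⟨σ, hσ⟩ := Equiv.Perm.exists_extending_pair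
    (fun i : Fin N => (i : ℕ)) (fun i => (e i : ℕ)) Fin.val_injective
    (Fin.val_injective.comp e.injective)
  rw [← (rename_perm_eq_iff _).1 hf σ]
  congr 1
  have : (Finsupp.embDomain Fin.valEmbedding (m.mapDomain e.symm)).embDomain σ.toEmbedding
      = Finsupp.embDomain Fin.valEmbedding m := by
    simp only [Finsupp.embDomain_eq_mapDomain, ← Finsupp.mapDomain_comp]
    congr 1
    funext i
    have := hσ (e.symm i)
    simpa using this
  rw [this]

theorem esymHom_surjective (R : Type*) [CommRing R] : Function.Surjective (esymHom R) := by
  classical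
  intro f
  obtain ⟨d, hd⟩ := f.2.2
  obtain ⟨q, hq, hqf⟩ := exists_symmetric_polynomial f d
  obtain ⟨P, hP⟩ := (MvPolynomial.esymmAlgHom_fin_bijective R d).2 ⟨q, hq⟩
  have hP' : MvPolynomial.aeval (fun i : Fin d => MvPolynomial.esymm (Fin d) R (i + 1)) P = q := by
    rw [← MvPolynomial.esymmAlgHom_apply, hP]
  set w : (Fin d →₀ ℕ) → ℕ := fun s => ∑ i, s i * (i + 1) with hw
  set T : (Fin d →₀ ℕ) → SymFunc R := fun s =>
    MvPolynomial.aeval (fun i : Fin d => esym R (i + 1)) (MvPolynomial.monomial s (P.coeff s))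
    with hT
  have hTdeg : ∀ s m, MvPowerSeries.coeff m (T s : MvPowerSeries ℕ R) ≠ 0 → m.degree = w s := by
    intro s m hm
    have h2 : (T s : MvPowerSeries ℕ R) =
        P.coeff s • ∏ i : Fin d, (esym R ((i : ℕ) + 1) : MvPowerSeries ℕ R) ^ s i := by
      rw [hT]
      simp only [MvPolynomial.aeval_monomial]
      rw [Finsupp.prod_fintype _ _ (by simp), ← Algebra.smul_def]
      simp
    rw [h2, map_smul, smul_eq_mul] at hm
    exact degree_of_coeff_prod_esym R Finset.univ (fun i : Fin d => (i : ℕ) + 1) s m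
      (right_ne_zero_of_mul hm)
  have hsum : MvPolynomial.aeval (fun i : Fin d => esym R (i + 1)) P = ∑ s ∈ P.support, T s := by
    conv_lhs => rw [P.as_sum]
    rw [map_sum]
  set P' : MvPolynomial (Fin d) R := ∑ s ∈ P.support.filter (fun s => w s ≤ d),
    MvPolynomial.monomial s (P.coeff s) with hP'def
  set g : SymFunc R := ∑ s ∈ P.support.filter (fun s => w s ≤ d), T s with hg
  have hg' : g = MvPolynomial.aeval (fun i : Fin d => esym R (i + 1)) P' := by
    rw [hP'def, map_sum]
  have coeff_sum' : ∀ (A : Finset (Fin d →₀ ℕ)) (m : ℕ →₀ ℕ),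
      MvPowerSeries.coeff m ((∑ s ∈ A, T s : SymFunc R) : MvPowerSeries ℕ R) =
        ∑ s ∈ A, MvPowerSeries.coeff m (T s : MvPowerSeries ℕ R) := by
    intro A m
    rw [AddSubmonoidClass.coe_finsetSum, map_sum]
  have hgdeg : ∀ m, MvPowerSeries.coeff m (g : MvPowerSeries ℕ R) ≠ 0 → m.degree ≤ d := by
    intro m hm
    rw [hg, coeff_sum'] at hm
    obtain ⟨s, hs, hne⟩ := Finset.exists_ne_zero_of_sum_ne_zero hm
    rw [hTdeg s m hne]
    exact (Finset.mem_filter.1 hs).2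
  have hkill : ∀ m : ℕ →₀ ℕ, m ∈ Set.range (Finsupp.embDomain (M := ℕ) (Fin.valEmbedding (n := d))) →
      MvPowerSeries.coeff m (f : MvPowerSeries ℕ R) =
        ∑ s ∈ P.support, MvPowerSeries.coeff m (T s : MvPowerSeries ℕ R) := by
    rintro _ ⟨m, rfl⟩
    rw [← coeff_sum', ← hsum, ← MvPowerSeries.coeff_killCompl, ← MvPowerSeries.coeff_killCompl,
      killCompl_aeval_esym, hP', hqf]
  have hfg : f - g = 0 := by
    apply zero_of_killCompl (f - g) d
    · intro m hm
      by_contra h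
      apply hm
      rw [AddSubgroupClass.coe_sub, map_sub, not_imp_comm.1 (hd m) h,
        not_imp_comm.1 (hgdeg m) h, sub_zero]
    · ext m
      rw [MvPowerSeries.coeff_killCompl, AddSubgroupClass.coe_sub, map_sub, map_zero, sub_eq_zero]
      by_cases h : (m.embDomain (Fin.valEmbedding (n := d))).degree ≤ d
      · rw [hkill _ ⟨m, rfl⟩, hg, coeff_sum', Finset.sum_filter]
        refine Finset.sum_congr rfl fun s _ => ?_
        split_ifs with hws
        · rfl
        · by_contra hne
          rw [hTdeg s _ hne] at h
          exact hws h
      · rw [not_imp_comm.1 (hd _) h, not_imp_comm.1 (hgdeg _) h]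
  refine ⟨MvPolynomial.rename Fin.val P', ?_⟩
  rw [esymHom, MvPolynomial.aeval_rename, sub_eq_zero.1 hfg, hg']
  rfl

theorem sum_esym_mul_hsym (R : Type*) [CommRing R] (n : ℕ) (hn : n ≠ 0) :
    ∑ p ∈ Finset.HasAntidiagonal.antidiagonal n, (-1) ^ p.1 * (esym R p.1 * hsym R p.2) = 0 := by
  classical
  apply Subtype.ext
  ext m
  have h1 : MvPowerSeries.coeff m ((∑ p ∈ Finset.HasAntidiagonal.antidiagonal n,
      (-1) ^ p.1 * (esym R p.1 * hsym R p.2) : SymFunc R) : MvPowerSeries ℕ R) =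
      ∑ p ∈ Finset.HasAntidiagonal.antidiagonal n, ∑ q ∈ Finset.HasAntidiagonal.antidiagonal m,
        (-1 : R) ^ p.1 * ((if q.1.degree = p.1 ∧ ∀ i, q.1 i ≤ 1 then 1 else 0) *
          (if q.2.degree = p.2 then 1 else 0)) := by
    rw [AddSubmonoidClass.coe_finsetSum, map_sum]
    refine Finset.sum_congr rfl fun p _ => ?_
    have : (((-1) ^ p.1 * (esym R p.1 * hsym R p.2) : SymFunc R) : MvPowerSeries ℕ R) =
        ((-1 : R) ^ p.1) • ((esym R p.1 : MvPowerSeries ℕ R) * (hsym R p.2 : MvPowerSeries ℕ R)) := by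
      rw [Algebra.smul_def]
      simp
    rw [this, map_smul, smul_eq_mul, MvPowerSeries.coeff_mul, Finset.mul_sum]
    rfl
  rw [h1, Finset.sum_comm]
  have h2 : ∀ q ∈ Finset.HasAntidiagonal.antidiagonal m, ∑ p ∈ Finset.HasAntidiagonal.antidiagonal n,
      (-1 : R) ^ p.1 * ((if q.1.degree = p.1 ∧ ∀ i, q.1 i ≤ 1 then 1 else 0) *
          (if q.2.degree = p.2 then 1 else 0)) =
      if m.degree = n then (if ∀ i, q.1 i ≤ 1 then (-1 : R) ^ q.1.degree else 0) else 0 := by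
    intro q hq
    have hqm : m.degree = q.1.degree + q.2.degree := by
      rw [← Finset.HasAntidiagonal.mem_antidiagonal.1 hq, map_add]
    by_cases hmn : m.degree = n
    · rw [if_pos hmn, Finset.sum_eq_single (q.1.degree, q.2.degree)]
      · simp
      · rintro ⟨a, b⟩ _ hne
        by_cases ha : q.1.degree = a
        · have hb : q.2.degree ≠ b := by
            rintro rfl
            exact hne (by rw [ha])
          simp [hb]
        · simp [ha]
      · intro h
        exact absurd (Finset.HasAntidiagonal.mem_antidiagonal.2 (by rw [← hmn, hqm])) h
    · rw [if_neg hmn]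
      apply Finset.sum_eq_zero
      rintro ⟨a, b⟩ hab
      rw [Finset.HasAntidiagonal.mem_antidiagonal] at hab
      by_cases ha : q.1.degree = a
      · have hb : q.2.degree ≠ b := by
          rintro rfl
          exact hmn (by rw [hqm, ha, hab])
        simp [hb]
      · simp [ha]
  rw [Finset.sum_congr rfl h2]
  by_cases hmn : m.degree = n
  swap
  · simp [hmn]
  simp only [if_pos hmn]
  rw [← Finset.sum_filter]
  have hne : m.support.Nonempty := by
    rw [Finsupp.support_nonempty_iff]
    rintro rfl
    exact hn (by rw [← hmn, map_zero])
  have h3 : ∑ S ∈ m.support.powerset, (-1 : R) ^ S.card = 0 := by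
    have := congrArg (Int.cast : ℤ → R) (Finset.sum_powerset_neg_one_pow_card_of_nonempty hne)
    simpa using this
  have hind : ∀ (S : Finset ℕ) (i : ℕ),
      (∑ i ∈ S, Finsupp.single i 1 : ℕ →₀ ℕ) i = if i ∈ S then 1 else 0 := by
    intro S i
    rw [Finsupp.finsetSum_apply]
    simp [Finsupp.single_apply]
  refine Eq.trans (Eq.symm ?_) h3
  refine Finset.sum_nbij' (fun S => (∑ i ∈ S, Finsupp.single i 1, m - ∑ i ∈ S, Finsupp.single i 1))
    (fun q => q.1.support) ?_ ?_ ?_ ?_ ?_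
  · intro S hS
    rw [Finset.mem_powerset] at hS
    rw [Finset.mem_filter, Finset.HasAntidiagonal.mem_antidiagonal]
    refine ⟨?_, fun i => ?_⟩
    · ext i
      rw [Finsupp.add_apply, Finsupp.tsub_apply, hind]
      split_ifs with h
      · have := Finsupp.mem_support_iff.1 (hS h)
        omega
      · omega
    · change (∑ i ∈ S, Finsupp.single i 1 : ℕ →₀ ℕ) i ≤ 1
      rw [hind]
      split_ifs <;> omega
  · rintro ⟨a, b⟩ hq
    rw [Finset.mem_filter, Finset.HasAntidiagonal.mem_antidiagonal] at hq
    rw [Finset.mem_powerset]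
    intro i hi
    have h4 := Finsupp.mem_support_iff.1 hi
    have h5 := DFunLike.congr_fun hq.1 i
    rw [Finsupp.mem_support_iff]
    simp only [Finsupp.add_apply] at h5
    simp only at h4
    omega
  · intro S _
    ext i
    rw [Finsupp.mem_support_iff, hind]
    simp
  · rintro ⟨a, b⟩ hq
    rw [Finset.mem_filter, Finset.HasAntidiagonal.mem_antidiagonal] at hq
    have ha : (∑ i ∈ a.support, Finsupp.single i 1 : ℕ →₀ ℕ) = a := by
      ext i
      rw [hind]
      have := hq.2 i
      simp only at this
      split_ifs with h
      · have := Finsupp.mem_support_iff.1 h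
        omega
      · exact (Finsupp.notMem_support_iff.1 h).symm
    simp only [ha]
    rw [← hq.1]
    simp
  · intro S _
    simp

theorem neg_one_pow_mul_self (A : Type*) [CommRing A] (k : ℕ) :
    (-1 : A) ^ k * (-1) ^ k = 1 := by
  rw [← mul_pow]
  simp

theorem eq_of_alternating_sums {A : Type*} [CommRing A] (a b c : ℕ → A) (hab : a 0 = b 0)
    (hc : c 0 = 1)
    (ha : ∀ n, n ≠ 0 → ∑ p ∈ Finset.HasAntidiagonal.antidiagonal n, (-1) ^ p.1 * (a p.1 * c p.2) = 0)
    (hb : ∀ n, n ≠ 0 → ∑ p ∈ Finset.HasAntidiagonal.antidiagonal n, (-1) ^ p.1 * (b p.1 * c p.2) = 0)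
    (n : ℕ) : a n = b n := by
  induction n using Nat.strong_induction_on with
  | _ n ih =>
    rcases Nat.eq_zero_or_pos n with rfl | hn
    · exact hab
    have h1 := ha n hn.ne'
    rw [← hb n hn.ne', Finset.Nat.sum_antidiagonal_eq_sum_range_succ_mk,
      Finset.Nat.sum_antidiagonal_eq_sum_range_succ_mk, Finset.sum_range_succ,
      Finset.sum_range_succ] at h1
    have h2 : ∑ i ∈ Finset.range n, (-1) ^ i * (a i * c (n - i)) =
        ∑ i ∈ Finset.range n, (-1) ^ i * (b i * c (n - i)) :=
      Finset.sum_congr rfl fun i hi => by rw [ih i (Finset.mem_range.1 hi)]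
    simp only [h2, Nat.sub_self, hc, mul_one] at h1
    have h3 := add_left_cancel h1
    have h4 := neg_one_pow_mul_self A n
    calc a n = (-1) ^ n * ((-1) ^ n * a n) := by rw [← mul_assoc, h4, one_mul]
      _ = b n := by rw [h3, ← mul_assoc, h4, one_mul]

theorem sum_hsym_mul_esym (R : Type*) [CommRing R] (n : ℕ) (hn : n ≠ 0) :
    ∑ p ∈ Finset.HasAntidiagonal.antidiagonal n, (-1) ^ p.1 * (hsym R p.1 * esym R p.2) = 0 := by
  have h := sum_esym_mul_hsym R n hn
  rw [← Finset.Nat.sum_antidiagonal_swap] at h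
  have h' := congrArg (fun x => (-1) ^ n * x) h
  simp only [mul_zero, Finset.mul_sum] at h'
  rw [← h']
  refine Finset.sum_congr rfl fun p hp => ?_
  rw [Finset.HasAntidiagonal.mem_antidiagonal] at hp
  have h4 := neg_one_pow_mul_self (SymFunc R) p.2
  rw [← hp, pow_add, Prod.fst_swap, Prod.snd_swap, mul_comm (hsym R p.1)]
  linear_combination (-((-1) ^ p.1 * (esym R p.2 * hsym R p.1))) * h4

theorem esym_zero (R : Type*) [CommRing R] : esym R 0 = 1 := by
  classical
  apply Subtype.ext
  ext m
  rw [esym, SymFunc.coeff_mk, OneMemClass.coe_one, MvPowerSeries.coeff_one]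
  congr 1
  rw [Finsupp.degree_eq_zero_iff, eq_iff_iff]
  constructor
  · exact fun h => h.1
  · rintro rfl
    simp

theorem hsym_zero (R : Type*) [CommRing R] : hsym R 0 = 1 := by
  classical
  apply Subtype.ext
  ext m
  rw [hsym, SymFunc.coeff_mk, OneMemClass.coe_one, MvPowerSeries.coeff_one]
  simp only [Finsupp.degree_eq_zero_iff]

theorem existsUnique_omega (R : Type*) [CommRing R] :
    ∃! φ : SymFunc R →ₐ[R] SymFunc R, ∀ k, φ (hsym R k) = esym R k := by
  set E := AlgEquiv.ofBijective (esymHom R) ⟨esymHom_injective R, esymHom_surjective R⟩ with hE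
  have hEX : ∀ i, E (MvPolynomial.X i) = esym R (i + 1) := fun i => by
    have : E (MvPolynomial.X i) = esymHom R (MvPolynomial.X i) := rfl
    rw [this, esymHom, MvPolynomial.aeval_X]
  have hmap : ∀ (φ : SymFunc R →ₐ[R] SymFunc R) (n : ℕ), n ≠ 0 →
      ∑ p ∈ Finset.HasAntidiagonal.antidiagonal n, (-1) ^ p.1 * (φ (esym R p.1) * φ (hsym R p.2)) = 0 := by
    intro φ n hn
    have := congrArg φ (sum_esym_mul_hsym R n hn)
    simpa using this
  have hmap' : ∀ (φ : SymFunc R →ₐ[R] SymFunc R) (n : ℕ), n ≠ 0 →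
      ∑ p ∈ Finset.HasAntidiagonal.antidiagonal n, (-1) ^ p.1 * (φ (hsym R p.1) * φ (esym R p.2)) = 0 := by
    intro φ n hn
    have := congrArg φ (sum_hsym_mul_esym R n hn)
    simpa using this
  refine ⟨(MvPolynomial.aeval fun i => hsym R (i + 1)).comp (E.symm : SymFunc R →ₐ[R] _), ?_, ?_⟩
  · set φ : SymFunc R →ₐ[R] SymFunc R :=
      (MvPolynomial.aeval fun i => hsym R (i + 1)).comp (E.symm : SymFunc R →ₐ[R] _) with hφ
    have he : ∀ k, φ (esym R k) = hsym R k := by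
      intro k
      cases k with
      | zero => rw [esym_zero, hsym_zero, map_one]
      | succ k =>
        rw [← hEX, hφ]
        simp
    refine eq_of_alternating_sums (fun k => φ (hsym R k)) (esym R) (hsym R) ?_ (hsym_zero R) ?_ ?_
    · simp [hsym_zero, esym_zero]
    · intro n hn
      have := hmap' φ n hn
      simpa only [he] using this
    · exact sum_esym_mul_hsym R
  · intro ψ hψ
    have he : ∀ k, ψ (esym R k) = hsym R k := by
      refine eq_of_alternating_sums (fun k => ψ (esym R k)) (hsym R) (esym R) ?_ (esym_zero R) ?_ ?_
      · simp [hsym_zero, esym_zero]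
      · intro n hn
        have := hmap ψ n hn
        simpa only [hψ] using this
      · exact sum_hsym_mul_esym R
    apply AlgHom.ext
    intro f
    obtain ⟨P, rfl⟩ := E.surjective f
    have : (ψ.comp (E : _ →ₐ[R] SymFunc R)) = MvPolynomial.aeval fun i => hsym R (i + 1) := by
      apply MvPolynomial.algHom_ext
      intro i
      simp [hEX, he]
    have h2 := AlgHom.congr_fun this P
    simpa using h2

/-- The involution `ω` of `Λ_R`: the unique algebra endomorphism that sends the complete
homogeneous symmetric function `h_k` to the elementary symmetric function `e_k` for all `k`. -/
def omega (R : Type*) [CommRing R] : SymFunc R →ₐ[R] SymFunc R :=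
  (existsUnique_omega R).choose

theorem omega_hsym (R : Type*) [CommRing R] (k : ℕ) : omega R (hsym R k) = esym R k :=
  (existsUnique_omega R).choose_spec.1 k

/-- The power sum symmetric function `p_λ = ∏ᵢ p_{λᵢ}` of a partition. -/
def psymPart (R : Type*) [CommRing R] {n : ℕ} (lam : n.Partition) : SymFunc R :=
  (lam.parts.map (psym R)).prod

/-- `z_λ = ∏ᵢ mᵢ(λ)! i ^ mᵢ(λ)`, where `mᵢ(λ)` is the multiplicity of the part `i` in `λ`. -/
def zPart {n : ℕ} (lam : n.Partition) : ℕ :=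
  ∏ i ∈ lam.parts.toFinset, (lam.parts.count i).factorial * i ^ lam.parts.count i

/-! ### Polynomials in `t`; the indeterminate `t` is `Polynomial.X` -/

/-- `[m]_t = 1 + t + ⋯ + t^{m-1}`. -/
def qInt (m : ℕ) : ℚ[X] := ∑ i ∈ Finset.range m, Polynomial.X ^ i

/-- The number of ascents of the word `σ(0) σ(1) ⋯ σ(m-1)`. -/
def permAsc {m : ℕ} (σ : Equiv.Perm (Fin m)) : ℕ :=
  Set.ncard {i : Fin m | ∃ j : Fin m, (j : ℕ) = i + 1 ∧ σ i < σ j}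

/-- The Eulerian polynomial `A_m(t) = ∑_{σ ∈ S_m} t^{asc σ}`. -/
def eulerianPoly (m : ℕ) : ℚ[X] := ∑ σ : Equiv.Perm (Fin m), Polynomial.X ^ permAsc σ

/-! ### Digraphs and their chromatic quasisymmetric functions -/

/-- The directed cycle on the vertices `v 0, v 1, …, v (n-1)`, with edges `(v i, v (i+1))` for
`i + 1 < n` and `(v (n-1), v 0)`. -/
def dirCycle {n : ℕ} (v : Equiv.Perm (Fin n)) : Digraph (Fin n) where
  Adj a b := ∃ i j : Fin n, v i = a ∧ v j = b ∧ (j : ℕ) = (i + 1) % n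

/-- A proper coloring of a digraph is a proper coloring of the underlying undirected graph. -/
def IsProperColoring {V : Type*} (D : Digraph V) (κ : V → ℕ) : Prop :=
  ∀ a b, D.toSimpleGraphInclusive.Adj a b → κ a ≠ κ b

/-- The number of ascents of a coloring: directed edges `(a, b)` with `κ a < κ b`. -/
def colorAsc {V : Type*} (D : Digraph V) (κ : V → ℕ) : ℕ :=
  Set.ncard {e : V × V | D.Adj e.1 e.2 ∧ κ e.1 < κ e.2}

/-- The exponent of the monomial `x_κ = ∏ᵥ x_{κ(v)}`. -/
def colorExponent {V : Type*} [Fintype V] (κ : V → ℕ) : ℕ →₀ ℕ :=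
  ∑ v, Finsupp.single (κ v) 1

/-- The chromatic quasisymmetric function `∑_κ t^{asc κ} x_κ`, the sum being over all proper
colorings. The coefficient of `x^m` is the sum of `t^{asc κ}` over the (finitely many) proper
colorings `κ` with `x_κ = x^m`. -/
def chromaticQSym {V : Type*} [Fintype V] (D : Digraph V) : MvPowerSeries ℕ ℚ[X] :=
  fun m => ∑ᶠ κ ∈ {κ : V → ℕ | IsProperColoring D κ ∧ colorExponent κ = m},
    Polynomial.X ^ colorAsc D κ

theorem finite_colorings {V : Type*} [Fintype V] (m : ℕ →₀ ℕ) :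
    {κ : V → ℕ | colorExponent κ = m}.Finite := by
  classical
  refine (Fintype.piFinset fun _ : V => m.support).finite_toSet.subset fun κ hκ => ?_
  rw [Finset.mem_coe, Fintype.mem_piFinset]
  rintro v
  have h : colorExponent κ = m := hκ
  rw [← h, Finsupp.mem_support_iff, colorExponent, Finsupp.finsetSum_apply]
  intro h0
  have := Finset.sum_eq_zero_iff.1 h0 v (Finset.mem_univ v)
  simp at this

/-! ### Inversions, ranks and descents with respect to a graph

A permutation `σ` of `Fin n` is read as the word `σ 0, σ 1, …, σ (n-1)`. -/

/-- The number of `D`-inversions of `σ`: directed edges `(a, b)` such that `b` precedes `a`. -/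
def digraphInv {n : ℕ} (D : Digraph (Fin n)) (σ : Equiv.Perm (Fin n)) : ℕ :=
  Set.ncard {e : Fin n × Fin n | D.Adj e.1 e.2 ∧ σ.symm e.2 < σ.symm e.1}

/-- The `(G, σ)`-rank of `x`: the length of the longest subword of `σ` that ends in `x` and whose
consecutive letters are adjacent in `G`. The list `l` is the list of positions of the subword. -/
def graphRank {n : ℕ} (G : SimpleGraph (Fin n)) (σ : Equiv.Perm (Fin n)) (x : Fin n) : ℕ :=
  sSup {k | ∃ l : List (Fin n), l.Pairwise (· < ·) ∧ (l.map σ).IsChain G.Adj ∧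
    (l.map σ).getLast? = some x ∧ l.length = k}

/-- `σ` has a `G`-descent between the adjacent positions `i` and `j = i + 1`. -/
def IsGraphDescent {n : ℕ} (G : SimpleGraph (Fin n)) (σ : Equiv.Perm (Fin n))
    (i j : Fin n) : Prop :=
  (j : ℕ) = i + 1 ∧ (graphRank G σ (σ j) < graphRank G σ (σ i) ∨
    graphRank G σ (σ i) = graphRank G σ (σ j) ∧ σ j < σ i)

/-- For a list `L = (λ₁, …, λ_l)` of sizes, position `p` lies in the segment with index `i`
(counted from `0`) when words are cut into contiguous segments of sizes `λ₁, …, λ_l`. -/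
def InSegment (L : List ℕ) (i p : ℕ) : Prop :=
  i < L.length ∧ (L.take i).sum ≤ p ∧ p < (L.take (i + 1)).sum

/-- The letter at position `q` is `G`-isolated in the segment with index `i`: it is not the first
letter of the segment, and no earlier letter of the segment is adjacent to it. -/
def IsIsolatedIn {n : ℕ} (G : SimpleGraph (Fin n)) (σ : Equiv.Perm (Fin n)) (L : List ℕ) (i : ℕ)
    (q : Fin n) : Prop :=
  InSegment L i q ∧ (L.take i).sum < q ∧
    ∀ p : Fin n, InSegment L i p → p < q → ¬ G.Adj (σ p) (σ q)

/-- The set `N_λ(G)` of all permutations `σ` such that, when `σ` is cut into contiguous segments of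
sizes `λ₁ ≥ λ₂ ≥ ⋯`, no segment has a `G`-isolated letter or contains a `G`-descent of `σ`. -/
def NSet {n : ℕ} (G : SimpleGraph (Fin n)) (lam : n.Partition) : Set (Equiv.Perm (Fin n)) :=
  {σ | ∀ i : ℕ,
    (∀ q : Fin n, ¬ IsIsolatedIn G σ (lam.parts.sort (· ≥ ·)) i q) ∧
    ∀ p q : Fin n, InSegment (lam.parts.sort (· ≥ ·)) i p →
      InSegment (lam.parts.sort (· ≥ ·)) i q → ¬ IsGraphDescent G σ p q}

open Classical in
/-- `∑_{σ ∈ N_λ(G)} t^{inv_D(σ)}`, where `G` is the underlying undirected graph of `D`. -/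
def invSum {n : ℕ} (D : Digraph (Fin n)) (lam : n.Partition) : ℚ[X] :=
  ∑ σ : Equiv.Perm (Fin n) with σ ∈ NSet D.toSimpleGraphInclusive lam,
    Polynomial.X ^ digraphInv D σ

end

end CycleChromatic

namespace CycleChromatic

noncomputable section

open Finset

/-! Parts (1) and (2) are a bijection followed by a count. Color each vertex of the cycle by the
segment of σ that contains it, and orient each edge from its earlier to its later letter; inversions
are the reversed edges. A segment has no isolated letter exactly when its color class has only one
source, and edges between classes point to the larger color. Conversely, ranks depend only on the
orientation, and a word without descents inside its segments is sorted by (segment, rank, letter),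
so σ is recovered from these data (`cycleData_injOn`, `exists_cycleData_eq`).

If there are k ≥ 2 colors, a class with one source is a single arc, because every other vertex of
the class needs an edge inside it (`IsSourced.existsUnique_exit`). Rotating the start of the arc of
color 0 to position 0 costs a factor n. What remains is a cyclic order of the arcs, whose cyclic
descents are the reversed edges between arcs and give t A_{k-1}(t), and for each arc the position of
its source, which gives [λ_i]_t (`sum_isSourced_isStart`). With one color, an orientation of the
cycle with its only source at 0 is a forward run followed by a reversed run, both nonempty, which
gives t [n-1]_t.

Part (3) uses a transfer matrix. Colorings of the cycle by N colors are closed walks, so X is the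
trace of B^n with B_{ij} = t x_j for i < j, x_j for i > j, and 0 for i = j. Jacobi's formula writes
∑ tr(B^{k+1}) z^k as -D'/D for D = det(1 - zB), and a rank one perturbation gives (t-1) D = t E(z) -
E(tz), where E(z) = ∏(1 + x_j z) (`det_one_sub_transferMatrix`). Thus X is a coefficient of -D'/D
over the ring of symmetric functions, and ω replaces e_k by h_k.

Let H be the generating function of the h_k, P = H'/H that of the power sums, and Q = ∑ [k]_t p_k
z^k / k. Then H(tz) = H(z) exp((t-1)Q). With the exponential generating function 𝓐 of the Eulerian
polynomials this yields D · 𝓐(Q) = H, hence -D'/D = Q' (t 𝓐(Q) - t + 1) - P (`cycleLogDeriv_eq`).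
The multinomial theorem expands Q' 𝓐(Q) over partitions; the other terms only affect p_n. The closed
form of 𝓐 is itself read off from the squarefree coefficients of X. Uniqueness of the expansion is
the linear independence of the p_λ (`linearIndependent_psymPart`). -/

/-! ### Rotations and cyclic descents. -/

theorem sum_eq_smul_sum_of_rotation {n : ℕ} [NeZero n] {β M : Type*} [AddCommMonoid M]
    (S : Finset (Fin n → β)) (F : (Fin n → β) → M) (P : (Fin n → β) → Fin n → Prop)
    [∀ r, DecidablePred fun f => P f r]
    (hS : ∀ f r, f ∈ S → (fun i => f (i + r)) ∈ S)
    (hF : ∀ f r, F (fun i => f (i + r)) = F f)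
    (hP : ∀ f r s, P (fun i => f (i + r)) s ↔ P f (s + r))
    (hu : ∀ f ∈ S, ∃! r, P f r) :
    ∑ f ∈ S, F f = n • ∑ f ∈ S with P f 0, F f := by
  classical
  -- Each `f` is counted once, at its only marked position. Rotating the mark to 0 shows that all n
  -- positions contribute equally.
  have h1 : ∑ f ∈ S, F f = ∑ f ∈ S, ∑ r : Fin n, if P f r then F f else 0 := by
    refine sum_congr rfl fun f hf => ?_
    obtain ⟨r, hr, hr'⟩ := hu f hf
    rw [sum_eq_single r, if_pos hr]
    · intro s _ hs
      exact if_neg fun h => hs (hr' s h)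
    · simp
  have h2 : ∀ r : Fin n, ∑ f ∈ S, (if P f r then F f else 0) = ∑ f ∈ S with P f 0, F f := by
    intro r
    rw [← sum_filter]
    refine sum_nbij' (fun f i => f (i + r)) (fun f i => f (i + -r)) ?_ ?_ ?_ ?_ ?_
    · intro f hf
      rw [mem_filter] at hf ⊢
      exact ⟨hS f r hf.1, by rw [hP]; simpa using hf.2⟩
    · intro f hf
      rw [mem_filter] at hf ⊢
      exact ⟨hS f _ hf.1, by rw [hP]; simpa using hf.2⟩
    · intro f _
      funext i
      simp
    · intro f _
      funext i
      simp
    · intro f _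
      exact (hF f r).symm
  rw [h1, sum_comm, sum_congr rfl fun r _ => h2 r]
  simp

/-- The number of cyclic descents of the word `f 0, f 1, …, f (n-1)`. -/
def cyclicDescents {n : ℕ} [NeZero n] {α : Type*} [LinearOrder α] (f : Fin n → α) : ℕ :=
  #{i | f (i + 1) < f i}

theorem card_filter_rotate {n : ℕ} [NeZero n] (p : Fin n → Prop) [DecidablePred p] (r : Fin n) :
    #{i | p (i + r)} = #{i | p i} := by
  refine card_nbij' (· + r) (· - r) ?_ ?_ ?_ ?_ <;> intro i hi <;> simp_all

theorem card_descents_eq_permAsc {m : ℕ} (e : Equiv.Perm (Fin m)) :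
    #{j : Fin m | ∃ j' : Fin m, (j' : ℕ) = j + 1 ∧ e j' < e j} = permAsc (e.trans Fin.revPerm) := by
  classical
  rw [permAsc, Set.ncard_eq_toFinset_card']
  congr 1
  ext j
  simp

/-- The smallest letter comes first: the step out of it is an ascent, and the step that wraps around
into it is the extra descent. All other steps are those of `e`, shifted by one. -/
theorem cyclicDescents_decomposeFin {m : ℕ} (hm : m ≠ 0) (e : Equiv.Perm (Fin m)) :
    cyclicDescents (Equiv.Perm.decomposeFin.symm ((0 : Fin (m + 1)), e)) =
      #{j : Fin m | ∃ j' : Fin m, (j' : ℕ) = j + 1 ∧ e j' < e j} + 1 := by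
  classical
  set w := Equiv.Perm.decomposeFin.symm ((0 : Fin (m + 1)), e) with hw
  have w0 : w 0 = 0 := by simp [hw]
  have ws : ∀ j : Fin m, w j.succ = (e j).succ := fun j => by simp [hw]
  rw [cyclicDescents, ← card_map (Fin.succEmb m), ← card_insert_of_notMem (a := Fin.last m)]
  · congr 1
    ext i
    simp only [mem_filter, mem_univ, true_and, mem_insert, mem_map, Fin.coe_succEmb]
    constructor
    · intro h
      by_cases hi : i = Fin.last m
      · exact Or.inl hi
      right
      induction i using Fin.cases with
      | zero => simp [w0] at h
      | succ j =>
        have hj : (j : ℕ) + 1 < m := by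
          have : (j : ℕ) + 1 ≠ m := fun h' => hi (Fin.ext (by simpa using h'))
          omega
        refine ⟨j, ⟨⟨j + 1, hj⟩, rfl, ?_⟩, rfl⟩
        have h2 : j.succ + 1 = (⟨j + 1, hj⟩ : Fin m).succ := by
          apply Fin.ext
          rw [Fin.val_add_one_of_lt (Fin.lt_last_iff_ne_last.2 hi)]
          rfl
        rw [h2, ws, ws] at h
        simpa using h
    · rintro (rfl | ⟨j, ⟨j', hj, h⟩, rfl⟩)
      · obtain ⟨m, rfl⟩ := Nat.exists_eq_succ_of_ne_zero hm
        have : Fin.last (m + 1) = (Fin.last m).succ := rfl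
        rw [Fin.last_add_one, w0, this, ws]
        exact Fin.succ_pos _
      · have h2 : j.succ + 1 = j'.succ := by
          apply Fin.ext
          rw [Fin.val_add_one_of_lt (Fin.lt_last_iff_ne_last.2 ?_)]
          · simp [hj]
          · intro h3
            have := congrArg Fin.val h3
            simp at this
            omega
        rw [h2, ws, ws]
        simpa using h
  · simp only [mem_map, mem_filter, mem_univ, true_and, Fin.coe_succEmb, not_exists, not_and]
    rintro j ⟨j', hj, h⟩ h3
    have := congrArg Fin.val h3
    simp at this
    omega

/-- The wrap-around descent is the factor t. Reversing the values turns the remaining descents into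
the ascents that the Eulerian polynomial counts. -/
theorem sum_cyclicDescents_fix_zero {m : ℕ} (hm : m ≠ 0) :
    ∑ w : Equiv.Perm (Fin (m + 1)) with w 0 = 0, (Polynomial.X : ℚ[X]) ^ cyclicDescents w =
      Polynomial.X * eulerianPoly m := by
  classical
  rw [eulerianPoly, mul_sum]
  symm
  refine sum_bij (fun e _ => Equiv.Perm.decomposeFin.symm ((0 : Fin (m + 1)), e.trans Fin.revPerm))
    ?_ ?_ ?_ ?_
  · intro e _
    simp
  · intro e _ e' _ h
    have := congrArg (Equiv.Perm.decomposeFin) h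
    simp only [Equiv.apply_symm_apply, Prod.mk.injEq, true_and] at this
    ext i
    have h2 := congrArg (fun f => f i) this
    simp only [Equiv.trans_apply, Fin.revPerm_apply, Fin.rev_inj] at h2
    rw [h2]
  · intro w hw
    obtain ⟨⟨p, e⟩, rfl⟩ := Equiv.Perm.decomposeFin.symm.surjective w
    simp only [mem_filter, mem_univ, true_and] at hw
    have : p = 0 := by simpa using hw
    subst this
    refine ⟨e.trans Fin.revPerm, mem_univ _, ?_⟩
    congr 2
    ext
    simp
  · intro e _
    rw [cyclicDescents_decomposeFin hm, card_descents_eq_permAsc, pow_succ, mul_comm]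
    congr 3
    ext
    simp

theorem sum_cyclicDescents {k : ℕ} [NeZero k] (hk : 2 ≤ k) :
    ∑ w : Equiv.Perm (Fin k), (Polynomial.X : ℚ[X]) ^ cyclicDescents w =
      (k : ℚ[X]) * Polynomial.X * eulerianPoly (k - 1) := by
  classical
  -- Rotation acts on functions, so the sum is moved from permutations to bijective functions; the
  -- marked position is that of the letter 0.
  have key : ∀ (p : (Fin k → Fin k) → Prop) [DecidablePred p],
      ∑ w ∈ (univ : Finset (Equiv.Perm (Fin k))).filter (fun w : Equiv.Perm (Fin k) => p ⇑w), (Polynomial.X : ℚ[X]) ^ cyclicDescents w =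
      ∑ f ∈ {f : Fin k → Fin k | Function.Bijective f} with p f,
        (Polynomial.X : ℚ[X]) ^ cyclicDescents f := by
    intro p _
    refine sum_bij (fun w _ => w) ?_ ?_ ?_ ?_
    · intro w hw
      rw [mem_filter] at hw
      exact mem_filter.2 ⟨mem_filter.2 ⟨mem_univ _, w.bijective⟩, hw.2⟩
    · intro w _ w' _ h
      exact DFunLike.coe_injective h
    · intro f hf
      simp only [mem_filter, mem_univ, true_and] at hf
      exact ⟨Equiv.ofBijective f hf.1, by simpa using hf.2, rfl⟩
    · intro w _
      rfl
  have h1 := key (fun _ => True)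
  simp only [filter_true] at h1
  rw [h1, sum_eq_smul_sum_of_rotation _ _ (fun f r => f r = 0)]
  · rw [← key (fun f => f 0 = 0)]
    obtain ⟨m, rfl⟩ : ∃ m, k = m + 1 := ⟨k - 1, by omega⟩
    have := sum_cyclicDescents_fix_zero (m := m) (by omega)
    rw [Nat.add_sub_cancel, nsmul_eq_mul, mul_assoc, ← this]
  · intro f r hf
    simp only [mem_filter, mem_univ, true_and] at hf ⊢
    exact hf.comp (Equiv.addRight r).bijective
  · intro f r
    rw [cyclicDescents, cyclicDescents]
    have := card_filter_rotate (fun i => f (i + 1) < f i) r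
    rw [← this]
    simp only [add_right_comm]
  · intro f r s
    rfl
  · intro f hf
    simp only [mem_filter, mem_univ, true_and] at hf
    exact hf.existsUnique 0

/-! ### Orientations of a path with one source. -/

/-- `p` has no in-edge inside a path of length `m` whose edge `p → p + 1` is reversed iff `f p`. -/
def IsPathSource {m : ℕ} (f : Fin m → Bool) (p : Fin m) : Prop :=
  (∀ p' : Fin m, (p' : ℕ) + 1 = p → f p' = true) ∧ ((p : ℕ) + 1 < m → f p = false)

/-- All edges flow away from the source. A forward edge before `s` would produce a source before
`s`, namely the tail of the first forward edge; a reversed edge at or after `s` would produce a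
source after it, where the run of reversed edges stops. -/
theorem eq_decide_lt_of_existsUnique_source {m : ℕ} (f : Fin m → Bool) (s : Fin m)
    (hs : ∀ p, IsPathSource f p ↔ p = s) (p : Fin m) (hp : (p : ℕ) + 1 < m) :
    f p = decide (p < s) := by
  classical
  by_cases hps : p < s
  · rw [decide_eq_true hps]
    by_contra hf
    rw [Bool.not_eq_true] at hf
    have hne : ({q : Fin m | q ≤ p ∧ f q = false} : Finset (Fin m)).Nonempty := ⟨p, by simp [hf]⟩
    obtain ⟨q, hq0, hqmin⟩ : ∃ q, q ∈ _ ∧ ∀ p' ∈ _, q ≤ p' :=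
      ⟨_, min'_mem _ hne, fun p' hp' => min'_le _ p' hp'⟩
    have hq := hq0
    rw [mem_filter] at hq
    replace hq := hq.2
    have : q = s := by
      rw [← hs]
      refine ⟨fun p' hp' => ?_, fun _ => hq.2⟩
      by_contra h
      rw [Bool.not_eq_true] at h
      have := hqmin p' (by
        simp only [mem_filter, mem_univ, true_and]
        exact ⟨(Fin.le_def.2 (by have := Fin.le_def.1 hq.1; omega)), h⟩)
      have := Fin.le_def.1 this
      omega
    have h1 : q ≤ p := hq.1
    rw [this] at h1
    exact absurd hps (not_lt.2 h1)
  · rw [decide_eq_false hps]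
    by_contra hf
    rw [Bool.not_eq_false] at hf
    have hne : ({q : Fin m | p < q ∧ ((q : ℕ) + 1 < m → f q = false)} : Finset (Fin m)).Nonempty :=
      -- The last vertex has no outgoing edge along the path, so it meets the condition vacuously.
      ⟨⟨m - 1, by omega⟩, by
        simp only [mem_filter, mem_univ, true_and]
        exact ⟨Fin.lt_def.2 (by dsimp only; omega), fun h => by omega⟩⟩
    obtain ⟨q, hq0, hqmin⟩ : ∃ q, q ∈ _ ∧ ∀ p' ∈ _, q ≤ p' :=
      ⟨_, min'_mem _ hne, fun p' hp' => min'_le _ p' hp'⟩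
    have hq := hq0
    rw [mem_filter] at hq
    replace hq := hq.2
    have : q = s := by
      rw [← hs]
      refine ⟨fun p' hp' => ?_, hq.2⟩
      have h0 := Fin.lt_def.1 hq.1
      by_contra h
      rw [Bool.not_eq_true] at h
      have hpp : p < p' := by
        rcases lt_trichotomy p p' with h1 | h1 | h1
        · exact h1
        · rw [← h1, hf] at h
          exact absurd h (by simp)
        · have := Fin.lt_def.1 h1
          omega
      have := hqmin p' (by
        simp only [mem_filter, mem_univ, true_and]
        exact ⟨hpp, fun _ => h⟩)
      have := Fin.le_def.1 this
      omega
    have h1 : p < q := hq.1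
    rw [this] at h1
    exact hps h1

theorem isPathSource_iff {m : ℕ} (f : Fin m → Bool) (s : Fin m)
    (hf : ∀ p : Fin m, (p : ℕ) + 1 < m → f p = decide (p < s)) (p : Fin m) :
    IsPathSource f p ↔ p = s := by
  constructor
  · rintro ⟨h1, h2⟩
    rcases lt_trichotomy p s with h | h | h
    · have := Fin.lt_def.1 h
      have h3 : (p : ℕ) + 1 < m := by omega
      have := hf p h3
      rw [h2 h3, decide_eq_true h] at this
      exact absurd this (by simp)
    · exact h
    · have h4 := Fin.lt_def.1 h
      have h3 := h1 ⟨p - 1, by omega⟩ (by dsimp only; omega)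
      rw [hf _ (by dsimp only; omega), decide_eq_true_iff, Fin.lt_def] at h3
      dsimp only at h3
      omega
  · rintro rfl
    refine ⟨fun p' hp' => ?_, fun h => by simp [hf p h]⟩
    rw [hf p' (by omega), decide_eq_true_iff, Fin.lt_def]
    omega

open Classical in
-- A source at `s` forces exactly `s` reversed inner edges, and `s` is arbitrary. The coordinate
-- `last` is no edge of the path; it stands for the edge that leaves the arc, whose direction `b` is
-- dictated by the neighboring arc.
theorem sum_path_orientations (m : ℕ) (last : Fin m) (hl : (last : ℕ) + 1 = m) (b : Bool) :
    ∑ f : Fin m → Bool with f last = b ∧ ∃! p, IsPathSource f p,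
      (Polynomial.X : ℚ[X]) ^ #{i | f i = true} = Polynomial.X ^ b.toNat * qInt m := by
  rw [qInt, ← Fin.sum_univ_eq_sum_range, mul_sum]
  symm
  set g : Fin m → Fin m → Bool := fun s p => if (p : ℕ) + 1 < m then decide (p < s) else b with hg
  have hgs : ∀ s p : Fin m, (p : ℕ) + 1 < m → g s p = decide (p < s) := fun s p h => if_pos h
  refine sum_bij (fun s _ => g s) ?_ ?_ ?_ ?_
  · intro s _
    simp only [mem_filter, mem_univ, true_and]
    refine ⟨if_neg (by omega), s, (isPathSource_iff _ s (hgs s) s).2 rfl, fun p hp =>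
      (isPathSource_iff _ s (hgs s) p).1 hp⟩
  · intro s _ s' _ h
    rw [← isPathSource_iff (g s') s' (hgs s') s, ← h]
    exact (isPathSource_iff (g s) s (hgs s) s).2 rfl
  · intro f hf
    simp only [mem_filter, mem_univ, true_and] at hf
    obtain ⟨hb, s, hs, hs'⟩ := hf
    refine ⟨s, mem_univ _, ?_⟩
    funext p
    by_cases h : (p : ℕ) + 1 < m
    · rw [hgs s p h]
      exact (eq_decide_lt_of_existsUnique_source f s
        (fun p => ⟨hs' p, by rintro rfl; exact hs⟩) p h).symm
    · have : p = last := Fin.ext (by omega)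
      rw [hg, this]
      simp only
      rw [if_neg (by omega), hb]
  · intro s _
    rw [← pow_add]
    congr 1
    have h1 : ({i | g s i = true} : Finset (Fin m)) =
        Finset.Iio s ∪ (if b then {last} else ∅) := by
      ext i
      simp only [mem_filter, mem_univ, true_and, mem_union, mem_Iio]
      by_cases h : (i : ℕ) + 1 < m
      · rw [hgs s i h, decide_eq_true_iff]
        have : i ≠ last := fun h' => by rw [h'] at h; omega
        cases b <;> simp [this]
      · have : i = last := Fin.ext (by omega)
        subst this
        have hs : ¬ i < s := fun h' => by have := Fin.lt_def.1 h'; omega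
        simp only [hg, if_neg h, hs, false_or]
        cases b <;> simp
    rw [h1, card_union_of_disjoint, Fin.card_Iio]
    · cases b <;> simp [add_comm]
    · rw [Finset.disjoint_left]
      intro i hi
      rw [mem_Iio, Fin.lt_def] at hi
      cases b
      · simp
      · simp only [if_true, mem_singleton]
        rintro rfl
        omega

theorem val_add_one_eq_mod {n : ℕ} [NeZero n] (i : Fin n) :
    ((i + 1 : Fin n) : ℕ) = (i + 1) % n := by
  simp [Fin.val_add]

/-! ### Cutting `Fin n` into blocks -/

/-- `Fin n` cut into consecutive blocks of sizes `μ 0, μ 1, …`. -/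
def blockEquiv {n k : ℕ} (μ : Fin k → ℕ) (h : ∑ j, μ j = n) : (Σ j, Fin (μ j)) ≃ Fin n :=
  finSigmaFinEquiv.trans (finCongr h)

theorem blockEquiv_val {n k : ℕ} (μ : Fin k → ℕ) (h : ∑ j, μ j = n) (a : Fin k) (p : Fin (μ a)) :
    (blockEquiv μ h ⟨a, p⟩ : ℕ) = ∑ b ∈ Iio a, μ b + p := by
  have := finSigmaFinEquiv_apply (⟨a, p⟩ : Σ j, Fin (μ j))
  rw [blockEquiv, Equiv.trans_apply, finCongr_apply, Fin.val_cast, this]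
  congr 1
  refine sum_bij (fun b _ => Fin.castLE a.2.le b) ?_ ?_ ?_ ?_
  · intro b _
    rw [mem_Iio, Fin.lt_def]
    exact b.2
  · intro b _ b' _ h
    exact Fin.castLE_injective _ h
  · intro b hb
    rw [mem_Iio, Fin.lt_def] at hb
    exact ⟨⟨b, hb⟩, mem_univ _, rfl⟩
  · intro b _
    rfl

/-- The index of the block that contains a position. -/
def blockIndex {n k : ℕ} (μ : Fin k → ℕ) (h : ∑ j, μ j = n) (p : Fin n) : Fin k :=
  ((blockEquiv μ h).symm p).1

theorem blockIndex_blockEquiv {n k : ℕ} (μ : Fin k → ℕ) (h : ∑ j, μ j = n)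
    (x : Σ j, Fin (μ j)) : blockIndex μ h (blockEquiv μ h x) = x.1 := by
  rw [blockIndex, Equiv.symm_apply_apply]

theorem card_blockIndex_eq {n k : ℕ} (μ : Fin k → ℕ) (h : ∑ j, μ j = n) (j : Fin k) :
    #{p | blockIndex μ h p = j} = μ j := by
  rw [← Fintype.card_fin (μ j), ← card_univ]
  symm
  refine card_bij (fun p _ => blockEquiv μ h ⟨j, p⟩) ?_ ?_ ?_
  · intro p _
    simp [blockIndex_blockEquiv]
  · intro p _ p' _ h
    simpa using h
  · intro p hp
    obtain ⟨⟨a, q⟩, rfl⟩ := (blockEquiv μ h).surjective p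
    simp only [blockIndex_blockEquiv, mem_filter, mem_univ, true_and] at hp
    subst hp
    exact ⟨q, mem_univ _, rfl⟩

theorem sum_Iio_add_le {k : ℕ} (μ : Fin k → ℕ) {a b : Fin k} (hab : a < b) :
    ∑ j ∈ Iio a, μ j + μ a ≤ ∑ j ∈ Iio b, μ j := by
  rw [add_comm, ← sum_insert (by simp)]
  refine sum_le_sum_of_subset fun j hj => ?_
  rw [mem_insert, mem_Iio] at hj
  rw [mem_Iio]
  rcases hj with rfl | hj
  · exact hab
  · exact hj.trans hab

theorem blockIndex_eq_iff {n k : ℕ} (μ : Fin k → ℕ) (h : ∑ j, μ j = n) (p : Fin n) (a : Fin k) :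
    blockIndex μ h p = a ↔ ∑ j ∈ Iio a, μ j ≤ p ∧ (p : ℕ) < ∑ j ∈ Iio a, μ j + μ a := by
  obtain ⟨⟨b, q⟩, rfl⟩ := (blockEquiv μ h).surjective p
  rw [blockIndex_blockEquiv, blockEquiv_val]
  dsimp only
  constructor
  · rintro rfl
    have := q.2
    omega
  · rintro ⟨h1, h2⟩
    have := q.2
    rcases lt_trichotomy b a with h3 | h3 | h3
    · have := sum_Iio_add_le μ h3
      omega
    · exact h3
    · have := sum_Iio_add_le μ h3
      omega

theorem monotone_blockIndex {n k : ℕ} (μ : Fin k → ℕ) (h : ∑ j, μ j = n) :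
    Monotone (blockIndex μ h) := by
  intro p q hpq
  by_contra hlt
  rw [not_le] at hlt
  have h1 := (blockIndex_eq_iff μ h p _).1 rfl
  have h2 := (blockIndex_eq_iff μ h q _).1 rfl
  have h3 := sum_Iio_add_le μ hlt
  have := Fin.le_def.1 hpq
  omega

/-- The sizes of the fibers determine a monotone map: the positions of color less than `f p` all
precede `p`, and all positions up to `p` have color at most `f p`. -/
theorem monotone_eq_blockIndex {n k : ℕ} (μ : Fin k → ℕ) (h : ∑ j, μ j = n) (f : Fin n → Fin k)
    (hf : Monotone f) (hc : ∀ j, #{p | f p = j} = μ j) : f = blockIndex μ h := by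
  funext p
  symm
  rw [blockIndex_eq_iff]
  have hlow : ∀ S : Finset (Fin k), #{q | f q ∈ S} = ∑ j ∈ S, μ j := by
    intro S
    rw [card_eq_sum_card_fiberwise (f := f) (t := S)]
    · refine sum_congr rfl fun j hj => ?_
      rw [← hc j, filter_filter]
      congr 1
      ext q
      simp only [mem_filter, mem_univ, true_and, and_iff_right_iff_imp]
      rintro rfl
      exact hj
    · intro q hq
      simpa using hq
  constructor
  · rw [← hlow, ← Fin.card_Iio p]
    refine card_le_card fun q hq => ?_
    simp only [mem_filter, mem_univ, true_and, mem_Iio] at hq ⊢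
    by_contra hle
    exact absurd (hf (not_lt.1 hle)) (not_le.2 hq)
  · rw [add_comm, ← sum_insert (by simp), ← hlow]
    refine lt_of_lt_of_le (Nat.lt_succ_self _) ?_
    rw [Nat.succ_eq_add_one, ← Fin.card_Iic p]
    refine card_le_card fun q hq => ?_
    simp only [mem_filter, mem_univ, true_and, mem_insert, mem_Iio, mem_Iic] at hq ⊢
    exact (hf hq).eq_or_lt

theorem blockEquiv_add_one {n k : ℕ} [NeZero n] (μ : Fin k → ℕ) (h : ∑ j, μ j = n) (a : Fin k)
    (p p' : Fin (μ a)) (hp : (p' : ℕ) = p + 1) :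
    blockEquiv μ h ⟨a, p⟩ + 1 = blockEquiv μ h ⟨a, p'⟩ := by
  have h1 := blockEquiv_val μ h a p
  have h2 := blockEquiv_val μ h a p'
  apply Fin.ext
  have := (blockEquiv μ h ⟨a, p'⟩).2
  rw [val_add_one_eq_mod, Nat.mod_eq_of_lt] <;> omega

theorem blockEquiv_last_add_one {n k : ℕ} [NeZero n] [NeZero k] (μ : Fin k → ℕ)
    (h : ∑ j, μ j = n) (hμ : ∀ j, 0 < μ j) (a : Fin k) (p : Fin (μ a)) (hp : (p : ℕ) + 1 = μ a) :
    blockEquiv μ h ⟨a, p⟩ + 1 = blockEquiv μ h ⟨a + 1, ⟨0, hμ _⟩⟩ := by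
  have h1 := blockEquiv_val μ h a p
  have h2 := blockEquiv_val μ h (a + 1) ⟨0, hμ _⟩
  apply Fin.ext
  rw [val_add_one_eq_mod, h2]
  have ha : (a + 1 : Fin k).val = (a.val + 1) % k := val_add_one_eq_mod a
  have hk := a.2
  have h3 : ∑ b ∈ Iio a, μ b + μ a = ∑ b ∈ Iic a, μ b := by
    rw [add_comm, ← sum_insert (by simp)]
    congr 1
    ext b
    simp [le_iff_eq_or_lt]
  -- After the last block both `a + 1` and the position wrap around to 0.
  by_cases hak : a.val + 1 = k
  · have h4 : Iic a = univ := by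
      ext b
      have := b.2
      simp only [mem_Iic, mem_univ, iff_true, Fin.le_def]
      omega
    have h5 : Iio (a + 1 : Fin k) = ∅ := by
      ext b
      rw [mem_Iio, Fin.lt_def, ha, hak, Nat.mod_self]
      simp
    rw [h4, h] at h3
    rw [h5, h1, add_assoc, hp, h3, Nat.mod_self]
    simp
  · have h5 : Iio (a + 1 : Fin k) = Iic a := by
      ext b
      rw [mem_Iio, mem_Iic, Fin.lt_def, Fin.le_def, ha, Nat.mod_eq_of_lt (by omega)]
      omega
    rw [h5, ← h3]
    have h6 := (blockEquiv μ h ⟨a + 1, ⟨0, hμ _⟩⟩).2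
    rw [h2, h5, ← h3] at h6
    dsimp only at h6 ⊢
    rw [Nat.mod_eq_of_lt] <;> omega

open Fin.NatCast in
theorem eq_univ_of_add_one_mem {n : ℕ} [NeZero n] (P : Fin n → Prop) (i : Fin n) (hi : P i)
    (h : ∀ j, P j → P (j + 1)) (j : Fin n) : P j := by
  have key : ∀ m : ℕ, P (i + (m : Fin n)) := by
    intro m
    induction m with
    | zero => simpa using hi
    | succ m ih =>
      rw [Nat.cast_succ, ← add_assoc]
      exact h _ ih
  have := key (j - i : Fin n).val
  rwa [Fin.cast_val_eq_self, add_sub_cancel] at this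

/-! ### Oriented colored cycles -/

/-- For a coloring of the vertices of a cycle and an orientation of its edges (the edge
`i → i + 1` being reversed iff the second component is `true`): `i` has no in-edge from a vertex
of its color. -/
def IsSource {n k : ℕ} [NeZero n] (f : Fin n → Fin k × Bool) (i : Fin n) : Prop :=
  (∀ i', i' + 1 = i → (f i').1 = (f i).1 → (f i').2 = true) ∧
    ((f (i + 1)).1 = (f i).1 → (f i).2 = false)

/-- The color classes have the sizes `μ`, the edges between color classes point from the smaller
to the larger color, and each color class has exactly one source. -/
structure IsSourced {n k : ℕ} [NeZero n] (μ : Fin k → ℕ) (f : Fin n → Fin k × Bool) : Prop where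
  card_eq : ∀ j, #{i | (f i).1 = j} = μ j
  of_lt : ∀ i, (f i).1 < (f (i + 1)).1 → (f i).2 = false
  of_gt : ∀ i, (f (i + 1)).1 < (f i).1 → (f i).2 = true
  source : ∀ j, ∃! i, (f i).1 = j ∧ IsSource f i

/-- `i` is the last vertex of an arc of constant color. -/
def IsExit {n : ℕ} [NeZero n] {α : Type*} (c : Fin n → α) (i : Fin n) : Prop :=
  c (i + 1) ≠ c i

/-- This says that a color class is one arc. Without an exit the class would fill the whole cycle,
although another color occurs. With two exits it would have too few inner edges for every vertex but
one to receive an edge. -/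
theorem IsSourced.existsUnique_exit {n k : ℕ} [NeZero n] {μ : Fin k → ℕ}
    {f : Fin n → Fin k × Bool} (hf : IsSourced μ f) (hk : 2 ≤ k) (j : Fin k) :
    ∃! i, (f i).1 = j ∧ IsExit (fun i => (f i).1) i := by
  classical
  have hne : ∀ j, ∃ i, (f i).1 = j := fun j => by
    obtain ⟨i, hi, -⟩ := hf.source j
    exact ⟨i, hi.1⟩
  obtain ⟨i, hi, hex⟩ : ∃ i, (f i).1 = j ∧ IsExit (fun i => (f i).1) i := by
    by_contra! hcon
    obtain ⟨i, hi⟩ := hne j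
    have hall := eq_univ_of_add_one_mem (fun i => (f i).1 = j) i hi fun i hi => by
      have := hcon i hi
      rw [IsExit, not_not] at this
      rw [this, hi]
    obtain ⟨j', hj'⟩ : ∃ j' : Fin k, j' ≠ j :=
      haveI : Nontrivial (Fin k) := Fin.nontrivial_iff_two_le.2 hk
      exists_ne j
    obtain ⟨i', hi'⟩ := hne j'
    exact hj' (hi'.symm.trans (hall i'))
  refine ⟨i, ⟨hi, hex⟩, ?_⟩
  rintro i' ⟨hi', hex'⟩
  by_contra hii
  obtain ⟨s, ⟨hs, hss⟩, hs'⟩ := hf.source j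
  set C : Finset (Fin n) := {i | (f i).1 = j} with hC
  have hmem : ∀ x, x ∈ C ↔ (f x).1 = j := fun x => by simp [hC]
  -- The inner edges of the class are labeled by its vertices that are not exits, and the map sends
  -- an edge to its head. Every vertex of the class except the source `s` is such a head.
  have h1 : C.erase s ⊆ ((C.erase i).erase i').image fun x => if (f x).2 then x else x + 1 := by
    intro x hx
    rw [mem_erase, hmem] at hx
    have hxs : ¬ IsSource f x := fun h => hx.1 (hs' x ⟨hx.2, h⟩)
    rw [IsSource, not_and_or] at hxs
    rw [mem_image]
    rcases hxs with h | h
    · push Not at h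
      obtain ⟨y, rfl, hy, hy'⟩ := h
      refine ⟨y, ?_, by rw [if_neg hy']⟩
      rw [mem_erase, mem_erase, hmem, hy, hx.2]
      refine ⟨?_, ?_, rfl⟩
      · rintro rfl
        exact hex' hy.symm
      · rintro rfl
        exact hex hy.symm
    · rw [Classical.not_imp, Bool.not_eq_false] at h
      refine ⟨x, ?_, by rw [if_pos h.2]⟩
      rw [mem_erase, mem_erase, hmem, hx.2]
      refine ⟨?_, ?_, rfl⟩
      · rintro rfl
        exact hex' h.1
      · rintro rfl
        exact hex h.1
  have h2 := (card_le_card h1).trans card_image_le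
  rw [card_erase_of_mem ((hmem s).2 hs), card_erase_of_mem, card_erase_of_mem ((hmem i).2 hi)] at h2
  · have h3 : 1 < #C := one_lt_card.2 ⟨i, (hmem i).2 hi, i', (hmem i').2 hi', fun h => hii h.symm⟩
    omega
  · rw [mem_erase, hmem]
    exact ⟨hii, hi'⟩

theorem isSource_rotate {n k : ℕ} [NeZero n] (f : Fin n → Fin k × Bool) (r i : Fin n) :
    IsSource (fun i => f (i + r)) i ↔ IsSource f (i + r) := by
  rw [IsSource, IsSource]
  refine and_congr ⟨fun h i' hi' => ?_, fun h i' hi' => ?_⟩ ?_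
  · have := h (i' - r) (by rw [← add_left_inj r, ← hi']; abel)
    simpa using this
  · refine h (i' + r) ?_
    rw [← hi']
    abel
  · simp only [add_right_comm i 1 r]

theorem IsSourced.rotate {n k : ℕ} [NeZero n] {μ : Fin k → ℕ}
    {f : Fin n → Fin k × Bool} (hf : IsSourced μ f) (r : Fin n) :
    IsSourced μ (fun i => f (i + r)) := by
  have hsrc := isSource_rotate f r
  refine ⟨fun j => ?_, fun i => ?_, fun i => ?_, fun j => ?_⟩
  · rw [← hf.card_eq j]
    exact card_filter_rotate (fun i => (f i).1 = j) r
  · have := hf.of_lt (i + r)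
    rwa [add_right_comm] at this
  · have := hf.of_gt (i + r)
    rwa [add_right_comm] at this
  · obtain ⟨s, hs, hs'⟩ := hf.source j
    refine ⟨s - r, ?_, ?_⟩
    · simp only [hsrc]
      simpa using hs
    · intro i hi
      rw [hsrc] at hi
      rw [← hs' _ hi]
      simp

/-- The cycle is cut at 0, where an arc of color 0 begins, so no arc is cut in two. Ordering the
colors by their exits is then the order in which the arcs appear. -/
theorem exists_monotone_of_exits {n k : ℕ} [NeZero n] [NeZero k]
    (c : Fin n → Fin k) (hex : ∀ j, ∃! i, c i = j ∧ IsExit c i) (h0 : c 0 = 0)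
    (hlast : ∀ i, i + 1 = 0 → c i ≠ 0) :
    ∃ w : Equiv.Perm (Fin k), w 0 = 0 ∧ Monotone fun i => w.symm (c i) := by
  classical
  choose ex hex hex' using hex
  have hinj : Function.Injective ex := fun a b h => by
    rw [← (hex a).1, h, (hex b).1]
  -- A vertex beyond the exit of its color would have its color continue up to `n - 1`, which would
  -- be a second exit, since the colors at `n - 1` and 0 differ.
  have hle : ∀ i, i ≤ ex (c i) := by
    intro i
    by_contra hlt
    rw [not_le] at hlt
    have hall : ∀ m : ℕ, ∀ h : m < n, i.val ≤ m → c ⟨m, h⟩ = c i := by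
      intro m
      induction m with
      | zero =>
        intro h hm
        congr 1
        exact Fin.ext (by dsimp only; omega)
      | succ m ih =>
        intro h hm
        rcases Nat.eq_or_lt_of_le hm with h1 | h1
        · congr 1
          exact Fin.ext h1.symm
        · have h2 := ih (by omega) (by omega)
          have h3 : (⟨m, by omega⟩ : Fin n) + 1 = ⟨m + 1, h⟩ := by
            apply Fin.ext
            rw [val_add_one_eq_mod, Nat.mod_eq_of_lt h]
          by_contra h4
          have h5 := hex' (c i) ⟨m, by omega⟩ ⟨h2, by
            rw [IsExit, h3, h2]
            exact h4⟩
          have := Fin.lt_def.1 hlt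
          rw [← h5] at this
          dsimp only at this
          omega
    have hn := NeZero.pos n
    have hl := hall (n - 1) (by omega) (by have := i.2; omega)
    have hl1 : (⟨n - 1, by omega⟩ : Fin n) + 1 = 0 := by
      apply Fin.ext
      rw [val_add_one_eq_mod]
      dsimp only
      rw [Nat.sub_add_cancel hn, Nat.mod_self]
      simp
    have hc0 := hlast _ hl1
    have := hex' (c i) ⟨n - 1, by omega⟩ ⟨hl, by
      rw [IsExit, hl1, h0]
      exact hc0.symm⟩
    rw [← this, Fin.lt_def] at hlt
    dsimp only at hlt
    have := i.2
    omega
  -- Either `i'` lies beyond the exit of the color of `i`, and then `hle` applies to `i'`, or the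
  -- color is constant from `i` to `i'`.
  have hlt_of : ∀ i i', i ≤ i' → ex (c i) ≤ ex (c i') := by
    intro i i' hii
    rcases lt_or_ge (ex (c i)) i' with h | h
    · exact h.le.trans (hle i')
    · suffices c i' = c i by rw [this]
      have hall : ∀ m : ℕ, ∀ h : m < n, i.val ≤ m → m ≤ (ex (c i)).val → c ⟨m, h⟩ = c i := by
        intro m
        induction m with
        | zero =>
          intro h hm _
          congr 1
          exact Fin.ext (by dsimp only; omega)
        | succ m ih =>
          intro h hm hm2
          rcases Nat.eq_or_lt_of_le hm with h1 | h1
          · congr 1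
            exact Fin.ext h1.symm
          · have h2 := ih (by omega) (by omega) (by omega)
            have h3 : (⟨m, by omega⟩ : Fin n) + 1 = ⟨m + 1, h⟩ := by
              apply Fin.ext
              rw [val_add_one_eq_mod, Nat.mod_eq_of_lt h]
            by_contra h4
            have h5 := hex' (c i) ⟨m, by omega⟩ ⟨h2, by
              rw [IsExit, h3, h2]
              exact h4⟩
            rw [← h5] at hm2
            dsimp only at hm2
            omega
      exact hall i' i'.2 (Fin.le_def.1 hii) (Fin.le_def.1 h)
  -- sort the colors by their exits
  set S : Finset (Fin n) := univ.image ex with hS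
  have hSc : #S = k := by rw [hS, card_image_of_injective _ hinj, card_univ, Fintype.card_fin]
  have hbij : Function.Bijective fun j => (⟨ex j, mem_image_of_mem _ (mem_univ j)⟩ : S) := by
    constructor
    · intro a b h
      exact hinj (congrArg Subtype.val h)
    · rintro ⟨x, hx⟩
      obtain ⟨j, -, rfl⟩ := mem_image.1 hx
      exact ⟨j, rfl⟩
  set E := Equiv.ofBijective _ hbij
  set w : Equiv.Perm (Fin k) := (S.orderIsoOfFin hSc).toEquiv.trans E.symm with hw
  have hwsymm : ∀ a b, ex a ≤ ex b → w.symm a ≤ w.symm b := by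
    intro a b h
    have : ∀ j, w.symm j = (S.orderIsoOfFin hSc).symm (E j) := fun j => rfl
    rw [this, this, OrderIso.le_iff_le]
    exact h
  have hmono : Monotone fun i => w.symm (c i) := fun i i' h => hwsymm _ _ (hlt_of i i' h)
  refine ⟨w, ?_, hmono⟩
  -- Color 0 is the color of the vertex 0, so it comes first in the new order.
  have h1 : ∀ j, w.symm 0 ≤ w.symm j := by
    intro j
    have := hmono (Fin.zero_le (ex j))
    simp only at this
    rwa [h0, (hex j).1] at this
  have := h1 (w 0)
  rw [w.symm_apply_apply, Fin.le_def, Fin.val_zero, Nat.le_zero] at this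
  rw [← w.eq_symm_apply]
  exact (Fin.ext (by rw [this, Fin.val_zero])).symm

/-- The vertex of the cycle at which the arc of color `0` starts. -/
def IsStart {n k : ℕ} [NeZero n] [NeZero k] (f : Fin n → Fin k × Bool) (r : Fin n) : Prop :=
  (f r).1 = 0 ∧ ∀ i, i + 1 = r → (f i).1 ≠ 0

/-- Around a cycle, a set of vertices is entered as often as it is left, and color 0 is left exactly
once. -/
theorem IsSourced.existsUnique_start {n k : ℕ} [NeZero n] [NeZero k] {μ : Fin k → ℕ}
    {f : Fin n → Fin k × Bool} (hf : IsSourced μ f) (hk : 2 ≤ k) : ∃! r, IsStart f r := by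
  classical
  have h1 : #{i | (f i).1 = 0 ∧ ¬ (f (i + 1)).1 = 0} = 1 := by
    obtain ⟨i, ⟨hi, hi1⟩, hi2⟩ := hf.existsUnique_exit hk 0
    rw [card_eq_one]
    refine ⟨i, ?_⟩
    ext x
    simp only [mem_filter, mem_univ, true_and, mem_singleton]
    constructor
    · rintro ⟨hx, hx'⟩
      exact hi2 x ⟨hx, by rw [IsExit, hx]; exact hx'⟩
    · rintro rfl
      refine ⟨hi, ?_⟩
      rw [IsExit, hi] at hi1
      exact hi1
  have h2 : #{i | (f (i + 1)).1 = 0 ∧ ¬ (f i).1 = 0} = 1 := by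
    have a1 := card_filter_add_card_filter_not (s := {i | (f i).1 = 0}) (fun i => (f (i + 1)).1 = 0)
    have a2 := card_filter_add_card_filter_not (s := {i | (f (i + 1)).1 = 0}) (fun i => (f i).1 = 0)
    have a3 := card_filter_rotate (fun i => (f i).1 = 0) 1
    have a4 : #{i | (f i).1 = 0 ∧ (f (i + 1)).1 = 0} = #{i | (f (i + 1)).1 = 0 ∧ (f i).1 = 0} := by
      simp only [and_comm]
    simp only [filter_filter] at a1 a2
    omega
  obtain ⟨i, hi⟩ := card_eq_one.1 h2
  have hi' : ∀ x, ((f (x + 1)).1 = 0 ∧ ¬ (f x).1 = 0) ↔ x = i := fun x => by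
    have := Finset.ext_iff.1 hi x
    simpa using this
  refine ⟨i + 1, ⟨((hi' i).2 rfl).1, fun x hx => ?_⟩, fun r hr => ?_⟩
  · have := add_right_cancel hx
    rw [this]
    exact ((hi' i).2 rfl).2
  · have := (hi' (r - 1)).1 ⟨by simpa using hr.1, hr.2 _ (by simp)⟩
    rw [← this]
    simp

section Assemble

variable {n k : ℕ} {μ : Fin k → ℕ}

theorem sum_comp_perm_eq (h : ∑ j, μ j = n) (w : Equiv.Perm (Fin k)) :
    ∑ j, (μ ∘ w) j = n := by
  rw [← h]
  exact Equiv.sum_comp w μ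

/-- The oriented colored cycle whose arcs have the colors `w 0, w 1, …` and the sizes
`μ (w 0), μ (w 1), …`, and are oriented by `g`. -/
def assemble (h : ∑ j, μ j = n) (w : Equiv.Perm (Fin k)) (g : ∀ a, Fin (μ (w a)) → Bool)
    (i : Fin n) : Fin k × Bool :=
  (w ((blockEquiv (μ ∘ w) (sum_comp_perm_eq h w)).symm i).1,
    g _ ((blockEquiv (μ ∘ w) (sum_comp_perm_eq h w)).symm i).2)

variable (h : ∑ j, μ j = n) (w : Equiv.Perm (Fin k)) (g : ∀ a, Fin (μ (w a)) → Bool)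

theorem assemble_blockEquiv (a : Fin k) (p : Fin (μ (w a))) :
    assemble h w g (blockEquiv (μ ∘ w) (sum_comp_perm_eq h w) ⟨a, p⟩) = (w a, g a p) := by
  rw [assemble, Equiv.symm_apply_apply]

theorem add_one_ne_self [NeZero k] (hk : 2 ≤ k) (a : Fin k) : a + 1 ≠ a := by
  intro ha
  have := congrArg Fin.val ha
  rw [val_add_one_eq_mod] at this
  have h2 := a.2
  by_cases h3 : a.val + 1 = k
  · rw [h3, Nat.mod_self] at this
    omega
  · rw [Nat.mod_eq_of_lt (by omega)] at this
    omega

theorem assemble_snd_true_card :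
    #{i | (assemble h w g i).2 = true} = ∑ a, #{p | g a p = true} := by
  simp only [card_filter]
  rw [← Equiv.sum_comp (blockEquiv (μ ∘ w) (sum_comp_perm_eq h w)), Fintype.sum_sigma]
  refine sum_congr rfl fun a _ => sum_congr rfl fun p _ => ?_
  rw [assemble_blockEquiv]

/-- Both block indices are monotone in the position and the colors agree, so `w` followed by the
inverse of `w'` is a monotone permutation, hence the identity. Nonempty blocks are needed for every
index to occur. -/
theorem perm_eq_of_assemble_eq (hμ : ∀ j, 0 < μ j) {w w' : Equiv.Perm (Fin k)}
    {g : ∀ a, Fin (μ (w a)) → Bool} {g' : ∀ a, Fin (μ (w' a)) → Bool}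
    (he : assemble h w g = assemble h w' g') : w = w' := by
  set m := blockIndex (μ ∘ w) (sum_comp_perm_eq h w) with hm
  set m' := blockIndex (μ ∘ w') (sum_comp_perm_eq h w') with hm'
  have h1 : ∀ i, w (m i) = w' (m' i) := fun i => congrArg Prod.fst (congrFun he i)
  have hsurj : Function.Surjective m := fun a =>
    ⟨blockEquiv (μ ∘ w) (sum_comp_perm_eq h w) ⟨a, ⟨0, hμ _⟩⟩, blockIndex_blockEquiv _ _ _⟩
  have hmono : Monotone (w.trans w'.symm) := by
    intro a b hab
    by_contra hlt
    obtain ⟨i, rfl⟩ := hsurj a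
    obtain ⟨i', rfl⟩ := hsurj b
    have hii : i ≤ i' := by
      by_contra hii
      have := monotone_blockIndex (μ ∘ w) (sum_comp_perm_eq h w) (not_le.1 hii).le
      have h4 : m i = m i' := le_antisymm hab this
      exact hlt (by rw [h4])
    have := monotone_blockIndex (μ ∘ w') (sum_comp_perm_eq h w') hii
    apply hlt
    simp only [Equiv.trans_apply, h1, Equiv.symm_apply_apply]
    exact this
  have hs := hmono.strictMono_of_injective (w.trans w'.symm).injective
  have := StrictMono.range_inj hs strictMono_id |>.1 (by
    rw [(w.trans w'.symm).surjective.range_eq, Set.range_id])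
  ext a
  have h2 := congrFun this a
  simp only [Equiv.trans_apply, id, Equiv.symm_apply_eq] at h2
  rw [h2]

variable [NeZero n] [NeZero k]

/-- Since there are at least two arcs, cyclically consecutive arcs have different colors, so edges
between arcs play no role for sources. -/
theorem isSource_assemble_iff (hk : 2 ≤ k) (hμ : ∀ j, 0 < μ j) (a : Fin k) (p : Fin (μ (w a))) :
    IsSource (assemble h w g) (blockEquiv (μ ∘ w) (sum_comp_perm_eq h w) ⟨a, p⟩) ↔
      IsPathSource (g a) p := by
  set e := blockEquiv (μ ∘ w) (sum_comp_perm_eq h w) with he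
  have hf : ∀ a p, assemble h w g (e ⟨a, p⟩) = (w a, g a p) := assemble_blockEquiv h w g
  have hnext : ∀ (a : Fin k) (p p' : Fin (μ (w a))), (p' : ℕ) = p + 1 → e ⟨a, p⟩ + 1 = e ⟨a, p'⟩ :=
    fun a p p' hp => blockEquiv_add_one (μ ∘ w) _ a p p' hp
  have hlast : ∀ (a : Fin k) (p : Fin (μ (w a))), (p : ℕ) + 1 = μ (w a) →
      e ⟨a, p⟩ + 1 = e ⟨a + 1, ⟨0, hμ _⟩⟩ :=
    fun a p hp => blockEquiv_last_add_one (μ ∘ w) _ (fun _ => hμ _) a p hp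
  refine and_congr ⟨fun H p' hp' => ?_, fun H i' hi' hc => ?_⟩ ⟨fun H hp => ?_, fun H hc => ?_⟩
  · have := H (e ⟨a, p'⟩) (hnext a p' p hp'.symm) (by rw [hf, hf])
    rwa [hf] at this
  · obtain ⟨⟨b, q⟩, rfl⟩ := e.surjective i'
    rw [hf, hf] at hc
    obtain rfl : b = a := w.injective hc
    rw [hf]
    dsimp only
    have hq := q.2
    by_cases hq' : (q : ℕ) + 1 < μ (w b)
    · rw [hnext b q ⟨q + 1, hq'⟩ rfl, e.apply_eq_iff_eq] at hi'
      simp only [Sigma.mk.injEq, heq_eq_eq, true_and] at hi'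
      exact H q (by rw [← hi'])
    · rw [hlast b q (by simp only [Function.comp] at hq; omega), e.apply_eq_iff_eq] at hi'
      exact absurd (congrArg Sigma.fst hi') (add_one_ne_self hk b)
  · have := H (by rw [hnext a p ⟨p + 1, hp⟩ rfl, hf, hf])
    rwa [hf] at this
  · rw [hf]
    dsimp only
    have hq := p.2
    by_cases hq' : (p : ℕ) + 1 < μ (w a)
    · exact H hq'
    · rw [hlast a p (by omega), hf, hf] at hc
      exact absurd (w.injective hc) (add_one_ne_self hk a)

theorem isSourced_assemble (hk : 2 ≤ k) (hμ : ∀ j, 0 < μ j)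
    (hg : ∀ a (p : Fin (μ (w a))), (p : ℕ) + 1 = μ (w a) → g a p = decide (w (a + 1) < w a))
    (hs : ∀ a, ∃! p, IsPathSource (g a) p) : IsSourced μ (assemble h w g) := by
  have hf : ∀ a p, assemble h w g (blockEquiv (μ ∘ w) (sum_comp_perm_eq h w) ⟨a, p⟩) =
    (w a, g a p) := assemble_blockEquiv h w g
  have hedge : ∀ a p, (assemble h w g (blockEquiv (μ ∘ w) (sum_comp_perm_eq h w) ⟨a, p⟩ + 1)).1 ≠
      w a → g a p = decide (w (a + 1) < w a) ∧
        (assemble h w g (blockEquiv (μ ∘ w) (sum_comp_perm_eq h w) ⟨a, p⟩ + 1)).1 = w (a + 1) := by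
    intro a p hne
    have hq : (p : ℕ) < μ (w a) := p.2
    by_cases hq' : (p : ℕ) + 1 < μ (w a)
    · rw [blockEquiv_add_one (μ ∘ w) _ a p ⟨p + 1, hq'⟩ rfl, hf] at hne
      exact absurd rfl hne
    · have hq2 : (p : ℕ) + 1 = μ (w a) := by omega
      rw [blockEquiv_last_add_one (μ ∘ w) _ (fun _ => hμ _) a p hq2, hf]
      exact ⟨hg a p hq2, rfl⟩
  refine ⟨fun j => ?_, fun i hi => ?_, fun i hi => ?_, fun j => ?_⟩
  · have := card_blockIndex_eq (μ ∘ w) (sum_comp_perm_eq h w) (w.symm j)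
    rw [Function.comp, w.apply_symm_apply] at this
    rw [← this]
    congr 1
    ext i
    rw [mem_filter, mem_filter]
    exact and_congr_right fun _ => (w.eq_symm_apply).symm
  · obtain ⟨⟨a, p⟩, rfl⟩ := (blockEquiv (μ ∘ w) (sum_comp_perm_eq h w)).surjective i
    rw [hf] at hi ⊢
    obtain ⟨h1, h2⟩ := hedge a p hi.ne'
    rw [h2] at hi
    dsimp only at hi ⊢
    rw [h1, decide_eq_false hi.not_gt]
  · obtain ⟨⟨a, p⟩, rfl⟩ := (blockEquiv (μ ∘ w) (sum_comp_perm_eq h w)).surjective i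
    rw [hf] at hi ⊢
    obtain ⟨h1, h2⟩ := hedge a p hi.ne
    rw [h2] at hi
    dsimp only at hi ⊢
    rw [h1, decide_eq_true hi]
  · obtain ⟨a, rfl⟩ := w.surjective j
    obtain ⟨p, hp, hp'⟩ := hs a
    refine ⟨blockEquiv (μ ∘ w) (sum_comp_perm_eq h w) ⟨a, p⟩,
      ⟨by rw [hf], (isSource_assemble_iff h w g hk hμ a p).2 hp⟩, fun i hi => ?_⟩
    obtain ⟨⟨b, q⟩, rfl⟩ := (blockEquiv (μ ∘ w) (sum_comp_perm_eq h w)).surjective i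
    rw [hf] at hi
    obtain rfl : b = a := w.injective hi.1
    rw [hp' q ((isSource_assemble_iff h w g hk hμ b q).1 hi.2)]

theorem isStart_assemble (hk : 2 ≤ k) (hμ : ∀ j, 0 < μ j) (hw : w 0 = 0) :
    IsStart (assemble h w g) 0 := by
  have hf : ∀ a p, assemble h w g (blockEquiv (μ ∘ w) (sum_comp_perm_eq h w) ⟨a, p⟩) =
    (w a, g a p) := assemble_blockEquiv h w g
  have h0 : (0 : Fin n) = blockEquiv (μ ∘ w) (sum_comp_perm_eq h w) ⟨0, ⟨0, hμ _⟩⟩ := by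
    apply Fin.ext
    rw [blockEquiv_val]
    have : Iio (0 : Fin k) = ∅ := by
      ext b
      simp
    rw [this]
    simp
  refine ⟨by rw [h0, hf]; exact hw, fun i hi hi0 => ?_⟩
  obtain ⟨⟨a, p⟩, rfl⟩ := (blockEquiv (μ ∘ w) (sum_comp_perm_eq h w)).surjective i
  rw [hf] at hi0
  obtain rfl : a = 0 := w.injective (hi0.trans hw.symm)
  rw [h0] at hi
  have hq : (p : ℕ) < μ (w 0) := p.2
  by_cases hq' : (p : ℕ) + 1 < μ (w 0)
  · rw [blockEquiv_add_one (μ ∘ w) _ 0 p ⟨p + 1, hq'⟩ rfl, Equiv.apply_eq_iff_eq] at hi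
    simp only [Sigma.mk.injEq, heq_eq_eq, true_and] at hi
    have := congrArg Fin.val hi
    dsimp only at this
    omega
  · rw [blockEquiv_last_add_one (μ ∘ w) _ (fun _ => hμ _) 0 p (by
      change (p : ℕ) + 1 = μ (w 0)
      omega), Equiv.apply_eq_iff_eq] at hi
    exact absurd (congrArg Sigma.fst hi) (add_one_ne_self hk 0)

theorem exists_assemble_eq (hk : 2 ≤ k) (hμ : ∀ j, 0 < μ j) {f : Fin n → Fin k × Bool}
    (hf : IsSourced μ f) (hs : IsStart f 0) :
    ∃ w : Equiv.Perm (Fin k), ∃ g : ∀ a, Fin (μ (w a)) → Bool, w 0 = 0 ∧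
      (∀ a (p : Fin (μ (w a))), (p : ℕ) + 1 = μ (w a) → g a p = decide (w (a + 1) < w a)) ∧
      (∀ a, ∃! p, IsPathSource (g a) p) ∧ assemble h w g = f := by
  obtain ⟨w, hw, hmono⟩ := exists_monotone_of_exits (fun i => (f i).1)
    (fun j => hf.existsUnique_exit hk j) hs.1 hs.2
  -- Relabeled by the order of their arcs, the colors increase along the cut cycle, so the class
  -- sizes fix the arcs.
  have hb := monotone_eq_blockIndex (μ ∘ w) (sum_comp_perm_eq h w) _ hmono (by
    intro j
    rw [Function.comp, ← hf.card_eq]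
    congr 1
    ext i
    simp only [mem_filter, mem_univ, true_and]
    exact w.symm_apply_eq)
  set e := blockEquiv (μ ∘ w) (sum_comp_perm_eq h w) with he
  have hc : ∀ a p, (f (e ⟨a, p⟩)).1 = w a := by
    intro a p
    have := congrFun hb (e ⟨a, p⟩)
    rw [blockIndex_blockEquiv] at this
    exact w.symm_apply_eq.1 this
  set g : ∀ a, Fin (μ (w a)) → Bool := fun a p => (f (e ⟨a, p⟩)).2 with hg
  have hfg : assemble h w g = f := by
    funext i
    obtain ⟨⟨a, p⟩, rfl⟩ := e.surjective i
    rw [assemble_blockEquiv]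
    exact Prod.ext (hc a p).symm rfl
  refine ⟨w, g, hw, fun a p hp => ?_, fun a => ?_, hfg⟩
  · have h1 := hf.of_lt (e ⟨a, p⟩)
    have h2 := hf.of_gt (e ⟨a, p⟩)
    rw [blockEquiv_last_add_one (μ ∘ w) _ (fun _ => hμ _) a p hp, hc, hc] at h1 h2
    rcases lt_trichotomy (w (a + 1)) (w a) with h3 | h3 | h3
    · rw [decide_eq_true h3]
      exact h2 h3
    · exact absurd (w.injective h3) (add_one_ne_self hk a)
    · rw [decide_eq_false h3.not_gt]
      exact h1 h3
  · obtain ⟨i, ⟨hi, hi'⟩, hu⟩ := hf.source (w a)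
    obtain ⟨⟨b, q⟩, rfl⟩ := e.surjective i
    rw [hc] at hi
    obtain rfl : b = a := w.injective hi
    rw [← hfg] at hi'
    refine ⟨q, (isSource_assemble_iff h w g hk hμ b q).1 hi', fun p hp => ?_⟩
    have := hu (e ⟨b, p⟩) ⟨hc _ _, by
      rw [← hfg]
      exact (isSource_assemble_iff h w g hk hμ b p).2 hp⟩
    simpa using this

end Assemble

/-! ### Counting sourced cycles with at least two colors. -/

open Classical in
theorem sum_isSourced_isStart {n k : ℕ} [NeZero n] [NeZero k] {μ : Fin k → ℕ}
    (h : ∑ j, μ j = n) (hk : 2 ≤ k) (hμ : ∀ j, 0 < μ j) :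
    ∑ f : Fin n → Fin k × Bool with IsSourced μ f ∧ IsStart f 0,
      (Polynomial.X : ℚ[X]) ^ #{i | (f i).2 = true} =
      Polynomial.X * eulerianPoly (k - 1) * ∏ j, qInt (μ j) := by
  have h1 : Polynomial.X * eulerianPoly (k - 1) =
      ∑ w : Equiv.Perm (Fin k) with w 0 = 0, (Polynomial.X : ℚ[X]) ^ cyclicDescents w := by
    obtain ⟨m, rfl⟩ : ∃ m, k = m + 1 := ⟨k - 1, by omega⟩
    exact (sum_cyclicDescents_fix_zero (m := m) (by omega)).symm
  -- The arcs are oriented independently. The edge from arc `a` to the next arc is the last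
  -- coordinate of `g a`, and it is reversed exactly at a cyclic descent of `w`.
  have h2 : ∀ w : Equiv.Perm (Fin k),
      (Polynomial.X : ℚ[X]) ^ cyclicDescents w * ∏ j, qInt (μ j) =
      ∑ g ∈ Fintype.piFinset fun a : Fin k =>
        (univ : Finset (Fin (μ (w a)) → Bool)).filter fun g =>
          g ⟨μ (w a) - 1, Nat.sub_lt (hμ _) one_pos⟩ = decide (w (a + 1) < w a) ∧
            ∃! p, IsPathSource g p,
        ∏ a, (Polynomial.X : ℚ[X]) ^ #{p | g a p = true} := by
    intro w
    rw [← prod_univ_sum (f := fun a (g : Fin (μ (w a)) → Bool) =>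
      (Polynomial.X : ℚ[X]) ^ #{p | g p = true}), ← Equiv.prod_comp w (fun j => qInt (μ j)), cyclicDescents, card_filter,
      ← prod_pow_eq_pow_sum, ← prod_mul_distrib]
    refine prod_congr rfl fun a _ => ?_
    rw [sum_path_orientations (μ (w a)) ⟨μ (w a) - 1, Nat.sub_lt (hμ _) one_pos⟩
      (Nat.sub_add_cancel (hμ _))]
    congr 2
    by_cases hlt : w (a + 1) < w a <;> simp [hlt]
  rw [h1, sum_mul, sum_congr rfl fun w _ => h2 w, sum_sigma']
  symm
  refine sum_bij (fun x _ => assemble h x.1 x.2) ?_ ?_ ?_ ?_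
  · rintro ⟨w, g⟩ hx
    simp only [mem_sigma, mem_filter, mem_univ, true_and, Fintype.mem_piFinset] at hx ⊢
    refine ⟨isSourced_assemble h w g hk hμ (fun a p hp => ?_) (fun a => (hx.2 a).2),
      isStart_assemble h w g hk hμ hx.1⟩
    rw [← (hx.2 a).1]
    congr 1
    apply Fin.ext
    dsimp only
    omega
  · rintro ⟨w, g⟩ _ ⟨w', g'⟩ _ he
    dsimp only at he
    obtain rfl := perm_eq_of_assemble_eq h hμ he
    congr 1
    funext a p
    have := congrFun he (blockEquiv (μ ∘ w) (sum_comp_perm_eq h w) ⟨a, p⟩)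
    rw [assemble_blockEquiv, assemble_blockEquiv] at this
    exact congrArg Prod.snd this
  · intro f hf
    simp only [mem_filter, mem_univ, true_and] at hf
    obtain ⟨w, g, hw, hg, hs, he⟩ := exists_assemble_eq h hk hμ hf.1 hf.2
    refine ⟨⟨w, g⟩, ?_, he⟩
    simp only [mem_sigma, mem_filter, mem_univ, true_and, Fintype.mem_piFinset]
    refine ⟨hw, fun a => ⟨hg a _ ?_, hs a⟩⟩
    exact Nat.sub_add_cancel (hμ _)
  · rintro ⟨w, g⟩ _
    dsimp only
    rw [assemble_snd_true_card, prod_pow_eq_pow_sum]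

open Classical in
theorem sum_isSourced {n k : ℕ} [NeZero n] {μ : Fin k → ℕ}
    (h : ∑ j, μ j = n) (hk : 2 ≤ k) (hμ : ∀ j, 0 < μ j) :
    ∑ f : Fin n → Fin k × Bool with IsSourced μ f,
      (Polynomial.X : ℚ[X]) ^ #{i | (f i).2 = true} =
      (n : ℚ[X]) * Polynomial.X * eulerianPoly (k - 1) * ∏ j, qInt (μ j) := by
  have : NeZero k := ⟨by omega⟩
  rw [sum_eq_smul_sum_of_rotation _ _ IsStart, filter_filter, sum_isSourced_isStart h hk hμ,
    nsmul_eq_mul]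
  · ring
  · intro f r hf
    rw [mem_filter] at hf ⊢
    exact ⟨mem_univ _, hf.2.rotate r⟩
  · intro f r
    rw [card_filter_rotate (fun i => (f i).2 = true) r]
  · intro f r s
    refine and_congr Iff.rfl ⟨fun H i hi => ?_, fun H i hi => H (i + r) ?_⟩
    · have := H (i - r) (by rw [← add_left_inj r, ← hi]; abel)
      simpa using this
    · rw [← hi]
      abel
  · intro f hf
    exact (mem_filter.1 hf).2.existsUnique_start hk

theorem exists_pred {n : ℕ} [NeZero n] (i : Fin n) :
    ∃ i' : Fin n, i' + 1 = i ∧ (i ≠ 0 → (i' : ℕ) + 1 = i) ∧ (i = 0 → (i' : ℕ) + 1 = n) := by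
  refine ⟨i - 1, sub_add_cancel _ _, fun hi => ?_, fun hi => ?_⟩
  all_goals
    have h := val_add_one_eq_mod (i - 1)
    rw [sub_add_cancel] at h
    have h1 := (i - 1).2
    have h2 := i.2
  · have h3 : (i : ℕ) ≠ 0 := fun h' => hi (Fin.ext (by simpa using h'))
    by_cases h4 : ((i - 1 : Fin n) : ℕ) + 1 = n
    · rw [h4, Nat.mod_self] at h
      omega
    · rw [Nat.mod_eq_of_lt (by omega)] at h
      omega
  · have h3 : (i : ℕ) = 0 := by rw [hi]; simp
    by_contra h4
    rw [Nat.mod_eq_of_lt (by omega)] at h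
    omega

theorem card_filter_le_add {n s : ℕ} (hs : s ≤ n) : #{i : Fin n | n ≤ (i : ℕ) + s} = s := by
  have h := card_filter_add_card_filter_not (s := (univ : Finset (Fin n)))
    (fun i : Fin n => (i : ℕ) < n - s)
  rw [Fin.card_filter_val_lt, card_univ, Fintype.card_fin] at h
  have h2 : ({i : Fin n | n ≤ (i : ℕ) + s} : Finset _) =
      ({i : Fin n | ¬ (i : ℕ) < n - s} : Finset _) := by
    ext i
    simp only [mem_filter, mem_univ, true_and]
    omega
  rw [h2]
  omega

/-! ### Counting sourced cycles with one color. -/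

open Classical in
-- With the only source at 0, the edge at 0 is forward, the edge at `n - 1` is reversed, and there
-- is a single switch between them. So the orientation is determined by the number of reversed
-- edges, which runs from 1 to `n - 1`.
theorem sum_isSourced_one_isSource {n : ℕ} [NeZero n] :
    ∑ f : Fin n → Fin 1 × Bool with IsSourced (fun _ => n) f ∧ IsSource f 0,
      (Polynomial.X : ℚ[X]) ^ #{i | (f i).2 = true} = Polynomial.X * qInt (n - 1) := by
  rw [qInt, ← Fin.sum_univ_eq_sum_range, mul_sum]
  symm
  -- The last `s + 1` edges are reversed; the shift by one keeps the reversed run nonempty and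
  -- yields the factor t.
  set F : ℕ → Fin n → Fin 1 × Bool := fun s i => (0, decide (n ≤ (i : ℕ) + (s + 1))) with hF
  have hsrc : ∀ s < n - 1, ∀ i, IsSource (F s) i ↔ i = 0 := by
    intro s hs i
    obtain ⟨i', hi', h1, h2⟩ := exists_pred i
    constructor
    · rintro ⟨a1, a2⟩
      by_contra hi
      have a3 := a1 i' hi' rfl
      have a4 := a2 rfl
      have := h1 hi
      simp only [hF, decide_eq_true_iff, decide_eq_false_iff_not] at a3 a4
      omega
    · rintro rfl
      refine ⟨fun x hx _ => ?_, fun _ => ?_⟩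
      · have : x = i' := add_right_cancel (hx.trans hi'.symm)
        have h3 := h2 rfl
        simp only [hF, decide_eq_true_iff, this]
        omega
      · refine decide_eq_false ?_
        rw [Fin.val_zero]
        omega
  have hcard : ∀ s < n - 1, #{i | (F s i).2 = true} = s + 1 := by
    intro s hs
    simp only [hF, decide_eq_true_iff]
    exact card_filter_le_add (by omega)
  refine sum_bij (fun s _ => F s) ?_ ?_ ?_ ?_
  · intro s _
    rw [mem_filter]
    refine ⟨mem_univ _, ⟨fun j => ?_, fun i hi => ?_, fun i hi => ?_, fun j => ?_⟩,
      (hsrc s s.2 0).2 rfl⟩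
    · rw [filter_true_of_mem fun i _ => Subsingleton.elim _ _]
      simp
    · exact absurd hi (by simp [hF])
    · exact absurd hi (by simp [hF])
    · exact ⟨0, ⟨Subsingleton.elim _ _, (hsrc s s.2 0).2 rfl⟩, fun i hi => (hsrc s s.2 i).1 hi.2⟩
  · intro s _ s' _ h
    have h1 := hcard s s.2
    have h2 := hcard s' s'.2
    rw [h, h2] at h1
    exact Fin.ext (by omega)
  · intro f hf
    rw [mem_filter] at hf
    obtain ⟨-, hf, h0⟩ := hf
    have hu : ∀ i, IsSource f i → i = 0 := by
      obtain ⟨r, hr, hr'⟩ := hf.source 0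
      intro i hi
      rw [hr' i ⟨Subsingleton.elim _ _, hi⟩, hr' 0 ⟨Subsingleton.elim _ _, h0⟩]
    -- A reversed edge followed by a forward edge would make their common vertex a source other than
    -- 0.
    have hstep : ∀ i : Fin n, (i : ℕ) + 1 < n → (f i).2 = true → (f (i + 1)).2 = true := by
      intro i hi hfi
      by_contra h
      rw [Bool.not_eq_true] at h
      have := hu (i + 1) ⟨fun x hx _ => by rw [add_right_cancel hx, hfi], fun _ => h⟩
      have h2 := val_add_one_eq_mod i
      rw [this, Nat.mod_eq_of_lt hi] at h2
      simp at h2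
    have hup : ∀ i : Fin n, (f i).2 = true → ∀ m, ∀ hm : m < n, (i : ℕ) ≤ m →
        (f ⟨m, hm⟩).2 = true := by
      intro i hi m
      induction m with
      | zero =>
        intro hm him
        have : i = ⟨0, hm⟩ := Fin.ext (by dsimp only; omega)
        rwa [← this]
      | succ m ih =>
        intro hm him
        rcases Nat.eq_or_lt_of_le him with h1 | h1
        · have : i = ⟨m + 1, hm⟩ := Fin.ext h1
          rwa [← this]
        · have h2 := hstep ⟨m, by omega⟩ hm (ih (by omega) (by omega))
          have h3 : (⟨m, by omega⟩ : Fin n) + 1 = ⟨m + 1, hm⟩ := by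
            apply Fin.ext
            rw [val_add_one_eq_mod, Nat.mod_eq_of_lt hm]
          rwa [h3] at h2
    set c := #{i | (f i).2 = true} with hc
    -- The reversed edges form a final segment of `Fin n`, which is determined by its cardinality.
    have hiff : ∀ i : Fin n, (f i).2 = true ↔ n ≤ (i : ℕ) + c := by
      intro i
      constructor
      · intro h
        have : #(Ici i) ≤ c := card_le_card fun j hj => by
          rw [mem_filter]
          exact ⟨mem_univ _, hup i h j j.2 (Fin.le_def.1 (mem_Ici.1 hj))⟩
        rw [Fin.card_Ici] at this
        omega
      · intro h
        by_contra hfi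
        have : c ≤ #(Ioi i) := card_le_card fun j hj => by
          rw [mem_filter] at hj
          rw [mem_Ioi]
          by_contra hij
          exact hfi (hup j hj.2 i i.2 (Fin.le_def.1 (not_lt.1 hij)))
        rw [Fin.card_Ioi] at this
        have := i.2
        omega
    have hn := NeZero.pos n
    have hc1 : 1 ≤ c := by
      obtain ⟨i', hi', -, h2⟩ := exists_pred (0 : Fin n)
      have h3 := (hiff i').1 (h0.1 i' hi' (Subsingleton.elim _ _))
      have := h2 rfl
      omega
    have hc2 : c < n := by
      have h3 := h0.2 (Subsingleton.elim _ _)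
      by_contra h4
      have := (hiff 0).2 (by omega)
      rw [h3] at this
      exact absurd this (by simp)
    refine ⟨⟨c - 1, by omega⟩, mem_univ _, ?_⟩
    funext i
    refine Prod.ext (Subsingleton.elim _ _) ?_
    simp only [hF, Nat.sub_add_cancel hc1]
    rw [Bool.eq_iff_iff, decide_eq_true_iff]
    exact (hiff i).symm
  · intro s _
    rw [hcard s s.2, pow_succ, mul_comm]

open Classical in
theorem sum_isSourced_one {n : ℕ} [NeZero n] :
    ∑ f : Fin n → Fin 1 × Bool with IsSourced (fun _ => n) f,
      (Polynomial.X : ℚ[X]) ^ #{i | (f i).2 = true} =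
      (n : ℚ[X]) * Polynomial.X * qInt (n - 1) := by
  rw [sum_eq_smul_sum_of_rotation _ _ IsSource, filter_filter, sum_isSourced_one_isSource,
    nsmul_eq_mul, mul_assoc]
  · intro f r hf
    rw [mem_filter] at hf ⊢
    exact ⟨mem_univ _, hf.2.rotate r⟩
  · intro f r
    rw [card_filter_rotate (fun i => (f i).2 = true) r]
  · intro f r s
    exact isSource_rotate f r s
  · intro f hf
    obtain ⟨i, hi, hi'⟩ := (mem_filter.1 hf).2.source 0
    exact ⟨i, hi.2, fun j hj => hi' j ⟨Subsingleton.elim _ _, hj⟩⟩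

/-! ### Ranks depend only on the orientation -/

theorem isChain_and {α : Type*} {R S : α → α → Prop} {l : List α} (hR : l.IsChain R)
    (hS : l.IsChain S) : l.IsChain fun a b => R a b ∧ S a b := by
  induction l with
  | nil => exact List.IsChain.nil
  | cons a l ih =>
    rw [List.isChain_cons] at hR hS ⊢
    exact ⟨fun b hb => ⟨hR.1 b hb, hS.1 b hb⟩, ih hR.2 hS.2⟩

/-- `a` and `b` are adjacent, and `a` precedes `b` in `σ`. -/
def Precedes {n : ℕ} (G : SimpleGraph (Fin n)) (σ : Equiv.Perm (Fin n)) (a b : Fin n) : Prop :=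
  G.Adj a b ∧ σ.symm a < σ.symm b

/-- Chains of letters replace chains of positions, so that σ enters only through the relative order
of adjacent letters. -/
theorem graphRank_eq {n : ℕ} (G : SimpleGraph (Fin n)) (σ : Equiv.Perm (Fin n)) (x : Fin n) :
    graphRank G σ x = sSup {k | ∃ l : List (Fin n), l.IsChain (Precedes G σ) ∧
      l.getLast? = some x ∧ l.length = k} := by
  rw [graphRank]
  congr 1
  ext k
  constructor
  · rintro ⟨l, h1, h2, h3, h4⟩
    refine ⟨l.map σ, ?_, h3, by rw [List.length_map, h4]⟩
    rw [List.isChain_map] at h2 ⊢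
    rw [← List.isChain_iff_pairwise] at h1
    refine (isChain_and h2 h1).imp fun a b h => ⟨h.1, by simpa using h.2⟩
  · rintro ⟨l, h1, h2, h3⟩
    have h4 : (l.map σ.symm).map σ = l := by simp
    refine ⟨l.map σ.symm, ?_, by rw [h4]; exact h1.imp fun a b h => h.1, by rw [h4, h2],
      by rw [List.length_map, h3]⟩
    rw [← List.isChain_iff_pairwise, List.isChain_map]
    exact h1.imp fun a b h => h.2

theorem graphRank_congr {n : ℕ} {G : SimpleGraph (Fin n)} {σ σ' : Equiv.Perm (Fin n)}
    (h : ∀ a b, G.Adj a b → (σ.symm a < σ.symm b ↔ σ'.symm a < σ'.symm b)) (x : Fin n) :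
    graphRank G σ x = graphRank G σ' x := by
  have : Precedes G σ = Precedes G σ' := by
    funext a b
    exact propext (and_congr_right fun hab => h a b hab)
  rw [graphRank_eq, graphRank_eq, this]

/-- A longest chain that ends in `a` can be prolonged by `b`. -/
theorem graphRank_lt {n : ℕ} {G : SimpleGraph (Fin n)} {σ : Equiv.Perm (Fin n)} {a b : Fin n}
    (hab : G.Adj a b) (hlt : σ.symm a < σ.symm b) : graphRank G σ a < graphRank G σ b := by
  -- Positions strictly increase along a chain, so its length is at most `n`. Without a bound the
  -- supremum in ℕ would be the default value 0.
  have hb : ∀ x, BddAbove {k | ∃ l : List (Fin n), l.IsChain (Precedes G σ) ∧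
      l.getLast? = some x ∧ l.length = k} := by
    refine fun x => ⟨n, ?_⟩
    rintro k ⟨l, h1, -, rfl⟩
    have h2 : (l.map σ.symm).Pairwise (· < ·) := by
      rw [← List.isChain_iff_pairwise, List.isChain_map]
      exact h1.imp fun a b h => h.2
    have h3 : (l.map σ.symm).Nodup := h2.imp fun h => ne_of_lt h
    have := h3.length_le_card
    rwa [List.length_map, Fintype.card_fin] at this
  obtain ⟨l, h1, h2, h3⟩ := Nat.sSup_mem
    (s := {k | ∃ l : List (Fin n), l.IsChain (Precedes G σ) ∧ l.getLast? = some a ∧ l.length = k})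
    ⟨1, [a], by simp, by simp, by simp⟩ (hb a)
  rw [graphRank_eq, graphRank_eq, ← Nat.succ_le_iff, ← h3]
  refine le_csSup (hb b) ⟨l ++ [b], ?_, by simp, by simp⟩
  refine h1.append (by simp) ?_
  intro x hx y hy
  rw [h2] at hx
  simp only [Option.mem_def, Option.some.injEq, List.head?_cons] at hx hy
  rw [← hx, ← hy]
  exact ⟨hab, hlt⟩

/-! ### Sorting by a key -/

/-- The permutation sends `i` to the number of elements with a smaller key. -/
theorem exists_perm_lt_iff {n : ℕ} {α : Type*} [LinearOrder α] (K : Fin n → α)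
    (hK : Function.Injective K) : ∃ τ : Equiv.Perm (Fin n), ∀ i j, τ i < τ j ↔ K i < K j := by
  classical
  have hlt : ∀ i, #{x | K x < K i} < n := fun i => by
    have : #{x | K x < K i} < #(univ : Finset (Fin n)) :=
      card_lt_card ⟨subset_univ _, fun h => by simpa using h (mem_univ i)⟩
    simpa using this
  set r : Fin n → Fin n := fun i => ⟨#{x | K x < K i}, hlt i⟩ with hr
  have hmono : ∀ i j, K i < K j → r i < r j := fun i j hij => by
    suffices #{x | K x < K i} < #{x | K x < K j} from this
    refine card_lt_card ⟨fun x hx => ?_, fun h => ?_⟩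
    · simp only [mem_filter, mem_univ, true_and] at hx ⊢
      exact hx.trans hij
    · have := h (by simpa using hij)
      simp at this
  have hiff : ∀ i j, r i < r j ↔ K i < K j := fun i j => by
    refine ⟨fun h => ?_, hmono i j⟩
    by_contra h2
    rcases (not_lt.1 h2).eq_or_lt with h3 | h3
    · rw [hK h3] at h
      exact lt_irrefl _ h
    · exact lt_asymm h (hmono _ _ h3)
  have hinj : Function.Injective r := fun i j h => by
    rcases lt_trichotomy (K i) (K j) with h1 | h1 | h1
    · exact absurd h (hmono _ _ h1).ne
    · exact hK h1
    · exact absurd h (hmono _ _ h1).ne'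
  exact ⟨Equiv.ofBijective r hinj.bijective_of_finite, hiff⟩

theorem val_perm_eq_card {n : ℕ} (τ : Equiv.Perm (Fin n)) (i : Fin n) :
    (τ i : ℕ) = #{x | τ x < τ i} := by
  rw [← Fin.card_Iio (τ i)]
  symm
  refine card_bij (fun x _ => τ x) ?_ ?_ ?_
  · intro x hx
    simpa using hx
  · intro x _ y _ h
    exact τ.injective h
  · intro y hy
    exact ⟨τ.symm y, by simpa using hy, by simp⟩

theorem perm_ext_of_lt_iff {n : ℕ} {τ τ' : Equiv.Perm (Fin n)}
    (h : ∀ i j, τ i < τ j ↔ τ' i < τ' j) : τ = τ' := by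
  ext i
  rw [val_perm_eq_card, val_perm_eq_card]
  simp only [h]

theorem strictMono_of_consecutive {n : ℕ} {α : Type*} [Preorder α] (K : Fin n → α)
    (h : ∀ p q : Fin n, (q : ℕ) = p + 1 → K p < K q) : StrictMono K := by
  intro p q hpq
  have key : ∀ m, ∀ hm : m < n, (p : ℕ) < m → K p < K ⟨m, hm⟩ := by
    intro m
    induction m with
    | zero => intro _ h; omega
    | succ m ih =>
      intro hm hpm
      have h1 := h ⟨m, by omega⟩ ⟨m + 1, hm⟩ rfl
      rcases Nat.eq_or_lt_of_le (Nat.lt_succ_iff.1 hpm) with h2 | h2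
      · have : p = ⟨m, by omega⟩ := Fin.ext h2
        rw [this]
        exact h1
      · exact (ih (by omega) h2).trans h1
  exact key q q.2 (Fin.lt_def.1 hpq)

/-! ### The directed cycle -/

theorem dirCycle_adj {n : ℕ} [NeZero n] (v : Equiv.Perm (Fin n)) (a b : Fin n) :
    (dirCycle v).Adj a b ↔ ∃ i, v i = a ∧ v (i + 1) = b := by
  constructor
  · rintro ⟨i, j, hi, hj, hij⟩
    have : j = i + 1 := Fin.ext (by rw [hij, val_add_one_eq_mod])
    exact ⟨i, hi, by rw [← this, hj]⟩
  · rintro ⟨i, hi, hj⟩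
    exact ⟨i, i + 1, hi, hj, val_add_one_eq_mod i⟩

theorem dirCycle_graph_adj {n : ℕ} [NeZero n] (hn : 2 ≤ n) (v : Equiv.Perm (Fin n)) (i j : Fin n) :
    (dirCycle v).toSimpleGraphInclusive.Adj (v i) (v j) ↔ i + 1 = j ∨ j + 1 = i := by
  rw [Digraph.toSimpleGraphInclusive, SimpleGraph.fromRel_adj, dirCycle_adj, dirCycle_adj]
  simp only [v.apply_eq_iff_eq, exists_eq_left, ne_eq]
  refine and_iff_right_of_imp ?_
  rintro (rfl | rfl)
  · exact fun h => add_one_ne_self hn i h.symm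
  · exact add_one_ne_self hn j

theorem dirCycle_graph_adj_iff_exists {n : ℕ} [NeZero n] (hn : 2 ≤ n) (v : Equiv.Perm (Fin n))
    (a b : Fin n) : (dirCycle v).toSimpleGraphInclusive.Adj a b ↔
      ∃ i, (v i = a ∧ v (i + 1) = b) ∨ (v i = b ∧ v (i + 1) = a) := by
  obtain ⟨i, rfl⟩ := v.surjective a
  obtain ⟨j, rfl⟩ := v.surjective b
  rw [dirCycle_graph_adj hn]
  simp only [v.apply_eq_iff_eq]
  constructor
  · rintro (h | h)
    · exact ⟨i, Or.inl ⟨rfl, h⟩⟩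
    · exact ⟨j, Or.inr ⟨rfl, h⟩⟩
  · rintro ⟨x, ⟨rfl, h⟩ | ⟨rfl, h⟩⟩
    · exact Or.inl h
    · exact Or.inr h

theorem digraphInv_dirCycle {n : ℕ} [NeZero n] (v σ : Equiv.Perm (Fin n)) :
    digraphInv (dirCycle v) σ = #{i | σ.symm (v (i + 1)) < σ.symm (v i)} := by
  classical
  rw [digraphInv, Set.ncard_eq_toFinset_card']
  symm
  refine card_bij (fun i _ => (v i, v (i + 1))) ?_ ?_ ?_
  · intro i hi
    simp only [Set.mem_toFinset, Set.mem_ofPred_eq, dirCycle_adj]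
    exact ⟨⟨i, rfl, rfl⟩, by simpa using hi⟩
  · intro i _ j _ h
    exact v.injective (congrArg Prod.fst h)
  · rintro ⟨a, b⟩ hab
    simp only [Set.mem_toFinset, Set.mem_ofPred_eq, dirCycle_adj] at hab
    obtain ⟨⟨i, rfl, rfl⟩, h⟩ := hab
    exact ⟨i, by simpa using h, rfl⟩

/-! ### Segments -/

theorem sum_take_eq (L : List ℕ) (a : Fin L.length) :
    (L.take a).sum = ∑ j ∈ Iio a, L.get j := by
  obtain ⟨a, ha⟩ := a
  induction a with
  | zero =>
    have : Iio (⟨0, ha⟩ : Fin L.length) = ∅ := by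
      ext b
      simp [Fin.lt_def]
    rw [this]
    simp
  | succ a ih =>
    dsimp only at ih ⊢
    rw [List.sum_take_succ L a (by omega), ih (by omega)]
    have : Iio (⟨a + 1, ha⟩ : Fin L.length) = insert ⟨a, by omega⟩ (Iio ⟨a, by omega⟩) := by
      ext b
      simp only [mem_insert, mem_Iio, Fin.lt_def, Fin.ext_iff]
      omega
    rw [this, sum_insert (by simp), add_comm]
    rfl

theorem inSegment_iff {n : ℕ} (L : List ℕ) (h : ∑ j, L.get j = n) (i : ℕ) (p : Fin n) :
    InSegment L i p ↔ ∃ hi : i < L.length, blockIndex L.get h p = ⟨i, hi⟩ := by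
  constructor
  · rintro ⟨hi, h1, h2⟩
    refine ⟨hi, ?_⟩
    rw [blockIndex_eq_iff, ← sum_take_eq]
    rw [List.sum_take_succ L i hi] at h2
    exact ⟨h1, h2⟩
  · rintro ⟨hi, h1⟩
    rw [blockIndex_eq_iff, ← sum_take_eq] at h1
    refine ⟨hi, h1.1, ?_⟩
    rw [List.sum_take_succ L i hi]
    exact h1.2

theorem mem_NSet_iff {n : ℕ} (G : SimpleGraph (Fin n)) (lam : n.Partition) (L : List ℕ)
    (hL : L = lam.parts.sort (· ≥ ·)) (h : ∑ j, L.get j = n) (σ : Equiv.Perm (Fin n)) :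
    σ ∈ NSet G lam ↔
      (∀ p q, p < q → blockIndex L.get h p = blockIndex L.get h q →
        ∃ p', p' < q ∧ blockIndex L.get h p' = blockIndex L.get h q ∧ G.Adj (σ p') (σ q)) ∧
      ∀ p q, blockIndex L.get h p = blockIndex L.get h q → ¬ IsGraphDescent G σ p q := by
  rw [NSet, Set.mem_ofPred_eq, ← hL, forall_and]
  refine and_congr ⟨fun H p q hpq hs => ?_, fun H i q hq => ?_⟩ ⟨fun H p q hs => ?_, fun H i p q => ?_⟩
  · have := H (blockIndex L.get h q) q
    rw [IsIsolatedIn, not_and, not_and] at this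
    have h1 := this ((inSegment_iff L h _ q).2 ⟨Fin.is_lt _, rfl⟩) (by
      have := ((blockIndex_eq_iff _ h p _).1 hs).1
      rw [sum_take_eq]
      have := Fin.lt_def.1 hpq
      omega)
    push Not at h1
    obtain ⟨p', h2, h3, h4⟩ := h1
    obtain ⟨_, h5⟩ := (inSegment_iff L h _ p').1 h2
    exact ⟨p', h3, h5, h4⟩
  · obtain ⟨h1, h2, h3⟩ := hq
    obtain ⟨hi, h4⟩ := (inSegment_iff L h _ q).1 h1
    -- The first position of the segment serves as the earlier position `p` in the hypothesis `H`.
    have h5 : blockIndex L.get h ⟨(L.take i).sum, h2.trans q.2⟩ = ⟨i, hi⟩ := by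
      have h6 := (blockIndex_eq_iff _ h q _).1 h4
      rw [blockIndex_eq_iff]
      have := sum_take_eq L ⟨i, hi⟩
      dsimp only at this ⊢
      omega
    obtain ⟨p', h6, h7, h8⟩ := H _ q (Fin.lt_def.2 h2) (h5.trans h4.symm)
    exact h3 p' ((inSegment_iff L h _ p').2 ⟨hi, h7.trans h4⟩) h6 h8
  · exact H (blockIndex L.get h q) p q ((inSegment_iff L h _ p).2 ⟨Fin.is_lt _, hs⟩)
      ((inSegment_iff L h _ q).2 ⟨Fin.is_lt _, rfl⟩)
  · intro h1 h2
    obtain ⟨hi, h3⟩ := (inSegment_iff L h _ p).1 h1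
    obtain ⟨_, h4⟩ := (inSegment_iff L h _ q).1 h2
    exact H p q (h3.trans h4.symm)

/-! ### Words as oriented colored cycles. -/

/-- The key by which a segment-sorted permutation is sorted. -/
def sortKey {n k : ℕ} (v : Equiv.Perm (Fin n)) (c : Fin n → Fin k) (R : Fin n → ℕ) (i : Fin n) : Fin k ×ₗ ℕ ×ₗ Fin n :=
  toLex (c i, toLex (R (v i), v i))

theorem sortKey_lt_iff {n k : ℕ} (v : Equiv.Perm (Fin n)) (c : Fin n → Fin k) (R : Fin n → ℕ) (i j : Fin n) :
    sortKey v c R i < sortKey v c R j ↔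
      c i < c j ∨ c i = c j ∧ (R (v i) < R (v j) ∨ R (v i) = R (v j) ∧ v i < v j) := by
  rw [sortKey, sortKey, Prod.Lex.toLex_lt_toLex, Prod.Lex.toLex_lt_toLex]

theorem sortKey_injective {n k : ℕ} (v : Equiv.Perm (Fin n)) (c : Fin n → Fin k) (R : Fin n → ℕ) :
    Function.Injective (sortKey v c R) := fun i j hij => by
  have h1 := congrArg (fun x => (ofLex (ofLex x).2).2) hij
  exact v.injective h1

section

variable {n k : ℕ} [NeZero n] (v : Equiv.Perm (Fin n)) {μ : Fin k → ℕ} (h : ∑ j, μ j = n)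

/-- The oriented colored cycle of a permutation: the color of a vertex is the segment that contains
it, and an edge is reversed iff it is an inversion. -/
def cycleData (σ : Equiv.Perm (Fin n)) (i : Fin n) : Fin k × Bool :=
  (blockIndex μ h (σ.symm (v i)), decide (σ.symm (v (i + 1)) < σ.symm (v i)))

/-- `σ` has no isolated letters and no descents in the segments of sizes `μ 0, μ 1, …`. -/
def IsSegmentSorted (σ : Equiv.Perm (Fin n)) : Prop :=
  (∀ p q, p < q → blockIndex μ h p = blockIndex μ h q →
    ∃ p', p' < q ∧ blockIndex μ h p' = blockIndex μ h q ∧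
      (dirCycle v).toSimpleGraphInclusive.Adj (σ p') (σ q)) ∧
  ∀ p q, blockIndex μ h p = blockIndex μ h q →
    ¬ IsGraphDescent (dirCycle v).toSimpleGraphInclusive σ p q

/-- Edges point from the earlier to the later letter, so an in-edge of the same color is an adjacent
earlier letter of the same segment. -/
theorem isSource_cycleData_iff (hn : 2 ≤ n) (σ : Equiv.Perm (Fin n)) (q : Fin n) :
    IsSource (cycleData v h σ) (v.symm (σ q)) ↔
      ∀ p, p < q → blockIndex μ h p = blockIndex μ h q →
        ¬ (dirCycle v).toSimpleGraphInclusive.Adj (σ p) (σ q) := by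
  obtain ⟨i, hi⟩ : ∃ i, v i = σ q := v.surjective _
  have hq : q = σ.symm (v i) := by rw [hi, σ.symm_apply_apply]
  subst hq
  rw [σ.apply_symm_apply, v.symm_apply_apply]
  have hne : ∀ j, σ.symm (v (j + 1)) ≠ σ.symm (v j) := fun j hj =>
    add_one_ne_self hn j (v.injective (σ.symm.injective hj))
  simp only [IsSource, cycleData, decide_eq_true_iff, decide_eq_false_iff_not]
  constructor
  · rintro ⟨h1, h2⟩ p hp hs hadj
    obtain ⟨j, hj⟩ : ∃ j, v j = σ p := v.surjective _
    obtain rfl : p = σ.symm (v j) := by rw [hj, σ.symm_apply_apply]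
    rw [σ.apply_symm_apply, dirCycle_graph_adj hn] at hadj
    rcases hadj with rfl | rfl
    · exact lt_asymm hp (h1 j rfl hs)
    · exact h2 hs hp
  · intro H
    constructor
    · rintro j rfl hs
      by_contra hlt
      refine H _ (lt_of_le_of_ne (not_lt.1 hlt) (hne j).symm) hs ?_
      rw [σ.apply_symm_apply, dirCycle_graph_adj hn]
      exact Or.inl rfl
    · intro hs hlt
      refine H _ hlt hs ?_
      rw [σ.apply_symm_apply, dirCycle_graph_adj hn]
      exact Or.inr rfl

/-- The first letter of a segment is always a source, and any further source would be an isolated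
letter. Letters of different segments are ordered like the segments. -/
theorem isSourced_cycleData (hn : 2 ≤ n) (hμ : ∀ j, 0 < μ j) {σ : Equiv.Perm (Fin n)}
    (hσ : IsSegmentSorted v h σ) : IsSourced μ (cycleData v h σ) := by
  refine ⟨fun j => ?_, fun i hi => ?_, fun i hi => ?_, fun j => ?_⟩
  · rw [← card_blockIndex_eq μ h j]
    refine card_bij (fun i _ => σ.symm (v i)) ?_ ?_ ?_
    · intro i hi
      rw [mem_filter] at hi ⊢
      exact ⟨mem_univ _, hi.2⟩
    · intro i _ i' _ hii
      exact v.injective (σ.symm.injective hii)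
    · intro p hp
      rw [mem_filter] at hp
      refine ⟨v.symm (σ p), ?_, by simp⟩
      rw [mem_filter]
      simpa [cycleData] using hp
  · simp only [cycleData] at hi ⊢
    rw [decide_eq_false_iff_not]
    intro hlt
    exact absurd (monotone_blockIndex μ h hlt.le) (not_le.2 hi)
  · simp only [cycleData] at hi ⊢
    rw [decide_eq_true_iff]
    by_contra hlt
    exact absurd (monotone_blockIndex μ h (not_lt.1 hlt)) (not_le.2 hi)
  · set p := blockEquiv μ h ⟨j, ⟨0, hμ j⟩⟩ with hp
    have hpj : blockIndex μ h p = j := blockIndex_blockEquiv _ _ _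
    have hmin : ∀ q, blockIndex μ h q = j → p ≤ q := fun q hq => by
      rw [Fin.le_def, hp, blockEquiv_val]
      have := ((blockIndex_eq_iff μ h q j).1 hq).1
      simpa using this
    have hc : ∀ q, (cycleData v h σ (v.symm (σ q))).1 = blockIndex μ h q := fun q => by
      simp [cycleData]
    refine ⟨v.symm (σ p), ⟨by rw [hc, hpj], ?_⟩, fun i hi => ?_⟩
    · rw [isSource_cycleData_iff v h hn]
      intro q hq hs
      exact absurd (hmin q (hs.trans hpj)) (not_le.2 hq)
    · obtain ⟨q, rfl⟩ : ∃ q, v.symm (σ q) = i := ⟨σ.symm (v i), by simp⟩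
      rw [hc, isSource_cycleData_iff v h hn] at hi
      rcases (hmin q hi.1).eq_or_lt with h1 | h1
      · rw [h1]
      · obtain ⟨p', h2, h3, h4⟩ := hσ.1 p q h1 (hpj.trans hi.1.symm)
        exact absurd h4 (hi.2 p' h2 h3)

/-- Between neighboring positions either the segment increases or, there being no descent, the pair
(rank, letter) does. So the keys strictly increase along the word. -/
theorem IsSegmentSorted.lt_iff {σ : Equiv.Perm (Fin n)} (hσ : IsSegmentSorted v h σ)
    (i j : Fin n) : σ.symm (v i) < σ.symm (v j) ↔
      sortKey v (fun i => (cycleData v h σ i).1)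
        (graphRank (dirCycle v).toSimpleGraphInclusive σ) i <
      sortKey v (fun i => (cycleData v h σ i).1)
        (graphRank (dirCycle v).toSimpleGraphInclusive σ) j := by
  set K := sortKey v (fun i => (cycleData v h σ i).1)
        (graphRank (dirCycle v).toSimpleGraphInclusive σ) with hK
  have hmono : StrictMono fun p => K (v.symm (σ p)) := by
    apply strictMono_of_consecutive
    intro p q hpq
    rw [hK, sortKey_lt_iff]
    simp only [cycleData, Equiv.apply_symm_apply, Equiv.symm_apply_apply]
    have hlt : p < q := Fin.lt_def.2 (by omega)
    rcases (monotone_blockIndex μ h hlt.le).lt_or_eq with h1 | h1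
    · exact Or.inl h1
    · refine Or.inr ⟨h1, ?_⟩
      have h2 := hσ.2 p q h1
      rw [IsGraphDescent, not_and] at h2
      have h3 := h2 hpq
      push Not at h3
      rcases h3.1.lt_or_eq with h4 | h4
      · exact Or.inl h4
      · refine Or.inr ⟨h4, lt_of_le_of_ne (h3.2 h4) fun h5 => hlt.ne (σ.injective h5)⟩
  have := hmono.lt_iff_lt (a := σ.symm (v i)) (b := σ.symm (v j))
  simp only [Equiv.apply_symm_apply, Equiv.symm_apply_apply] at this
  exact this.symm

theorem lt_iff_lt_of_orientation_eq (hn : 2 ≤ n) {σ σ' : Equiv.Perm (Fin n)}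
    (ho : ∀ i, σ.symm (v (i + 1)) < σ.symm (v i) ↔ σ'.symm (v (i + 1)) < σ'.symm (v i))
    (a b : Fin n) (hab : (dirCycle v).toSimpleGraphInclusive.Adj a b) :
    σ.symm a < σ.symm b ↔ σ'.symm a < σ'.symm b := by
  have hne : ∀ (σ : Equiv.Perm (Fin n)) j, σ.symm (v (j + 1)) ≠ σ.symm (v j) := fun σ j hj =>
    add_one_ne_self hn j (v.injective (σ.symm.injective hj))
  have hflip : ∀ (σ : Equiv.Perm (Fin n)) j,
      σ.symm (v j) < σ.symm (v (j + 1)) ↔ ¬ σ.symm (v (j + 1)) < σ.symm (v j) := fun σ j => by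
    rw [not_lt, le_iff_lt_or_eq, or_iff_left (hne σ j).symm]
  rw [dirCycle_graph_adj_iff_exists hn] at hab
  obtain ⟨i, ⟨rfl, rfl⟩ | ⟨rfl, rfl⟩⟩ := hab
  · rw [hflip, hflip, ho]
  · exact ho i

/-- Equal orientations give equal ranks, so the two words are sorted by the same keys. -/
theorem cycleData_injOn (hn : 2 ≤ n) {σ σ' : Equiv.Perm (Fin n)} (hσ : IsSegmentSorted v h σ)
    (hσ' : IsSegmentSorted v h σ') (he : cycleData v h σ = cycleData v h σ') : σ = σ' := by
  have ho : ∀ i, σ.symm (v (i + 1)) < σ.symm (v i) ↔ σ'.symm (v (i + 1)) < σ'.symm (v i) :=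
    fun i => decide_eq_decide.1 (congrArg Prod.snd (congrFun he i))
  have hR : graphRank (dirCycle v).toSimpleGraphInclusive σ =
      graphRank (dirCycle v).toSimpleGraphInclusive σ' :=
    funext (graphRank_congr (lt_iff_lt_of_orientation_eq v hn ho))
  have : v.trans σ.symm = v.trans σ'.symm := perm_ext_of_lt_iff fun i j => by
    simp only [Equiv.trans_apply]
    rw [hσ.lt_iff, hσ'.lt_iff, he, hR]
  ext x
  have h2 := congrArg (fun e => e (v.symm (σ x))) this
  simp only [Equiv.trans_apply, Equiv.apply_symm_apply, Equiv.symm_apply_apply] at h2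
  rw [← σ'.apply_symm_apply (σ x), ← h2]

/-! ### Realizing an orientation -/

/-- At the source of the smallest color both incident edges point outward: a neighbor of the same
color because it is a source, a neighbor of another color because that color is larger. One of these
edges is forward, the other reversed, so the orientation is not cyclic. -/
theorem IsSourced.exists_snd_eq {f : Fin n → Fin k × Bool} (hf : IsSourced μ f) (b : Bool) :
    ∃ i, (f i).2 = b := by
  by_contra! hcon
  have hk : (univ : Finset (Fin k)).Nonempty := ⟨(f 0).1, mem_univ _⟩
  obtain ⟨j, -, hj⟩ := exists_min_image univ id hk
  obtain ⟨i, ⟨hi, h1, h2⟩, -⟩ := hf.source j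
  cases b with
  | false =>
    have hc : ¬ (f (i + 1)).1 = (f i).1 := fun hc => hcon i (h2 hc)
    have h3 : ¬ (f i).1 < (f (i + 1)).1 := fun h3 => hcon i (hf.of_lt i h3)
    have := hj (f (i + 1)).1 (mem_univ _)
    rw [id, id, ← hi] at this
    exact h3 (lt_of_le_of_ne this (Ne.symm hc))
  | true =>
    have hi1 : i - 1 + 1 = i := sub_add_cancel _ _
    have hc : ¬ (f (i - 1)).1 = (f i).1 := fun hc => hcon (i - 1) (h1 _ hi1 hc)
    have h3 : ¬ (f i).1 < (f (i - 1)).1 := fun h3 => hcon (i - 1) (hf.of_gt (i - 1) (by rwa [hi1]))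
    have := hj (f (i - 1)).1 (mem_univ _)
    rw [id, id, ← hi] at this
    exact h3 (lt_of_le_of_ne this (Ne.symm hc))

/-- An orientation of a cycle that uses both directions is induced by a height function, which makes
it acyclic. -/
theorem exists_potential (o : Fin n → Bool) (h1 : ∃ i, o i = true) (h2 : ∃ i, o i = false) :
    ∃ φ : Fin n → ℤ, ∀ i, if o i then φ (i + 1) < φ i else φ i < φ (i + 1) := by
  classical
  set A : ℤ := ((#{i | o i = true} : ℕ) : ℤ) with hA
  set B : ℤ := ((#{i | o i = false} : ℕ) : ℤ) with hB
  have hApos : 0 < A := by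
    obtain ⟨i, hi⟩ := h1
    exact Int.natCast_pos.2 (card_pos.2 ⟨i, by simpa using hi⟩)
  have hBpos : 0 < B := by
    obtain ⟨i, hi⟩ := h2
    exact Int.natCast_pos.2 (card_pos.2 ⟨i, by simpa using hi⟩)
  -- There are `A` descending steps of size `B` and `B` ascending steps of size `A`, so the heights
  -- close up around the cycle.
  set s : Fin n → ℤ := fun i => if o i then -B else A with hs
  have htot : ∑ i, s i = 0 := by
    rw [hs, sum_ite, sum_const, sum_const, nsmul_eq_mul, nsmul_eq_mul]
    have : ({i | ¬ o i = true} : Finset (Fin n)) = ({i | o i = false} : Finset (Fin n)) := by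
      ext i
      simp
    rw [this, ← hA, ← hB]
    ring
  set φ : Fin n → ℤ := fun i => ∑ j ∈ Iio i, s j with hφ
  have hstep : ∀ i, φ (i + 1) = φ i + s i := by
    intro i
    have h3 : φ i + s i = ∑ j ∈ Iic i, s j := by
      rw [add_comm, hφ, ← sum_insert (by simp)]
      refine sum_congr ?_ fun _ _ => rfl
      ext b
      simp [le_iff_eq_or_lt]
    have h4 := val_add_one_eq_mod i
    have hi := i.2
    rw [h3]
    by_cases h5 : (i : ℕ) + 1 = n
    · have h6 : Iic i = univ := by
        ext b
        have := b.2
        simp only [mem_Iic, mem_univ, iff_true, Fin.le_def]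
        omega
      have h7 : Iio (i + 1) = ∅ := by
        ext b
        rw [mem_Iio, Fin.lt_def, h4, h5, Nat.mod_self]
        simp
      rw [h6, htot, hφ]
      simp only [h7, sum_empty]
    · rw [hφ]
      refine sum_congr ?_ fun _ _ => rfl
      ext b
      rw [mem_Iio, mem_Iic, Fin.lt_def, Fin.le_def, h4, Nat.mod_eq_of_lt (by omega)]
      omega
  refine ⟨φ, fun i => ?_⟩
  rw [hstep]
  by_cases hi : o i = true
  · simp only [hs, hi, if_true]
    linarith
  · simp only [hs, hi]
    simpa using hApos

theorem exists_perm_of_orientation (o : Fin n → Bool) (h1 : ∃ i, o i = true)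
    (h2 : ∃ i, o i = false) :
    ∃ σ : Equiv.Perm (Fin n), ∀ i, σ.symm (v (i + 1)) < σ.symm (v i) ↔ o i = true := by
  obtain ⟨φ, hφ⟩ := exists_potential o h1 h2
  obtain ⟨τ, hτ⟩ := exists_perm_lt_iff (fun i : Fin n => (toLex (φ i, i) : ℤ ×ₗ Fin n))
    (fun i j hij => congrArg (fun x => (ofLex x).2) hij)
  refine ⟨τ.symm.trans v, fun i => ?_⟩
  simp only [Equiv.symm_trans_apply, Equiv.symm_symm, Equiv.symm_apply_apply]
  rw [hτ, Prod.Lex.toLex_lt_toLex]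
  have := hφ i
  dsimp only
  by_cases hi : o i = true
  · rw [if_pos hi] at this
    exact ⟨fun _ => hi, fun _ => Or.inl this⟩
  · rw [if_neg hi] at this
    refine ⟨fun H => ?_, fun H => absurd H hi⟩
    rcases H with H | H
    · exact absurd H this.not_gt
    · exact absurd H.1 this.ne'

/-- An auxiliary word `σ₀` with the given orientation supplies the ranks; the word sought is
obtained by sorting by color, rank and letter. Ranks grow along edges, so the sorted word has the
same orientation and therefore the same ranks, which makes the sorting key its own. -/
theorem exists_cycleData_eq (hn : 2 ≤ n) {f : Fin n → Fin k × Bool}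
    (hf : IsSourced μ f) : ∃ σ, IsSegmentSorted v h σ ∧ cycleData v h σ = f := by
  classical
  obtain ⟨σ₀, h₀⟩ := exists_perm_of_orientation v (fun i => (f i).2) (hf.exists_snd_eq true)
    (hf.exists_snd_eq false)
  set G := (dirCycle v).toSimpleGraphInclusive with hG
  set R := graphRank G σ₀ with hR
  obtain ⟨τ, hτ⟩ := exists_perm_lt_iff (sortKey v (fun i => (f i).1) R) (sortKey_injective v _ _)
  have hR1 : ∀ i, (f i).2 = true → R (v (i + 1)) < R (v i) := fun i hi =>
    graphRank_lt ((dirCycle_graph_adj hn v _ _).2 (Or.inr rfl)) ((h₀ i).2 hi)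
  have hR2 : ∀ i, (f i).2 = false → R (v i) < R (v (i + 1)) := fun i hi =>
    graphRank_lt ((dirCycle_graph_adj hn v _ _).2 (Or.inl rfl)) (by
      have h1 : ¬ σ₀.symm (v (i + 1)) < σ₀.symm (v i) := by rw [h₀, hi]; simp
      refine lt_of_le_of_ne (not_lt.1 h1) fun h2 => ?_
      exact add_one_ne_self hn i (v.injective (σ₀.symm.injective h2)).symm)
  set σ : Equiv.Perm (Fin n) := τ.symm.trans v with hσ
  have hσv : ∀ i, σ.symm (v i) = τ i := fun i => by simp [hσ]
  have hστ : ∀ i, σ (τ i) = v i := fun i => by simp [hσ]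
  have hkey : ∀ i j, τ i < τ j ↔ (f i).1 < (f j).1 ∨ (f i).1 = (f j).1 ∧
      (R (v i) < R (v j) ∨ R (v i) = R (v j) ∧ v i < v j) := fun i j => by
    rw [hτ, sortKey_lt_iff]
  have hori : ∀ i, τ (i + 1) < τ i ↔ (f i).2 = true := by
    intro i
    rw [hkey]
    cases hi : (f i).2 with
    | true =>
      refine ⟨fun _ => rfl, fun _ => ?_⟩
      rcases lt_trichotomy (f (i + 1)).1 (f i).1 with h1 | h1 | h1
      · exact Or.inl h1
      · exact Or.inr ⟨h1, Or.inl (hR1 i hi)⟩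
      · have := hf.of_lt i h1
        rw [hi] at this
        exact absurd this (by simp)
    | false =>
      refine ⟨fun H => ?_, fun H => absurd H (by simp)⟩
      rcases H with H | ⟨-, H | H⟩
      · have := hf.of_gt i H
        rw [hi] at this
        exact this
      · exact absurd H (hR2 i hi).not_gt
      · exact absurd H.1 (hR2 i hi).ne'
  have hrank : graphRank G σ = R := by
    refine funext (graphRank_congr (lt_iff_lt_of_orientation_eq v hn fun i => ?_))
    rw [hσv, hσv, hori, h₀]
  have hlow : ∀ S : Finset (Fin k), #{i | (f i).1 ∈ S} = ∑ j ∈ S, μ j := by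
    intro S
    rw [card_eq_sum_card_fiberwise (f := fun i => (f i).1) (t := S)]
    · refine sum_congr rfl fun j hj => ?_
      rw [← hf.card_eq j, filter_filter]
      congr 1
      ext q
      simp only [mem_filter, mem_univ, true_and, and_iff_right_iff_imp]
      rintro rfl
      exact hj
    · intro q hq
      simpa using hq
  -- The position of `i` is the number of smaller keys, which is squeezed between the sizes of the
  -- color classes below and up to its color.
  have hseg : ∀ i, blockIndex μ h (τ i) = (f i).1 := by
    intro i
    rw [blockIndex_eq_iff, val_perm_eq_card]
    constructor
    · rw [← hlow]
      refine card_le_card fun x hx => ?_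
      simp only [mem_filter, mem_univ, true_and, mem_Iio] at hx ⊢
      exact (hkey x i).2 (Or.inl hx)
    · rw [add_comm, ← sum_insert (by simp), ← hlow]
      refine card_lt_card ⟨fun x hx => ?_, fun H => ?_⟩
      · simp only [mem_filter, mem_univ, true_and, mem_insert, mem_Iio] at hx ⊢
        rcases (hkey x i).1 hx with h1 | h1
        · exact Or.inr h1
        · exact Or.inl h1.1
      · have := @H i (by simp)
        simp at this
  have hdata : cycleData v h σ = f := by
    funext i
    refine Prod.ext ?_ ?_
    · simp only [cycleData, hσv, hseg]
    · simp only [cycleData, hσv]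
      rw [Bool.eq_iff_iff, decide_eq_true_iff]
      exact hori i
  refine ⟨σ, ⟨fun p q hpq hs => ?_, fun p q hs hd => ?_⟩, hdata⟩
  · have hc : ∀ q, (cycleData v h σ (v.symm (σ q))).1 = blockIndex μ h q := fun q => by
      simp [cycleData]
    by_contra! hcon
    -- The first letter of the segment is a source, and an isolated letter would be a second one.
    have hsrc : ∀ q, (∀ p', p' < q → blockIndex μ h p' = blockIndex μ h q → ¬ G.Adj (σ p') (σ q)) →
        IsSource f (v.symm (σ q)) := fun q H => by
      rw [← hdata]
      exact (isSource_cycleData_iff v h hn σ q).2 H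
    have hne : ({x | blockIndex μ h x = blockIndex μ h q} : Finset (Fin n)).Nonempty :=
      ⟨q, by simp⟩
    obtain ⟨x, hx, hmin⟩ := exists_min_image _ id hne
    rw [mem_filter] at hx
    have hx1 := hsrc x fun p' hp' hs' => absurd (hmin p' (by
      rw [mem_filter]
      exact ⟨mem_univ _, hs'.trans hx.2⟩)) (not_le.2 hp')
    have hq1 := hsrc q hcon
    obtain ⟨y, -, hy⟩ := hf.source (blockIndex μ h q)
    have e1 := hy _ ⟨by rw [← hdata, hc, hx.2], hx1⟩
    have e2 := hy _ ⟨by rw [← hdata, hc], hq1⟩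
    have hxq : x = q := σ.injective (v.symm.injective (e1.trans e2.symm))
    have := hmin p (by rw [mem_filter]; exact ⟨mem_univ _, hs⟩)
    rw [hxq] at this
    exact absurd this (not_le.2 hpq)
  · obtain ⟨i, rfl⟩ := τ.surjective p
    obtain ⟨j, rfl⟩ := τ.surjective q
    obtain ⟨h1, h2⟩ := hd
    rw [hrank, hστ, hστ] at h2
    rw [hseg, hseg] at hs
    have hlt : τ j < τ i := (hkey j i).2 (Or.inr ⟨hs.symm, by
      rcases h2 with h2 | h2
      · exact Or.inl h2
      · exact Or.inr ⟨h2.1.symm, h2.2⟩⟩)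
    have := Fin.lt_def.1 hlt
    omega

open Classical in
theorem sum_isSegmentSorted (hn : 2 ≤ n) (hμ : ∀ j, 0 < μ j) :
    ∑ σ : Equiv.Perm (Fin n) with IsSegmentSorted v h σ,
      (Polynomial.X : ℚ[X]) ^ digraphInv (dirCycle v) σ =
    ∑ f : Fin n → Fin k × Bool with IsSourced μ f,
      (Polynomial.X : ℚ[X]) ^ #{i | (f i).2 = true} := by
  refine sum_bij (fun σ _ => cycleData v h σ) ?_ ?_ ?_ ?_
  · intro σ hσ
    rw [mem_filter] at hσ ⊢
    exact ⟨mem_univ _, isSourced_cycleData v h hn hμ hσ.2⟩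
  · intro σ hσ σ' hσ' he
    rw [mem_filter] at hσ hσ'
    exact cycleData_injOn v h hn hσ.2 hσ'.2 he
  · intro f hf
    rw [mem_filter] at hf
    obtain ⟨σ, h1, h2⟩ := exists_cycleData_eq v h hn hf.2
    exact ⟨σ, by rw [mem_filter]; exact ⟨mem_univ _, h1⟩, h2⟩
  · intro σ _
    rw [digraphInv_dirCycle]
    simp [cycleData]

end

/-! ### Evaluation of the inversion sums. -/

theorem sum_sort_get {n : ℕ} (lam : n.Partition) :
    ∑ j, (lam.parts.sort (· ≥ ·)).get j = n := by
  have : (∑ j, (lam.parts.sort (· ≥ ·)).get j) = (lam.parts.sort (· ≥ ·)).sum := by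
    rw [← List.sum_ofFn, List.ofFn_get]
  rw [this, ← Multiset.sum_coe, Multiset.sort_eq, lam.parts_sum]

theorem sort_get_pos {n : ℕ} (lam : n.Partition) (j : Fin (lam.parts.sort (· ≥ ·)).length) :
    0 < (lam.parts.sort (· ≥ ·)).get j :=
  lam.parts_pos ((Multiset.mem_sort (· ≥ ·)).1 (List.get_mem _ j))

open Classical in
theorem invSum_eq {n : ℕ} [NeZero n] (hn : 2 ≤ n) (v : Equiv.Perm (Fin n)) (lam : n.Partition) :
    invSum (dirCycle v) lam =
    ∑ f : Fin n → Fin (lam.parts.sort (· ≥ ·)).length × Bool with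
      IsSourced (lam.parts.sort (· ≥ ·)).get f,
      (Polynomial.X : ℚ[X]) ^ #{i | (f i).2 = true} := by
  rw [← sum_isSegmentSorted v (sum_sort_get lam) hn (sort_get_pos lam), invSum]
  refine sum_congr ?_ fun _ _ => rfl
  ext σ
  rw [mem_filter, mem_filter]
  exact and_congr_right fun _ => mem_NSet_iff _ lam _ rfl (sum_sort_get lam) σ

theorem invSum_of_two_le_card {n : ℕ} [NeZero n] (hn : 2 ≤ n) (v : Equiv.Perm (Fin n))
    (lam : n.Partition) (hlam : 2 ≤ lam.parts.card) :
    invSum (dirCycle v) lam =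
      (n : ℚ[X]) * Polynomial.X * eulerianPoly (lam.parts.card - 1) *
        (lam.parts.map qInt).prod := by
  have hlen : (lam.parts.sort (· ≥ ·)).length = lam.parts.card := Multiset.length_sort _
  rw [invSum_eq hn, sum_isSourced (sum_sort_get lam) (by rw [hlen]; exact hlam) (sort_get_pos lam),
    show (lam.parts.sort (· ≥ ·)).length - 1 = lam.parts.card - 1 by rw [hlen]]
  congr 1
  have : (lam.parts.map qInt) = ((lam.parts.sort (· ≥ ·)).map qInt : Multiset ℚ[X]) := by
    rw [← Multiset.map_coe, Multiset.sort_eq]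
  rw [this, Multiset.prod_coe, ← List.prod_ofFn]
  congr 1
  apply List.ext_get <;> simp

theorem invSum_indiscrete {n : ℕ} [NeZero n] (hn : 2 ≤ n) (v : Equiv.Perm (Fin n)) :
    invSum (dirCycle v) (Nat.Partition.indiscrete n) =
      (n : ℚ[X]) * Polynomial.X * qInt (n - 1) := by
  classical
  have hs : (Nat.Partition.indiscrete n).parts.sort (· ≥ ·) = [n] := by
    rw [Nat.Partition.indiscrete_parts (by omega), Multiset.sort_singleton]
  rw [← sum_isSourced_one, invSum_eq hn, hs]
  have : ([n] : List ℕ).get = fun _ => n := by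
    funext j
    simp
  rw [this]
  rfl

/-! ### Jacobi's formula and traces of powers -/

theorem derivation_prod {k K ι : Type*} [CommRing k] [CommRing K] [Algebra k K] [DecidableEq ι]
    (d : Derivation k K K) (s : Finset ι) (f : ι → K) :
    d (∏ i ∈ s, f i) = ∑ i ∈ s, (∏ j ∈ s.erase i, f j) * d (f i) := by
  induction s using Finset.induction_on with
  | empty => simp
  | insert a s ha ih =>
    rw [prod_insert ha, Derivation.leibniz, ih, sum_insert ha, erase_insert ha, smul_eq_mul,
      smul_eq_mul, mul_sum, add_comm]
    congr 1
    refine sum_congr rfl fun i hi => ?_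
    have hne : a ≠ i := fun h => ha (h ▸ hi)
    rw [erase_insert_of_ne hne, prod_insert (fun h => ha (mem_of_mem_erase h)), mul_assoc]

/-- By the Leibniz rule, `d A.det` is the sum over the columns of the determinants with that column
differentiated; Cramer's rule identifies them with the diagonal entries on the right. -/
theorem derivation_det {k K ι : Type*} [CommRing k] [CommRing K] [Algebra k K] [DecidableEq ι]
    [Fintype ι] (d : Derivation k K K) (A : Matrix ι ι K) :
    d A.det = (A.adjugate * A.map d).trace := by
  have h1 : ∀ i, (A.adjugate * A.map d) i i = (A.updateCol i fun j => d (A j i)).det := by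
    intro i
    rw [← Matrix.cramer_apply, Matrix.cramer_eq_adjugate_mulVec]
    rfl
  rw [Matrix.trace]
  simp only [Matrix.diag_apply, h1, Matrix.det_apply, map_sum]
  rw [sum_comm]
  refine sum_congr rfl fun σ _ => ?_
  rw [Units.smul_def, map_zsmul, derivation_prod, smul_sum]
  refine sum_congr rfl fun i _ => ?_
  rw [Units.smul_def, ← mul_prod_erase univ _ (mem_univ i), Matrix.updateCol_self, mul_comm]
  congr 2
  refine prod_congr rfl fun j hj => ?_
  rw [Matrix.updateCol_ne (ne_of_mem_erase hj)]

/-- For A = 1 - zB the adjugate is det A times the Neumann series `T`, and A' = -B, so Jacobi's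
formula reads (det A)' = -det A · tr(TB). -/
theorem derivative_det_one_sub {S ι : Type*} [CommRing S] [DecidableEq ι] [Fintype ι]
    (B : Matrix ι ι S) :
    PowerSeries.derivative S
        ((1 : Matrix ι ι (PowerSeries S)) - (PowerSeries.X : PowerSeries S) • B.map PowerSeries.C).det =
      - (((1 : Matrix ι ι (PowerSeries S)) -
          (PowerSeries.X : PowerSeries S) • B.map PowerSeries.C).det *
        PowerSeries.mk fun k => (B ^ (k + 1)).trace) := by
  set A := (1 : Matrix ι ι (PowerSeries S)) - (PowerSeries.X : PowerSeries S) • B.map PowerSeries.C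
    with hA
  set T : Matrix ι ι (PowerSeries S) := Matrix.of fun i j => PowerSeries.mk fun k => (B ^ k) i j
    with hT
  have hBT : ∀ i j, (B.map PowerSeries.C * T) i j = PowerSeries.mk fun k => (B ^ (k + 1)) i j := by
    intro i j
    ext k
    rw [Matrix.mul_apply, map_sum, PowerSeries.coeff_mk, pow_succ', Matrix.mul_apply]
    refine sum_congr rfl fun l _ => ?_
    rw [Matrix.map_apply, PowerSeries.coeff_C_mul, hT, Matrix.of_apply, PowerSeries.coeff_mk]
  have hTB : ∀ i j, (T * B.map PowerSeries.C) i j = PowerSeries.mk fun k => (B ^ (k + 1)) i j := by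
    intro i j
    ext k
    rw [Matrix.mul_apply, map_sum, PowerSeries.coeff_mk, pow_succ, Matrix.mul_apply]
    refine sum_congr rfl fun l _ => ?_
    rw [Matrix.map_apply, PowerSeries.coeff_mul_C, hT, Matrix.of_apply, PowerSeries.coeff_mk]
  have hAT : A * T = 1 := by
    rw [hA, sub_mul, one_mul, Matrix.smul_mul]
    ext i j k
    rw [Matrix.sub_apply, Matrix.smul_apply, hBT, map_sub, smul_eq_mul]
    cases k with
    | zero =>
      rw [PowerSeries.coeff_zero_X_mul, hT, Matrix.of_apply, PowerSeries.coeff_mk, pow_zero, sub_zero,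
        Matrix.one_apply, Matrix.one_apply]
      split_ifs <;> simp
    | succ k =>
      rw [PowerSeries.coeff_succ_X_mul, PowerSeries.coeff_mk, hT, Matrix.of_apply,
        PowerSeries.coeff_mk, sub_self, Matrix.one_apply]
      split_ifs <;> simp [PowerSeries.coeff_one]
  have hadj : A.adjugate = A.det • T := by
    calc A.adjugate = A.adjugate * (A * T) := by rw [hAT, mul_one]
      _ = A.det • T := by rw [← mul_assoc, Matrix.adjugate_mul, Matrix.smul_mul, one_mul]
  have hd : A.map (PowerSeries.derivative S) = -(B.map PowerSeries.C) := by
    ext1 i j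
    rw [Matrix.map_apply, hA, Matrix.sub_apply, Matrix.smul_apply, map_sub, Matrix.map_apply,
      smul_eq_mul, Derivation.leibniz, PowerSeries.derivative_C, PowerSeries.derivative_X,
      Matrix.neg_apply, Matrix.map_apply, Matrix.one_apply]
    split_ifs <;> simp
  rw [derivation_det, hadj, hd, Matrix.mul_neg, Matrix.trace_neg, Matrix.smul_mul,
    Matrix.trace_smul, smul_eq_mul]
  congr 2
  ext k
  rw [Matrix.trace, map_sum, PowerSeries.coeff_mk, Matrix.trace]
  refine sum_congr rfl fun i _ => ?_
  rw [Matrix.diag_apply, hTB, PowerSeries.coeff_mk, Matrix.diag_apply]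

theorem pow_apply_eq_sum {S ι : Type*} [CommRing S] [DecidableEq ι] [Fintype ι]
    (B : Matrix ι ι S) (m : ℕ) (a b : ι) :
    (B ^ m) a b = ∑ κ : Fin (m + 1) → ι with κ 0 = a ∧ κ (Fin.last m) = b,
      ∏ i : Fin m, B (κ i.castSucc) (κ i.succ) := by
  induction m generalizing a with
  | zero =>
    rw [pow_zero, Matrix.one_apply]
    simp only [univ_eq_empty, prod_empty, sum_const, nsmul_eq_mul, mul_one]
    split_ifs with h
    · subst h
      have : ({κ : Fin 1 → ι | κ 0 = a ∧ κ (Fin.last 0) = a} : Finset _) = {fun _ => a} := by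
        ext κ
        simp only [mem_filter, mem_univ, true_and, mem_singleton, Fin.last_zero, and_self]
        exact ⟨fun h => funext fun i => by rw [Subsingleton.elim i 0, h], fun h => by rw [h]⟩
      rw [this]
      simp
    · rw [filter_false_of_mem]
      · simp
      · rintro κ - ⟨h1, h2⟩
        exact h (h1.symm.trans h2)
  | succ m ih =>
    rw [pow_succ', Matrix.mul_apply]
    simp only [ih, sum_filter, mul_sum]
    rw [sum_comm]
    conv_rhs => rw [← Equiv.sum_comp (Fin.consEquiv fun _ => ι), Fintype.sum_prod_type, sum_comm]
    refine sum_congr rfl fun κ _ => ?_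
    rw [sum_eq_single (κ 0), sum_eq_single a]
    · simp only [Fin.consEquiv_apply, Fin.cons_zero, true_and, Fin.prod_univ_succ,
        Fin.castSucc_zero, Fin.cons_succ, ← Fin.succ_last, ← Fin.succ_castSucc, mul_ite, mul_zero]
    · intro a' _ ha
      rw [if_neg]
      simp only [Fin.consEquiv_apply, Fin.cons_zero]
      exact fun h => ha h.1
    · simp
    · intro l _ hl
      rw [if_neg, mul_zero]
      exact fun h => hl h.1.symm
    · simp

theorem trace_pow_eq_sum {S ι : Type*} [CommRing S] [DecidableEq ι] [Fintype ι]
    (B : Matrix ι ι S) (m : ℕ) :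
    (B ^ (m + 1)).trace = ∑ κ : Fin (m + 1) → ι, ∏ i, B (κ i) (κ (i + 1)) := by
  rw [Matrix.trace]
  simp only [Matrix.diag_apply, pow_succ, Matrix.mul_apply, pow_apply_eq_sum, sum_filter, sum_mul]
  refine (sum_congr rfl fun a _ => sum_comm).trans (sum_comm.trans (sum_congr rfl fun κ _ => ?_))
  rw [sum_eq_single (κ 0), sum_eq_single (κ (Fin.last m))]
  · simp [Fin.prod_univ_castSucc, Fin.coeSucc_eq_succ]
  · intro b _ hb
    rw [if_neg, zero_mul]
    exact fun h => hb h.2.symm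
  · simp
  · intro a _ ha
    refine sum_eq_zero fun b _ => ?_
    rw [if_neg, zero_mul]
    exact fun h => ha h.1.symm
  · simp

/-! ### The transfer matrix -/

/-- The matrix whose powers count colorings of paths by ascents. -/
def transferMatrix {S : Type*} [CommRing S] {N : ℕ} (t : S) (x : Fin N → S) :
    Matrix (Fin N) (Fin N) S :=
  Matrix.of fun i j => if i < j then t * x j else if j < i then x j else 0

/-- By the matrix determinant lemma, a rank one perturbation changes the determinant affinely in
`s`. -/
theorem exists_det_add_rank_one {K ι : Type*} [CommRing K] [DecidableEq ι] [Fintype ι]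
    {A : Matrix ι ι K} (hA : IsUnit A.det) (y : ι → K) :
    ∃ q, ∀ s, (A + Matrix.of fun _ j => s * y j).det = A.det + s * q := by
  refine ⟨A.det * ((Matrix.replicateRow Unit y * A⁻¹ * Matrix.replicateCol Unit (fun _ : ι => (1 : K))) () ()),
    fun s => ?_⟩
  have h := Matrix.det_add_replicateCol_mul_replicateRow (ι := Unit) hA (fun _ => s) y
  have h1 : Matrix.replicateCol Unit (fun _ : ι => s) * Matrix.replicateRow Unit y =
      Matrix.of fun _ j => s * y j := by
    ext i j
    simp [Matrix.mul_apply]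
  have h2 : (1 + Matrix.replicateRow Unit y * A⁻¹ * Matrix.replicateCol Unit (fun _ : ι => s)).det =
      1 + s * ((Matrix.replicateRow Unit y * A⁻¹ * Matrix.replicateCol Unit (fun _ : ι => (1 : K))) () ()) := by
    rw [Matrix.det_unique, Matrix.add_apply, Matrix.one_apply_eq]
    congr 1
    rw [Matrix.mul_apply, Matrix.mul_apply, mul_sum]
    refine sum_congr rfl fun j _ => ?_
    simp [mul_comm]
  rw [h1, h2] at h
  rw [h]
  ring

/-- Adding s x_j z to every entry of column j clears the entries below the diagonal for s = 1 and
those above it for s = t, leaving a triangular matrix with diagonal entries 1 + s x_j z. The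
determinant is affine in s, so these two values give the one at s = 0. -/
theorem det_one_sub_transferMatrix {S : Type*} [CommRing S] {N : ℕ} (t : S) (x : Fin N → S) :
    (PowerSeries.C t - 1) * ((1 : Matrix (Fin N) (Fin N) (PowerSeries S)) -
        (PowerSeries.X : PowerSeries S) • (transferMatrix t x).map PowerSeries.C).det =
      PowerSeries.C t * ∏ j, (1 + PowerSeries.C (x j) * PowerSeries.X) -
        ∏ j, (1 + PowerSeries.C t * (PowerSeries.C (x j) * PowerSeries.X)) := by
  set A := (1 : Matrix (Fin N) (Fin N) (PowerSeries S)) -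
    (PowerSeries.X : PowerSeries S) • (transferMatrix t x).map PowerSeries.C with hA
  have hAij : ∀ i j, A i j = (if i = j then 1 else 0) - PowerSeries.X *
      PowerSeries.C (if i < j then t * x j else if j < i then x j else 0) := fun i j => by
    rw [hA, Matrix.sub_apply, Matrix.one_apply]
    rfl
  have hunit : IsUnit A.det := by
    rw [PowerSeries.isUnit_iff_constantCoeff, RingHom.map_det]
    have : (PowerSeries.constantCoeff (R := S)).mapMatrix A = 1 := by
      ext i j
      rw [RingHom.mapMatrix_apply, Matrix.map_apply, hAij, Matrix.one_apply]
      split_ifs <;> simp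
    rw [this, Matrix.det_one]
    exact isUnit_one
  obtain ⟨q, hq⟩ := exists_det_add_rank_one hunit fun j => PowerSeries.C (x j) * PowerSeries.X
  have h1 := hq 1
  have h2 := hq (PowerSeries.C t)
  rw [Matrix.det_of_isUpperTriangular] at h1
  · rw [Matrix.det_of_isLowerTriangular] at h2
    · simp only [Matrix.add_apply, Matrix.of_apply, hAij, lt_irrefl, if_false, if_true, map_zero,
        mul_zero, sub_zero, one_mul] at h1 h2
      rw [h1, h2]
      ring
    · intro i j hij
      have hij' : i < j := by simpa using hij
      rw [Matrix.add_apply, Matrix.of_apply, hAij, if_neg hij'.ne, if_pos hij', map_mul]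
      ring
  · intro i j hij
    have hij' : j < i := by simpa using hij
    rw [Matrix.add_apply, Matrix.of_apply, hAij, if_neg hij'.ne', if_neg hij'.not_gt, if_pos hij']
    ring

/-! ### Colorings of the directed cycle -/

theorem isProperColoring_dirCycle {n : ℕ} [NeZero n] (hn : 2 ≤ n) (v : Equiv.Perm (Fin n))
    (κ : Fin n → ℕ) :
    IsProperColoring (dirCycle v) κ ↔ ∀ i, κ (v i) ≠ κ (v (i + 1)) := by
  constructor
  · intro h i
    exact h _ _ ((dirCycle_graph_adj hn v _ _).2 (Or.inl rfl))
  · intro h a b hab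
    obtain ⟨i, ⟨rfl, rfl⟩ | ⟨rfl, rfl⟩⟩ := (dirCycle_graph_adj_iff_exists hn v a b).1 hab
    · exact h i
    · exact (h i).symm

theorem colorAsc_dirCycle {n : ℕ} [NeZero n] (v : Equiv.Perm (Fin n)) (κ : Fin n → ℕ) :
    colorAsc (dirCycle v) κ = #{i | κ (v i) < κ (v (i + 1))} := by
  classical
  rw [colorAsc, Set.ncard_eq_toFinset_card']
  symm
  refine card_bij (fun i _ => (v i, v (i + 1))) ?_ ?_ ?_
  · intro i hi
    simp only [Set.mem_toFinset, Set.mem_ofPred_eq, dirCycle_adj]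
    exact ⟨⟨i, rfl, rfl⟩, by simpa using hi⟩
  · intro i _ j _ h
    exact v.injective (congrArg Prod.fst h)
  · rintro ⟨a, b⟩ hab
    simp only [Set.mem_toFinset, Set.mem_ofPred_eq, dirCycle_adj] at hab
    obtain ⟨⟨i, rfl, rfl⟩, h⟩ := hab
    exact ⟨i, by simpa using h, rfl⟩

/-- The weight of a cyclic word: `t` to the number of cyclic ascents if cyclically consecutive
letters are distinct, and `0` otherwise. -/
def cyclicWeight {n N : ℕ} [NeZero n] (κ : Fin n → Fin N) : ℚ[X] :=
  ∏ i, if κ i < κ (i + 1) then Polynomial.X else if κ (i + 1) < κ i then 1 else 0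

theorem cyclicWeight_of_ne {n N : ℕ} [NeZero n] {κ : Fin n → Fin N}
    (h : ∀ i, κ i ≠ κ (i + 1)) :
    cyclicWeight κ = Polynomial.X ^ #{i | κ i < κ (i + 1)} := by
  rw [cyclicWeight, card_filter, ← prod_pow_eq_pow_sum]
  refine prod_congr rfl fun i _ => ?_
  rcases (h i).lt_or_gt with h1 | h1
  · simp [h1]
  · simp [h1, h1.not_gt]

theorem cyclicWeight_of_eq {n N : ℕ} [NeZero n] {κ : Fin n → Fin N}
    (h : ¬ ∀ i, κ i ≠ κ (i + 1)) : cyclicWeight κ = 0 := by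
  push Not at h
  obtain ⟨i, hi⟩ := h
  rw [cyclicWeight, prod_eq_zero (mem_univ i)]
  simp [hi]

theorem coeff_chromaticQSym_dirCycle {n N : ℕ} [NeZero n] (hn : 2 ≤ n) (v : Equiv.Perm (Fin n))
    (m : Fin N →₀ ℕ) :
    MvPowerSeries.coeff (m.embDomain Fin.valEmbedding) (chromaticQSym (dirCycle v)) =
      ∑ κ : Fin n → Fin N with ∑ i, Finsupp.single (κ i) 1 = m, cyclicWeight κ := by
  classical
  have hfin : {κ : Fin n → ℕ | IsProperColoring (dirCycle v) κ ∧
      colorExponent κ = m.embDomain Fin.valEmbedding}.Finite :=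
    (finite_colorings (m.embDomain Fin.valEmbedding)).subset fun κ hκ => hκ.2
  have h1 : MvPowerSeries.coeff (m.embDomain Fin.valEmbedding) (chromaticQSym (dirCycle v)) =
      ∑ κ ∈ hfin.toFinset, (Polynomial.X : ℚ[X]) ^ colorAsc (dirCycle v) κ :=
    finsum_mem_eq_finite_toFinset_sum _ hfin
  have h2 : ∑ κ : Fin n → Fin N with ∑ i, Finsupp.single (κ i) 1 = m, cyclicWeight κ =
      ∑ κ : Fin n → Fin N with ∑ i, Finsupp.single (κ i) 1 = m ∧ ∀ i, κ i ≠ κ (i + 1),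
        cyclicWeight κ := by
    rw [← filter_filter]
    symm
    refine sum_filter_of_ne fun κ _ hne => ?_
    by_contra h
    exact hne (cyclicWeight_of_eq h)
  have hexp : ∀ κ : Fin n → Fin N, colorExponent (fun a => (κ (v.symm a)).val) =
      (∑ i, Finsupp.single (κ i) 1 : Fin N →₀ ℕ).embDomain Fin.valEmbedding := by
    intro κ
    rw [colorExponent, Finsupp.embDomain_eq_mapDomain, Finsupp.mapDomain_finsetSum,
      ← Equiv.sum_comp v]
    simp
  rw [h1, h2]
  symm
  refine sum_bij (fun κ _ a => (κ (v.symm a)).val) ?_ ?_ ?_ ?_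
  · intro κ hκ
    rw [mem_filter] at hκ
    rw [Set.Finite.mem_toFinset]
    refine ⟨?_, by rw [hexp, hκ.2.1]⟩
    rw [isProperColoring_dirCycle hn]
    intro i h
    simp only [Equiv.symm_apply_apply] at h
    exact hκ.2.2 i (Fin.ext h)
  · intro κ _ κ' _ h
    funext i
    have := congrFun h (v i)
    simpa [Fin.ext_iff] using this
  · intro κ hκ
    rw [Set.Finite.mem_toFinset] at hκ
    obtain ⟨hκ1, hκ2⟩ := hκ
    have hlt : ∀ a, κ a < N := by
      intro a
      have h3 : κ a ∈ (m.embDomain Fin.valEmbedding).support := by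
        rw [← hκ2, Finsupp.mem_support_iff, colorExponent, Finsupp.finsetSum_apply]
        intro h0
        have := sum_eq_zero_iff.1 h0 a (mem_univ a)
        simp at this
      rw [Finsupp.support_embDomain, mem_map] at h3
      obtain ⟨j, -, hj⟩ := h3
      rw [← hj]
      exact j.2
    have hκeq : (fun a => (((fun i => ⟨κ (v i), hlt _⟩ : Fin n → Fin N) (v.symm a)).val)) = κ := by
      funext a
      simp
    refine ⟨fun i => ⟨κ (v i), hlt _⟩, ?_, hκeq⟩
    rw [mem_filter]
    refine ⟨mem_univ _, ?_, fun i h => (isProperColoring_dirCycle hn v κ).1 hκ1 i (congrArg Fin.val h)⟩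
    apply Finsupp.embDomain_injective Fin.valEmbedding
    rw [← hκ2, ← hexp, hκeq]
  · intro κ hκ
    rw [mem_filter] at hκ
    rw [cyclicWeight_of_ne hκ.2.2, colorAsc_dirCycle]
    simp only [Equiv.symm_apply_apply, Fin.val_fin_lt]

theorem prod_X_eq_monomial {σ ι R : Type*} [CommRing R] (s : Finset ι) (κ : ι → σ) :
    ∏ i ∈ s, (MvPowerSeries.X (κ i) : MvPowerSeries σ R) =
      MvPowerSeries.monomial (∑ i ∈ s, Finsupp.single (κ i) 1) 1 := by
  classical
  induction s using Finset.induction_on with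
  | empty => rfl
  | insert a s ha ih =>
    rw [prod_insert ha, sum_insert ha, ih, MvPowerSeries.X, MvPowerSeries.monomial_mul_monomial,
      one_mul]

/-- A coloring read along the cycle is a closed walk on the colors; the matrix entries record the
ascents and kill walks with two equal consecutive colors. -/
theorem killCompl_chromaticQSym_dirCycle {m N : ℕ} (hm : 2 ≤ m + 1) (v : Equiv.Perm (Fin (m + 1))) :
    MvPowerSeries.killCompl Fin.valEmbedding (chromaticQSym (dirCycle v)) =
      ((transferMatrix (MvPowerSeries.C Polynomial.X) MvPowerSeries.X :
        Matrix (Fin N) (Fin N) (MvPowerSeries (Fin N) ℚ[X])) ^ (m + 1)).trace := by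
  classical
  ext1 e
  rw [MvPowerSeries.coeff_killCompl, coeff_chromaticQSym_dirCycle hm, trace_pow_eq_sum, map_sum,
    sum_filter]
  refine sum_congr rfl fun κ _ => ?_
  have h1 : ∏ i, (transferMatrix (MvPowerSeries.C Polynomial.X) MvPowerSeries.X :
        Matrix (Fin N) (Fin N) (MvPowerSeries (Fin N) ℚ[X])) (κ i) (κ (i + 1)) =
      MvPowerSeries.C (cyclicWeight κ) *
        MvPowerSeries.monomial (∑ i, Finsupp.single (κ i) 1) 1 := by
    -- The matrix attaches the variable to the end of each step, so the monomial is rotated by one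
    -- to match.
    rw [← prod_X_eq_monomial, ← Equiv.prod_comp (Equiv.addRight 1) fun i => MvPowerSeries.X (κ i),
      cyclicWeight, map_prod, ← prod_mul_distrib]
    refine prod_congr rfl fun i _ => ?_
    rw [transferMatrix, Matrix.of_apply, Equiv.coe_addRight]
    split_ifs <;> simp
  rw [h1, MvPowerSeries.coeff_C_mul, MvPowerSeries.coeff_monomial]
  by_cases h2 : ∑ i, Finsupp.single (κ i) 1 = e
  · rw [if_pos h2, if_pos h2.symm, mul_one]
  · rw [if_neg h2, if_neg (Ne.symm h2), mul_zero]

/-! ### The generating function of the chromatic symmetric functions of cycles -/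

/-- `1, 0, -t, -t [2]_t, -t [3]_t, …`. -/
def cycleCoeff : ℕ → ℚ[X]
  | 0 => 1
  | k + 1 => -(Polynomial.X * qInt k)

/-- This is δ_k = (t - t^k)/(t - 1) without division; it treats k = 0 and k ≥ 1 alike. -/
theorem X_sub_one_mul_cycleCoeff (k : ℕ) :
    (Polynomial.X - 1) * cycleCoeff k = Polynomial.X - Polynomial.X ^ k := by
  cases k with
  | zero => simp [cycleCoeff]
  | succ k =>
    have := mul_geom_sum (Polynomial.X : ℚ[X]) k
    rw [cycleCoeff, qInt, pow_succ]
    linear_combination (-Polynomial.X) * this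

theorem X_sub_one_ne_zero : (Polynomial.X - 1 : ℚ[X]) ≠ 0 := by
  rw [← Polynomial.C_1]
  exact Polynomial.X_sub_C_ne_zero 1

/-- `∑_k δ_k f_k z^k`, where `δ_k` is `cycleCoeff k`. -/
def cycleSeries {A : Type*} [CommRing A] [Algebra ℚ[X] A] (f : ℕ → A) : PowerSeries A :=
  PowerSeries.mk fun k => cycleCoeff k • f k

section

variable {A : Type*} [CommRing A] [Algebra ℚ[X] A]

/-- The indeterminate `t`, as a constant power series. -/
def tConst (A : Type*) [CommRing A] [Algebra ℚ[X] A] : PowerSeries A :=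
  PowerSeries.C (algebraMap ℚ[X] A Polynomial.X)

theorem tConst_sub_one_mul_cycleSeries (f : ℕ → A) :
    (tConst A - 1) * cycleSeries f = tConst A * PowerSeries.mk f -
      PowerSeries.rescale (algebraMap ℚ[X] A Polynomial.X) (PowerSeries.mk f) := by
  ext k
  have h : tConst A - 1 = PowerSeries.C (algebraMap ℚ[X] A (Polynomial.X - 1)) := by
    rw [tConst, map_sub, map_sub, map_one, map_one]
  rw [h, tConst, PowerSeries.coeff_C_mul, map_sub (PowerSeries.coeff k),  PowerSeries.coeff_C_mul, PowerSeries.coeff_rescale,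
    cycleSeries, PowerSeries.coeff_mk, PowerSeries.coeff_mk, Algebra.smul_def, ← mul_assoc, ← map_mul,
    X_sub_one_mul_cycleCoeff, map_sub, map_pow, sub_mul]

theorem constantCoeff_cycleSeries {f : ℕ → A} (hf : f 0 = 1) :
    PowerSeries.constantCoeff (cycleSeries f) = 1 := by
  rw [← PowerSeries.coeff_zero_eq_constantCoeff_apply, cycleSeries, PowerSeries.coeff_mk, hf,
    cycleCoeff, one_smul]

/-- `-D' / D` for `D = ∑_k δ_k f_k z^k`. -/
def cycleLogDeriv (f : ℕ → A) : PowerSeries A :=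
  -(PowerSeries.derivative A (cycleSeries f) * PowerSeries.invOfUnit (cycleSeries f) 1)

theorem cycleSeries_mul_cycleLogDeriv {f : ℕ → A} (hf : f 0 = 1) :
    cycleSeries f * cycleLogDeriv f = -PowerSeries.derivative A (cycleSeries f) := by
  have := PowerSeries.mul_invOfUnit (cycleSeries f) 1 (constantCoeff_cycleSeries hf)
  rw [cycleLogDeriv]
  linear_combination (-PowerSeries.derivative A (cycleSeries f)) * this

/-- The series D has constant term 1, hence is invertible. Every later evaluation of -D'/D goes
through this criterion. -/
theorem eq_cycleLogDeriv {f : ℕ → A} (hf : f 0 = 1) {W : PowerSeries A}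
    (hW : cycleSeries f * W = -PowerSeries.derivative A (cycleSeries f)) : W = cycleLogDeriv f := by
  have h := PowerSeries.mul_invOfUnit (cycleSeries f) 1 (constantCoeff_cycleSeries hf)
  rw [cycleLogDeriv]
  linear_combination PowerSeries.invOfUnit (cycleSeries f) 1 * hW - W * h

theorem map_derivative {A B : Type*} [CommRing A] [CommRing B] (φ : A →+* B) (f : PowerSeries A) :
    PowerSeries.map φ (PowerSeries.derivative A f) =
      PowerSeries.derivative B (PowerSeries.map φ f) := by
  ext k
  simp [PowerSeries.coeff_derivative]

theorem map_cycleSeries {B : Type*} [CommRing B] [Algebra ℚ[X] B] (φ : A →ₐ[ℚ[X]] B) (f : ℕ → A) :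
    PowerSeries.map (φ : A →+* B) (cycleSeries f) = cycleSeries fun k => φ (f k) := by
  ext k
  simp [cycleSeries]

/-- Applied to the restriction to N variables and to ω. -/
theorem map_cycleLogDeriv {B : Type*} [CommRing B] [Algebra ℚ[X] B] (φ : A →ₐ[ℚ[X]] B) {f : ℕ → A}
    (hf : f 0 = 1) :
    PowerSeries.map (φ : A →+* B) (cycleLogDeriv f) = cycleLogDeriv fun k => φ (f k) := by
  apply eq_cycleLogDeriv (by rw [hf, map_one])
  rw [← map_cycleSeries, ← map_mul, cycleSeries_mul_cycleLogDeriv hf, map_neg, map_derivative]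

end

/-! ### Comparison in finitely many variables. -/

/-- The restriction of symmetric functions to `N` variables. -/
def restrict (N : ℕ) : SymFunc ℚ[X] →ₐ[ℚ[X]] MvPowerSeries (Fin N) ℚ[X] :=
  (MvPowerSeries.killCompl Fin.valEmbedding).comp (SymFunc ℚ[X]).val

theorem mk_restrict_esym (N : ℕ) :
    (PowerSeries.mk fun k => restrict N (esym ℚ[X] k)) =
      ∏ j : Fin N, (1 + PowerSeries.C (MvPowerSeries.X j : MvPowerSeries (Fin N) ℚ[X]) *
        PowerSeries.X) := by
  ext1 k
  have h : restrict N (esym ℚ[X] k) = (MvPolynomial.esymm (Fin N) ℚ[X] k : MvPowerSeries _ _) :=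
    coeff_esymm_fin N k
  rw [PowerSeries.coeff_mk, h, prod_one_add, map_sum, MvPolynomial.esymm]
  rw [← MvPolynomial.coeToMvPowerSeries.ringHom_apply, map_sum]
  have h2 : ∀ s : Finset (Fin N), (PowerSeries.coeff k)
      (∏ j ∈ s, PowerSeries.C (MvPowerSeries.X j : MvPowerSeries (Fin N) ℚ[X]) * PowerSeries.X) =
      if #s = k then ∏ j ∈ s, MvPowerSeries.X j else 0 := by
    intro s
    rw [prod_mul_distrib, prod_const, ← map_prod, PowerSeries.coeff_C_mul, PowerSeries.coeff_X_pow]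
    split_ifs with h1 h2 h2
    · rw [mul_one]
    · exact absurd h1.symm h2
    · exact absurd h2.symm h1
    · rw [mul_zero]
  rw [sum_congr rfl fun s _ => h2 s, ← sum_filter]
  have h3 : (univ : Finset (Fin N)).powerset.filter (fun s => #s = k) = powersetCard k univ := by
    ext s
    simp [mem_powersetCard]
  rw [h3]
  refine sum_congr rfl fun s _ => ?_
  rw [map_prod]
  refine prod_congr rfl fun j _ => ?_
  simp

/-- After multiplication by t - 1, both sides are t E(z) - E(tz) with E(z) = ∏(1 + x_j z), and t - 1
can be cancelled. -/
theorem restrict_cycleSeries (N : ℕ) :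
    (cycleSeries fun k => restrict N (esym ℚ[X] k)) =
      ((1 : Matrix (Fin N) (Fin N) (PowerSeries (MvPowerSeries (Fin N) ℚ[X]))) -
        (PowerSeries.X : PowerSeries (MvPowerSeries (Fin N) ℚ[X])) •
          (transferMatrix (MvPowerSeries.C Polynomial.X) MvPowerSeries.X).map PowerSeries.C).det := by
  have h1 := tConst_sub_one_mul_cycleSeries fun k => restrict N (esym ℚ[X] k)
  have h2 := det_one_sub_transferMatrix (MvPowerSeries.C Polynomial.X)
    (MvPowerSeries.X : Fin N → MvPowerSeries (Fin N) ℚ[X])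
  have ht : tConst (MvPowerSeries (Fin N) ℚ[X]) =
    PowerSeries.C (MvPowerSeries.C Polynomial.X) := rfl
  have ht' : algebraMap ℚ[X] (MvPowerSeries (Fin N) ℚ[X]) Polynomial.X =
    MvPowerSeries.C Polynomial.X := rfl
  rw [mk_restrict_esym, map_prod, ht, ht'] at h1
  have h3 : ∀ j : Fin N, PowerSeries.rescale (MvPowerSeries.C Polynomial.X)
      (1 + PowerSeries.C (MvPowerSeries.X j : MvPowerSeries (Fin N) ℚ[X]) * PowerSeries.X) =
      1 + PowerSeries.C (MvPowerSeries.C Polynomial.X) *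
        (PowerSeries.C (MvPowerSeries.X j) * PowerSeries.X) := by
    intro j
    have hC : PowerSeries.rescale (MvPowerSeries.C Polynomial.X)
        (PowerSeries.C (MvPowerSeries.X j : MvPowerSeries (Fin N) ℚ[X])) =
        PowerSeries.C (MvPowerSeries.X j) := by
      ext1 k
      rw [PowerSeries.coeff_rescale, PowerSeries.coeff_C]
      split_ifs with hk
      · rw [hk, pow_zero, one_mul]
      · rw [mul_zero]
    rw [map_add, map_one, map_mul, PowerSeries.rescale_X, hC]
    ring
  rw [prod_congr rfl fun j _ => h3 j, ← h2] at h1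
  refine mul_left_cancel₀ ?_ h1
  rw [sub_ne_zero, ← map_one PowerSeries.C, ← map_one MvPowerSeries.C]
  intro h
  exact sub_ne_zero.1 X_sub_one_ne_zero (MvPowerSeries.C_injective (PowerSeries.C_injective h))

theorem restrict_coeff_cycleLogDeriv (N k : ℕ) :
    restrict N (PowerSeries.coeff k (cycleLogDeriv (esym ℚ[X]))) =
      ((transferMatrix (MvPowerSeries.C Polynomial.X) MvPowerSeries.X :
        Matrix (Fin N) (Fin N) (MvPowerSeries (Fin N) ℚ[X])) ^ (k + 1)).trace := by
  have h1 := map_cycleLogDeriv (restrict N) (esym_zero ℚ[X])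
  have h2 := derivative_det_one_sub (transferMatrix (MvPowerSeries.C Polynomial.X)
    (MvPowerSeries.X : Fin N → MvPowerSeries (Fin N) ℚ[X]))
  rw [← restrict_cycleSeries] at h2
  have h3 := eq_cycleLogDeriv (f := fun k => restrict N (esym ℚ[X] k))
    (by rw [esym_zero, map_one]) (neg_eq_iff_eq_neg.1 h2.symm)
  rw [← h1] at h3
  have h4 := congrArg (PowerSeries.coeff k) h3
  rw [PowerSeries.coeff_mk, PowerSeries.coeff_map] at h4
  exact h4.symm

/-- A monomial involves finitely many variables, so its coefficient can be compared after
restriction to N of them, where both sides are the trace of a matrix power. Symmetry of X follows,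
as the right side is built from the e_k. -/
theorem chromaticQSym_dirCycle_eq {m : ℕ} (hm : 2 ≤ m + 1) (v : Equiv.Perm (Fin (m + 1))) :
    chromaticQSym (dirCycle v) =
      ((PowerSeries.coeff m (cycleLogDeriv (esym ℚ[X])) : SymFunc ℚ[X]) : MvPowerSeries ℕ ℚ[X]) := by
  ext1 e
  obtain ⟨N, hN⟩ : ∃ N, ∀ i ∈ e.support, i < N := ⟨e.support.sup id + 1, fun i hi =>
    Nat.lt_succ_of_le (Finset.le_sup (f := id) hi)⟩
  obtain ⟨e', rfl⟩ : e ∈ Set.range (Finsupp.embDomain (M := ℕ) (Fin.valEmbedding (n := N))) := by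
    rw [Finsupp.mem_range_embDomain_iff]
    exact fun i hi => ⟨⟨i, hN i hi⟩, rfl⟩
  rw [← MvPowerSeries.coeff_killCompl, killCompl_chromaticQSym_dirCycle hm,
    ← restrict_coeff_cycleLogDeriv, ← MvPowerSeries.coeff_killCompl]
  rfl

/-! ### Linear differential equations and substitution -/

section

variable {A : Type*} [CommRing A] [IsDomain A] [CharZero A]

theorem eq_zero_of_derivative_eq_mul {a f : PowerSeries A}
    (hf : PowerSeries.derivative A f = a * f) (h0 : PowerSeries.constantCoeff f = 0) : f = 0 := by
  ext n
  rw [map_zero]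
  induction n using Nat.strong_induction_on with
  | _ n ih =>
    cases n with
    | zero => rwa [PowerSeries.coeff_zero_eq_constantCoeff_apply]
    | succ n =>
      have h := congrArg (PowerSeries.coeff n) hf
      rw [PowerSeries.coeff_derivative, PowerSeries.coeff_mul, sum_eq_zero] at h
      · exact (mul_eq_zero.1 h).resolve_right (Nat.cast_add_one_ne_zero n)
      · rintro ⟨i, j⟩ hij
        rw [HasAntidiagonal.mem_antidiagonal] at hij
        simp only at hij ⊢
        rw [ih j (by omega), mul_zero]

theorem eq_of_derivative_eq_mul {a f g : PowerSeries A}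
    (hf : PowerSeries.derivative A f = a * f) (hg : PowerSeries.derivative A g = a * g)
    (h0 : PowerSeries.constantCoeff f = PowerSeries.constantCoeff g) : f = g := by
  rw [← sub_eq_zero]
  apply eq_zero_of_derivative_eq_mul (a := a)
  · rw [map_sub, hf, hg, mul_sub]
  · rw [map_sub, h0, sub_self]

end

section

variable {A : Type*} [CommRing A] [Algebra ℚ[X] A]

theorem subst_eq_subst_map {u : PowerSeries A} (hu : PowerSeries.HasSubst u)
    (f : PowerSeries ℚ[X]) :
    f.subst u = (PowerSeries.map (algebraMap ℚ[X] A) f).subst u := by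
  rw [PowerSeries.map_algebraMap_eq_subst_X, PowerSeries.subst_comp_subst_apply
    PowerSeries.HasSubst.X' hu, PowerSeries.subst_X hu]

theorem derivative_subst_algebra {u : PowerSeries A} (hu : PowerSeries.HasSubst u)
    (f : PowerSeries ℚ[X]) :
    PowerSeries.derivative A (f.subst u) =
      (PowerSeries.derivative ℚ[X] f).subst u * PowerSeries.derivative A u := by
  rw [subst_eq_subst_map hu, PowerSeries.derivative_subst hu, subst_eq_subst_map hu, map_derivative]

theorem subst_C_algebra {u : PowerSeries A} (hu : PowerSeries.HasSubst u) (a : ℚ[X]) :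
    (PowerSeries.C a).subst u = PowerSeries.C (algebraMap ℚ[X] A a) := by
  rw [subst_eq_subst_map hu, PowerSeries.map_C]
  exact PowerSeries.subst_C _

theorem constantCoeff_subst_algebra {u : PowerSeries A}
    (hu : PowerSeries.constantCoeff u = 0) (f : PowerSeries ℚ[X]) :
    PowerSeries.constantCoeff (f.subst u) = algebraMap ℚ[X] A (PowerSeries.constantCoeff f) := by
  rw [← PowerSeries.coeff_zero_eq_constantCoeff_apply,
    PowerSeries.coeff_subst' (PowerSeries.HasSubst.of_constantCoeff_zero' hu),
    finsum_eq_single _ 0]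
  · rw [pow_zero, PowerSeries.coeff_zero_eq_constantCoeff_apply,
      PowerSeries.coeff_zero_eq_constantCoeff_apply, map_one, Algebra.smul_def, mul_one]
  · intro d hd
    rw [PowerSeries.coeff_zero_eq_constantCoeff_apply, map_pow, hu, zero_pow hd, smul_zero]

/-- The solution is the exponential of the antiderivative `u` of `a`. -/
theorem exists_derivative_eq_mul (a : PowerSeries A) :
    ∃ f : PowerSeries A, PowerSeries.constantCoeff f = 1 ∧ PowerSeries.derivative A f = a * f := by
  -- At k = 0 the inverse is 0 by convention, so `u` has no constant term and can be substituted.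
  set u : PowerSeries A := PowerSeries.mk fun k =>
    (Polynomial.C ((k : ℚ)⁻¹) : ℚ[X]) • PowerSeries.coeff (k - 1) a with hu
  have hu0 : PowerSeries.constantCoeff u = 0 := by
    rw [← PowerSeries.coeff_zero_eq_constantCoeff_apply, hu, PowerSeries.coeff_mk]
    simp
  have hu1 : PowerSeries.derivative A u = a := by
    ext k
    rw [PowerSeries.coeff_derivative, hu, PowerSeries.coeff_mk, Algebra.smul_def,
      Nat.add_sub_cancel, mul_right_comm]
    have : ((k : A) + 1) = algebraMap ℚ[X] A (Polynomial.C ((k + 1 : ℕ) : ℚ)) := by simp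
    rw [this, ← map_mul, ← Polynomial.C_mul, inv_mul_cancel₀ (by positivity), Polynomial.C_1, map_one, one_mul]
  refine ⟨(PowerSeries.exp ℚ[X]).subst u, ?_, ?_⟩
  · rw [constantCoeff_subst_algebra hu0, PowerSeries.constantCoeff_exp, map_one]
  · rw [derivative_subst_algebra (PowerSeries.HasSubst.of_constantCoeff_zero' hu0),
      PowerSeries.derivative_exp, hu1, mul_comm]

end

theorem derivative_rescale {A : Type*} [CommRing A] (r : A) (f : PowerSeries A) :
    PowerSeries.derivative A (PowerSeries.rescale r f) =
      PowerSeries.C r * PowerSeries.rescale r (PowerSeries.derivative A f) := by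
  ext k
  rw [PowerSeries.coeff_derivative, PowerSeries.coeff_C_mul, PowerSeries.coeff_rescale,
    PowerSeries.coeff_rescale, PowerSeries.coeff_derivative, pow_succ]
  ring

theorem X_sub_one_mul_qInt (k : ℕ) : (Polynomial.X - 1) * qInt k = Polynomial.X ^ k - 1 :=
  mul_geom_sum _ _

/-! ### The logarithmic derivative in terms of power sums -/

/-- The exponential generating function of the Eulerian polynomials. -/
def eulerianSeries : PowerSeries ℚ[X] :=
  PowerSeries.mk fun k => Polynomial.C ((k.factorial : ℚ)⁻¹) * eulerianPoly k

/-- `∑_k [k]_t p_k z^k / k`. -/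
def qPowerSeries {A : Type*} [CommRing A] [Algebra ℚ[X] A] (p : ℕ → A) : PowerSeries A :=
  PowerSeries.mk fun k => (Polynomial.C ((k : ℚ)⁻¹) * qInt k) • p k

section

variable {A : Type*} [CommRing A] [Algebra ℚ[X] A]

theorem constantCoeff_qPowerSeries (p : ℕ → A) :
    PowerSeries.constantCoeff (qPowerSeries p) = 0 := by
  rw [← PowerSeries.coeff_zero_eq_constantCoeff_apply, qPowerSeries, PowerSeries.coeff_mk]
  simp

theorem hasSubst_qPowerSeries (p : ℕ → A) : PowerSeries.HasSubst (qPowerSeries p) :=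
  PowerSeries.HasSubst.of_constantCoeff_zero' (constantCoeff_qPowerSeries p)

theorem coeff_derivative_qPowerSeries (p : ℕ → A) (k : ℕ) :
    PowerSeries.coeff k (PowerSeries.derivative A (qPowerSeries p)) = qInt (k + 1) • p (k + 1) := by
  rw [PowerSeries.coeff_derivative, qPowerSeries, PowerSeries.coeff_mk, Algebra.smul_def,
    Algebra.smul_def]
  have : ((k : A) + 1) = algebraMap ℚ[X] A (Polynomial.C ((k + 1 : ℕ) : ℚ)) := by simp
  rw [this, mul_right_comm, ← map_mul, mul_right_comm, ← Polynomial.C_mul,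
    inv_mul_cancel₀ (by positivity), Polynomial.C_1, one_mul]

theorem tConst_sub_one_mul_derivative_qPowerSeries (p : ℕ → A) :
    (tConst A - 1) * PowerSeries.derivative A (qPowerSeries p) =
      tConst A * PowerSeries.rescale (algebraMap ℚ[X] A Polynomial.X)
        (PowerSeries.mk fun k => p (k + 1)) - PowerSeries.mk fun k => p (k + 1) := by
  ext k
  have h : tConst A - 1 = PowerSeries.C (algebraMap ℚ[X] A (Polynomial.X - 1)) := by
    rw [tConst, map_sub, map_sub, map_one, map_one]
  rw [h, tConst, PowerSeries.coeff_C_mul, map_sub (PowerSeries.coeff k), PowerSeries.coeff_C_mul,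
    PowerSeries.coeff_rescale, coeff_derivative_qPowerSeries, PowerSeries.coeff_mk, Algebra.smul_def,
    ← mul_assoc, ← map_mul, X_sub_one_mul_qInt, map_sub, map_one, map_pow, pow_succ]
  ring

theorem derivative_rescale_mk {p h : ℕ → A}
    (hph : PowerSeries.derivative A (PowerSeries.mk h) =
      (PowerSeries.mk fun k => p (k + 1)) * PowerSeries.mk h) :
    PowerSeries.derivative A (PowerSeries.rescale (algebraMap ℚ[X] A Polynomial.X)
        (PowerSeries.mk h)) =
      tConst A * PowerSeries.rescale (algebraMap ℚ[X] A Polynomial.X)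
        (PowerSeries.mk fun k => p (k + 1)) *
        PowerSeries.rescale (algebraMap ℚ[X] A Polynomial.X) (PowerSeries.mk h) := by
  rw [derivative_rescale, hph, map_mul, tConst, mul_assoc]

theorem tConst_sub_one_ne_zero [IsDomain A] [FaithfulSMul ℚ[X] A] : tConst A - 1 ≠ 0 := by
  have h : tConst A - 1 = PowerSeries.C (algebraMap ℚ[X] A (Polynomial.X - 1)) := by
    rw [tConst, map_sub, map_sub, map_one, map_one]
  rw [h, Ne, map_eq_zero_iff _ PowerSeries.C_injective,
    map_eq_zero_iff _ (FaithfulSMul.algebraMap_injective ℚ[X] A)]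
  exact X_sub_one_ne_zero

/-- H(tz) = H(z) exp((t-1)Q): both sides have constant term 1 and solve f' = t P(tz) f, because
(t-1) Q' = t P(tz) - P(z). -/
theorem rescale_eq_mul_subst [IsDomain A] [CharZero A] {p h : ℕ → A}
    (hh : h 0 = 1) (hph : PowerSeries.derivative A (PowerSeries.mk h) =
      (PowerSeries.mk fun k => p (k + 1)) * PowerSeries.mk h) :
    PowerSeries.rescale (algebraMap ℚ[X] A Polynomial.X) (PowerSeries.mk h) =
      PowerSeries.mk h *
        (PowerSeries.rescale (Polynomial.X - 1) (PowerSeries.exp ℚ[X])).subst (qPowerSeries p) := by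
  have hc : PowerSeries.constantCoeff (PowerSeries.mk h) = 1 := by
    rw [← PowerSeries.coeff_zero_eq_constantCoeff_apply, PowerSeries.coeff_mk, hh]
  refine eq_of_derivative_eq_mul (derivative_rescale_mk hph) ?_ ?_
  · rw [Derivation.leibniz, hph, derivative_subst_algebra (hasSubst_qPowerSeries p),
      derivative_rescale, PowerSeries.derivative_exp,
      PowerSeries.subst_mul (hasSubst_qPowerSeries p), subst_C_algebra (hasSubst_qPowerSeries p),
      smul_eq_mul, smul_eq_mul, map_sub, map_one, map_sub, map_one]
    have := tConst_sub_one_mul_derivative_qPowerSeries p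
    rw [tConst] at this ⊢
    linear_combination (PowerSeries.mk h * (PowerSeries.rescale (Polynomial.X - 1)
      (PowerSeries.exp ℚ[X])).subst (qPowerSeries p)) * this
  · rw [map_mul, hc, constantCoeff_subst_algebra (constantCoeff_qPowerSeries p),
      ← PowerSeries.coeff_zero_eq_constantCoeff_apply, PowerSeries.coeff_rescale,
      ← PowerSeries.coeff_zero_eq_constantCoeff_apply, PowerSeries.coeff_rescale]
    simp [hh]

/-- Since (t-1) D = H (t - exp((t-1)Q)), the hypothesis `hE` on the Eulerian series 𝓐 gives D · 𝓐(Q)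
= H. Taking logarithmic derivatives, with 𝓐'/𝓐 = t𝓐 - t + 1, explains the formula. The proof
verifies it after multiplication by t - 1 and never differentiates 𝓐. -/
theorem cycleLogDeriv_eq [IsDomain A] [CharZero A] [FaithfulSMul ℚ[X] A] {p h : ℕ → A}
    (hE : (PowerSeries.C Polynomial.X - PowerSeries.rescale (Polynomial.X - 1)
      (PowerSeries.exp ℚ[X])) * eulerianSeries = PowerSeries.C (Polynomial.X - 1))
    (hh : h 0 = 1) (hph : PowerSeries.derivative A (PowerSeries.mk h) =
      (PowerSeries.mk fun k => p (k + 1)) * PowerSeries.mk h) :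
    cycleLogDeriv h = PowerSeries.derivative A (qPowerSeries p) *
      (tConst A * eulerianSeries.subst (qPowerSeries p) - tConst A + 1) -
        PowerSeries.mk fun k => p (k + 1) := by
  symm
  apply eq_cycleLogDeriv hh
  have h1 := rescale_eq_mul_subst hh hph
  have h2 := congrArg (PowerSeries.subst (qPowerSeries p)) hE
  rw [PowerSeries.subst_mul (hasSubst_qPowerSeries p), PowerSeries.subst_sub (hasSubst_qPowerSeries p),
    subst_C_algebra (hasSubst_qPowerSeries p), subst_C_algebra (hasSubst_qPowerSeries p), map_sub,
    map_one, map_sub, map_one, ← tConst] at h2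
  have h3 := tConst_sub_one_mul_cycleSeries h
  have h4 := congrArg (PowerSeries.derivative A) h3
  have h5 := tConst_sub_one_mul_derivative_qPowerSeries p
  have ht : PowerSeries.derivative A (tConst A) = 0 := PowerSeries.derivative_C
  rw [map_sub, Derivation.leibniz, Derivation.leibniz, map_sub, ht, derivative_rescale_mk hph, hph,
    Derivation.map_one_eq_zero] at h4
  simp only [smul_eq_mul, mul_zero, add_zero, sub_zero] at h4
  have ht1 := tConst_sub_one_ne_zero (A := A)
  apply mul_left_cancel₀ ht1
  -- This is D · 𝓐(Q) = H.
  have h6 : cycleSeries h * eulerianSeries.subst (qPowerSeries p) = PowerSeries.mk h := by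
    apply mul_left_cancel₀ ht1
    rw [← mul_assoc, h3, h1]
    linear_combination PowerSeries.mk h * h2
  set K := PowerSeries.rescale (algebraMap ℚ[X] A Polynomial.X) (PowerSeries.mk h)
  set P := PowerSeries.mk fun k => p (k + 1)
  set U := PowerSeries.derivative A (qPowerSeries p)
  linear_combination (tConst A - 1) * U * tConst A * h6 - (tConst A - 1) * U * h3 + h4 + K * h5 - P * h3

end

/-! ### Newton's identities -/

instance isDomain_symFunc {R : Type*} [CommRing R] [IsDomain R] : IsDomain (SymFunc R) :=
  have : IsDomain (MvPowerSeries ℕ R) := NoZeroDivisors.to_isDomain _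
  Subalgebra.isDomain _

instance charZero_symFunc {R : Type*} [CommRing R] [CharZero R] : CharZero (SymFunc R) where
  cast_injective a b h := by
    have h1 := congrArg (fun f : SymFunc R => MvPowerSeries.constantCoeff (f : MvPowerSeries ℕ R)) h
    simpa using h1

instance faithfulSMul_symFunc {R : Type*} [CommRing R] : FaithfulSMul R (SymFunc R) := by
  rw [faithfulSMul_iff_algebraMap_injective]
  intro a b h
  have h1 := congrArg (fun f : SymFunc R => MvPowerSeries.constantCoeff (f : MvPowerSeries ℕ R)) h
  have h2 : ∀ c : R, ((algebraMap R (SymFunc R) c : SymFunc R) : MvPowerSeries ℕ R) =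
    MvPowerSeries.C c := fun c => rfl
  simpa [h2] using h1

open Classical in
-- A positive power of the variable x can be split off from the monomial in `m x` ways.
theorem card_filter_single_antidiagonal (m : ℕ →₀ ℕ) :
    #{q ∈ HasAntidiagonal.antidiagonal m | ∃ x i, q.1 = Finsupp.single x (i + 1)} = m.degree := by
  rw [Finsupp.degree_apply, ← card_range (∑ i ∈ m.support, m i), card_range]
  have : ∑ x ∈ m.support, m x = #(m.support.sigma fun x => range (m x)) := by
    rw [card_sigma]
    simp
  rw [this]
  symm
  refine card_bij (fun q _ => (Finsupp.single q.1 (q.2 + 1), m - Finsupp.single q.1 (q.2 + 1)))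
    ?_ ?_ ?_
  · rintro ⟨x, i⟩ h
    rw [mem_sigma, mem_range] at h
    rw [mem_filter, HasAntidiagonal.mem_antidiagonal]
    refine ⟨add_tsub_cancel_of_le ?_, x, i, rfl⟩
    rw [Finsupp.single_le_iff]
    exact h.2
  · rintro ⟨x, i⟩ _ ⟨y, j⟩ _ h
    have h1 := (Finsupp.single_eq_single_iff _ _ _ _).1 (congrArg Prod.fst h)
    simp only at h1
    obtain ⟨rfl, h2⟩ : x = y ∧ i = j := by omega
    rw [h2]
  · rintro ⟨a, b⟩ h
    rw [mem_filter, HasAntidiagonal.mem_antidiagonal] at h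
    obtain ⟨h1, x, i, h2⟩ := h
    simp only at h1 h2
    have h3 : i < m x := by
      rw [← h1, h2, Finsupp.add_apply, Finsupp.single_eq_same]
      omega
    refine ⟨⟨x, i⟩, ?_, ?_⟩
    · rw [mem_sigma, mem_range, Finsupp.mem_support_iff]
      exact ⟨by simp only; omega, h3⟩
    · rw [← h1, h2, add_tsub_cancel_left]

/-- The coefficient of a monomial of degree k + 1 on the right counts the ways to split off a
positive power of one variable, and there are k + 1 of them. -/
theorem succ_mul_hsym (R : Type*) [CommRing R] (k : ℕ) :
    hsym R (k + 1) * ((k : SymFunc R) + 1) =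
      ∑ q ∈ HasAntidiagonal.antidiagonal k, psym R (q.1 + 1) * hsym R q.2 := by
  classical
  apply Subtype.ext
  ext m
  have h1 : MvPowerSeries.coeff m ((∑ q ∈ HasAntidiagonal.antidiagonal k,
      psym R (q.1 + 1) * hsym R q.2 : SymFunc R) : MvPowerSeries ℕ R) =
      ∑ q ∈ HasAntidiagonal.antidiagonal k, ∑ r ∈ HasAntidiagonal.antidiagonal m,
        (if ∃ x, r.1 = Finsupp.single x (q.1 + 1) then (1 : R) else 0) *
          (if r.2.degree = q.2 then 1 else 0) := by
    rw [AddSubmonoidClass.coe_finsetSum, map_sum]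
    refine sum_congr rfl fun q _ => ?_
    rw [MulMemClass.coe_mul, MvPowerSeries.coeff_mul]
    rfl
  have h2 : MvPowerSeries.coeff m ((hsym R (k + 1) * ((k : SymFunc R) + 1) : SymFunc R) :
      MvPowerSeries ℕ R) = (if m.degree = k + 1 then 1 else 0) * ((k : R) + 1) := by
    have h : ((hsym R (k + 1) * ((k : SymFunc R) + 1) : SymFunc R) : MvPowerSeries ℕ R) =
        (hsym R (k + 1) : MvPowerSeries ℕ R) * MvPowerSeries.C ((k : R) + 1) := by
      simp
    rw [h, MvPowerSeries.coeff_mul_C]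
    rfl
  rw [h1, h2, sum_comm]
  have h3 : ∀ r ∈ HasAntidiagonal.antidiagonal m, ∑ q ∈ HasAntidiagonal.antidiagonal k,
      (if ∃ x, r.1 = Finsupp.single x (q.1 + 1) then (1 : R) else 0) *
          (if r.2.degree = q.2 then 1 else 0) =
      if m.degree = k + 1 then (if ∃ x i, r.1 = Finsupp.single x (i + 1) then 1 else 0) else 0 := by
    intro r hr
    have hrm : m.degree = r.1.degree + r.2.degree := by
      rw [← HasAntidiagonal.mem_antidiagonal.1 hr, map_add]
    by_cases hx : ∃ x i, r.1 = Finsupp.single x (i + 1)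
    · rw [if_pos hx]
      obtain ⟨x, i, hxi⟩ := hx
      have hdeg : r.1.degree = i + 1 := by rw [hxi, Finsupp.degree_single]
      have h4 : ∀ j, (∃ y, r.1 = Finsupp.single y (j + 1)) ↔ j = i := by
        intro j
        constructor
        · rintro ⟨y, hy⟩
          rw [hy, Finsupp.degree_single] at hdeg
          omega
        · rintro rfl
          exact ⟨x, hxi⟩
      simp only [h4, ite_mul, one_mul, zero_mul, Nat.sum_antidiagonal_eq_sum_range_succ
        (fun a b => if a = i then (if r.2.degree = b then (1 : R) else 0) else 0), sum_ite_eq',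
        mem_range]
      split_ifs <;> first | rfl | omega
    · rw [if_neg hx, ite_self, sum_eq_zero]
      intro q _
      rw [if_neg fun ⟨x, h⟩ => hx ⟨x, q.1, h⟩, zero_mul]
  rw [sum_congr rfl h3]
  by_cases hm : m.degree = k + 1
  · simp only [if_pos hm]
    rw [← natCast_card_filter, card_filter_single_antidiagonal, hm]
    simp
  · simp [hm]

theorem derivative_mk_hsym (R : Type*) [CommRing R] :
    PowerSeries.derivative (SymFunc R) (PowerSeries.mk (hsym R)) =
      (PowerSeries.mk fun k => psym R (k + 1)) * PowerSeries.mk (hsym R) := by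
  ext1 k
  rw [PowerSeries.coeff_derivative, PowerSeries.coeff_mul, PowerSeries.coeff_mk, succ_mul_hsym]
  simp only [PowerSeries.coeff_mk]

/-- `∑_k (-1)^k e_k z^k`. -/
def signedEsymSeries (R : Type*) [CommRing R] : PowerSeries (SymFunc R) :=
  PowerSeries.mk fun k => (-1) ^ k * esym R k

theorem signedEsymSeries_mul (R : Type*) [CommRing R] :
    signedEsymSeries R * PowerSeries.mk (hsym R) = 1 := by
  ext1 k
  rw [PowerSeries.coeff_mul, PowerSeries.coeff_one]
  simp only [signedEsymSeries, PowerSeries.coeff_mk, mul_assoc]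
  split_ifs with h
  · rw [h]
    simp [esym_zero, hsym_zero]
  · exact sum_esym_mul_hsym R k h

theorem derivative_signedEsymSeries (R : Type*) [CommRing R] :
    PowerSeries.derivative (SymFunc R) (signedEsymSeries R) =
      -(PowerSeries.mk fun k => psym R (k + 1)) * signedEsymSeries R := by
  have h1 := signedEsymSeries_mul R
  have h2 := congrArg (PowerSeries.derivative (SymFunc R)) h1
  rw [Derivation.leibniz, Derivation.map_one_eq_zero, derivative_mk_hsym, smul_eq_mul,
    smul_eq_mul] at h2
  set H := PowerSeries.mk (hsym R)
  set P := PowerSeries.mk fun k => psym R (k + 1)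
  linear_combination signedEsymSeries R * h2 - (P * signedEsymSeries R +
    PowerSeries.derivative (SymFunc R) (signedEsymSeries R)) * h1

/-! ### The involution on elementary symmetric functions -/

theorem omega_esym (R : Type*) [CommRing R] (k : ℕ) : omega R (esym R k) = hsym R k := by
  refine eq_of_alternating_sums (fun k => omega R (esym R k)) (hsym R) (esym R) ?_ (esym_zero R) ?_
    (sum_hsym_mul_esym R) k
  · simp [hsym_zero, esym_zero]
  · intro n hn
    have := congrArg (omega R) (sum_esym_mul_hsym R n hn)
    simpa [omega_hsym] using this

theorem omega_coeff_cycleLogDeriv (k : ℕ) :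
    omega ℚ[X] (PowerSeries.coeff k (cycleLogDeriv (esym ℚ[X]))) =
      PowerSeries.coeff k (cycleLogDeriv (hsym ℚ[X])) := by
  have h := congrArg (PowerSeries.coeff k) (map_cycleLogDeriv (omega ℚ[X]) (esym_zero ℚ[X]))
  rw [PowerSeries.coeff_map] at h
  simp only [omega_esym] at h
  exact h

/-! ### Squarefree coefficients and the generating function of the Eulerian polynomials -/

/-- The exponent of the squarefree monomial `∏_{i ∈ T} x_i`. -/
def squarefreeExponent (T : Finset ℕ) : ℕ →₀ ℕ := ∑ i ∈ T, Finsupp.single i 1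

theorem squarefreeExponent_apply (T : Finset ℕ) (i : ℕ) :
    squarefreeExponent T i = if i ∈ T then 1 else 0 := by
  rw [squarefreeExponent, Finsupp.finsetSum_apply]
  simp [Finsupp.single_apply]

theorem squarefreeExponent_degree (T : Finset ℕ) : (squarefreeExponent T).degree = #T := by
  rw [squarefreeExponent, map_sum]
  simp

theorem coeff_squarefreeExponent_eq {R : Type*} [CommRing R] (f : SymFunc R) {S T : Finset ℕ}
    (h : #S = #T) :
    MvPowerSeries.coeff (squarefreeExponent S) (f : MvPowerSeries ℕ R) =
      MvPowerSeries.coeff (squarefreeExponent T) (f : MvPowerSeries ℕ R) := by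
  obtain ⟨e, he⟩ := Equiv.Perm.exists_extending_pair
    (fun i : S => (i : ℕ)) (fun i => (S.equivOfCardEq h i : ℕ)) Subtype.val_injective
    (Subtype.val_injective.comp (S.equivOfCardEq h).injective)
  rw [← (rename_perm_eq_iff _).1 f.2.1 e]
  congr 2
  rw [squarefreeExponent, squarefreeExponent, ← sum_coe_sort S, ← sum_coe_sort T,
    ← Equiv.sum_comp (S.equivOfCardEq h), Finsupp.embDomain_eq_mapDomain,
    Finsupp.mapDomain_finsetSum]
  refine sum_congr rfl fun i _ => ?_
  rw [Finsupp.mapDomain_single]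
  congr 1
  exact he i

theorem coeff_esym_squarefreeExponent (R : Type*) [CommRing R] (n : ℕ) :
    MvPowerSeries.coeff (squarefreeExponent (range n)) (esym R n : MvPowerSeries ℕ R) = 1 := by
  rw [esym, SymFunc.coeff_mk, if_pos]
  refine ⟨by rw [squarefreeExponent_degree, card_range], fun i => ?_⟩
  rw [squarefreeExponent_apply]
  split_ifs <;> omega

/-- The factor e_k takes k of the n variables, and by symmetry the choice does not matter. After
division by factorials, e_k acts on squarefree coefficients like z^k / k!. -/
theorem coeff_esym_mul_squarefreeExponent {R : Type*} [CommRing R] (f : SymFunc R) (k n : ℕ) :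
    MvPowerSeries.coeff (squarefreeExponent (range n))
        ((esym R k * f : SymFunc R) : MvPowerSeries ℕ R) =
      n.choose k * MvPowerSeries.coeff (squarefreeExponent (range (n - k)))
        (f : MvPowerSeries ℕ R) := by
  classical
  have h1 : ∑ S ∈ powersetCard k (range n),
      MvPowerSeries.coeff (squarefreeExponent (range n \ S)) (f : MvPowerSeries ℕ R) =
      n.choose k * MvPowerSeries.coeff (squarefreeExponent (range (n - k)))
        (f : MvPowerSeries ℕ R) := by
    rw [sum_congr rfl fun S hS => coeff_squarefreeExponent_eq f (T := range (n - k)) ?_, sum_const,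
      card_powersetCard, card_range, nsmul_eq_mul]
    rw [mem_powersetCard] at hS
    rw [card_sdiff_of_subset hS.1, card_range, card_range, hS.2]
  rw [← h1, MulMemClass.coe_mul, MvPowerSeries.coeff_mul]
  simp only [esym, SymFunc.coeff_mk, ite_mul, one_mul, zero_mul]
  rw [← sum_filter]
  symm
  refine sum_bij (fun S _ => (squarefreeExponent S, squarefreeExponent (range n \ S))) ?_ ?_ ?_ ?_
  · intro S hS
    rw [mem_powersetCard] at hS
    rw [mem_filter, HasAntidiagonal.mem_antidiagonal]
    refine ⟨?_, by rw [squarefreeExponent_degree, hS.2], fun i => ?_⟩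
    · rw [squarefreeExponent, squarefreeExponent, squarefreeExponent, add_comm,
        sum_sdiff hS.1]
    · rw [squarefreeExponent_apply]
      split_ifs <;> omega
  · intro S _ T _ h
    ext i
    have := DFunLike.congr_fun (congrArg Prod.fst h) i
    simp only [squarefreeExponent_apply] at this
    by_cases hS : i ∈ S <;> by_cases hT : i ∈ T <;> simp_all
  · rintro ⟨a, b⟩ hq
    rw [mem_filter, HasAntidiagonal.mem_antidiagonal] at hq
    obtain ⟨hab, hdeg, hle⟩ := hq
    simp only at hab hdeg hle
    have ha : squarefreeExponent a.support = a := by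
      ext i
      rw [squarefreeExponent_apply]
      have := hle i
      split_ifs with h
      · have := Finsupp.mem_support_iff.1 h
        omega
      · exact (Finsupp.notMem_support_iff.1 h).symm
    have hsub : a.support ⊆ range n := by
      intro i hi
      by_contra h
      have h2 := DFunLike.congr_fun hab i
      rw [squarefreeExponent_apply, if_neg h, Finsupp.add_apply] at h2
      exact Finsupp.mem_support_iff.1 hi (by omega)
    refine ⟨a.support, ?_, ?_⟩
    · rw [mem_powersetCard]
      refine ⟨hsub, ?_⟩
      rw [← hdeg, ← squarefreeExponent_degree, ha]
    · rw [ha]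
      congr 1
      have : squarefreeExponent (range n \ a.support) + squarefreeExponent a.support =
        squarefreeExponent (range n) := sum_sdiff hsub
      rw [← this, ha, add_comm] at hab
      exact (add_right_cancel hab).symm
  · intro S _
    rfl

theorem sum_single_eq_iff_bijective {n : ℕ} (κ : Fin n → Fin n) :
    ∑ i, Finsupp.single (κ i) 1 = (∑ i, Finsupp.single i 1 : Fin n →₀ ℕ) ↔
      Function.Bijective κ := by
  classical
  constructor
  · intro h
    rw [← Finite.surjective_iff_bijective]
    intro j
    have h1 := DFunLike.congr_fun h j
    rw [Finsupp.finsetSum_apply, Finsupp.finsetSum_apply] at h1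
    simp only [Finsupp.single_apply] at h1
    by_contra hj
    push Not at hj
    simp [hj] at h1
  · intro h
    exact Equiv.sum_comp (Equiv.ofBijective κ h) fun i => Finsupp.single i 1

/-- Colorings that use n colors once each are permutations; reversing the colors turns cyclic
ascents into cyclic descents. -/
theorem coeff_chromaticQSym_dirCycle_squarefree {n : ℕ} [NeZero n] (hn : 2 ≤ n)
    (v : Equiv.Perm (Fin n)) :
    MvPowerSeries.coeff (squarefreeExponent (range n)) (chromaticQSym (dirCycle v)) =
      (n : ℚ[X]) * Polynomial.X * eulerianPoly (n - 1) := by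
  classical
  have h1 : squarefreeExponent (range n) =
      (∑ i, Finsupp.single i 1 : Fin n →₀ ℕ).embDomain Fin.valEmbedding := by
    rw [squarefreeExponent, sum_range, Finsupp.embDomain_eq_mapDomain, Finsupp.mapDomain_finsetSum]
    simp
  rw [h1, coeff_chromaticQSym_dirCycle hn, ← sum_cyclicDescents hn]
  symm
  refine sum_bij (fun w _ i => Fin.rev (w i)) ?_ ?_ ?_ ?_
  · intro w _
    rw [mem_filter, sum_single_eq_iff_bijective]
    exact ⟨mem_univ _, (w.trans Fin.revPerm).bijective⟩
  · intro w _ w' _ h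
    ext i
    have := Fin.rev_injective (congrFun h i)
    rw [this]
  · intro κ hκ
    rw [mem_filter, sum_single_eq_iff_bijective] at hκ
    refine ⟨(Equiv.ofBijective κ hκ.2).trans Fin.revPerm, mem_univ _, ?_⟩
    funext i
    simp
  · intro w _
    rw [cyclicWeight_of_ne, cyclicDescents]
    · simp only [Fin.rev_lt_rev]
    · intro i h
      exact add_one_ne_self hn i (w.injective (Fin.rev_injective h)).symm

theorem coeff_zero_cycleLogDeriv {A : Type*} [CommRing A] [Algebra ℚ[X] A] (f : ℕ → A) :
    PowerSeries.coeff 0 (cycleLogDeriv f) = 0 := by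
  rw [cycleLogDeriv, map_neg, PowerSeries.coeff_zero_eq_constantCoeff_apply, map_mul,
    ← PowerSeries.coeff_zero_eq_constantCoeff_apply, PowerSeries.coeff_derivative, cycleSeries,
    PowerSeries.coeff_mk]
  simp [cycleCoeff, qInt]

/-- Taking squarefree coefficients over factorials in D · W = -D' replaces e_k by 1/k!. The
coefficient W_j has degree j + 1, whence the shifted factorials. -/
theorem cycleLogDeriv_inv_factorial_eq_mk :
    cycleLogDeriv (fun k => (Polynomial.C ((k.factorial : ℚ)⁻¹) : ℚ[X])) =
      PowerSeries.mk fun j => Polynomial.C (((j + 1).factorial : ℚ)⁻¹) *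
        MvPowerSeries.coeff (squarefreeExponent (range (j + 1)))
          ((PowerSeries.coeff j (cycleLogDeriv (esym ℚ[X])) : SymFunc ℚ[X]) :
            MvPowerSeries ℕ ℚ[X]) := by
  symm
  apply eq_cycleLogDeriv (by simp)
  ext1 j
  have h1 := congrArg (PowerSeries.coeff j) (cycleSeries_mul_cycleLogDeriv (esym_zero ℚ[X]))
  set W := cycleLogDeriv (esym ℚ[X])
  have h2 := congrArg (fun f : SymFunc ℚ[X] => Polynomial.C (((j + 1).factorial : ℚ)⁻¹) *
    MvPowerSeries.coeff (squarefreeExponent (range (j + 1))) (f : MvPowerSeries ℕ ℚ[X])) h1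
  simp only [PowerSeries.coeff_mul, map_neg, PowerSeries.coeff_derivative, cycleSeries,
    PowerSeries.coeff_mk] at h2 ⊢
  refine Eq.trans ?_ (h2.trans ?_)
  · rw [AddSubmonoidClass.coe_finsetSum, map_sum, mul_sum]
    refine sum_congr rfl fun q hq => ?_
    rw [HasAntidiagonal.mem_antidiagonal] at hq
    have h3 : ((cycleCoeff q.1 • esym ℚ[X] q.1 * PowerSeries.coeff q.2 W : SymFunc ℚ[X]) :
        MvPowerSeries ℕ ℚ[X]) = cycleCoeff q.1 •
          ((esym ℚ[X] q.1 * PowerSeries.coeff q.2 W : SymFunc ℚ[X]) : MvPowerSeries ℕ ℚ[X]) := by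
      rw [smul_mul_assoc]
      rfl
    rw [h3, map_smul, coeff_esym_mul_squarefreeExponent,
      show j + 1 - q.1 = q.2 + 1 by omega, smul_eq_mul, smul_eq_mul]
    have h4 : (Polynomial.C ((q.1.factorial : ℚ)⁻¹) : ℚ[X]) *
        Polynomial.C (((q.2 + 1).factorial : ℚ)⁻¹) =
        Polynomial.C (((j + 1).factorial : ℚ)⁻¹) * ((j + 1).choose q.1 : ℚ[X]) := by
      rw [← Polynomial.C_eq_natCast, ← Polynomial.C_mul, ← Polynomial.C_mul]
      congr 1
      have h5 := Nat.choose_mul_factorial_mul_factorial (by omega : q.1 ≤ j + 1)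
      rw [show j + 1 - q.1 = q.2 + 1 by omega] at h5
      have h6 : ((j + 1).choose q.1 : ℚ) * (q.1.factorial : ℚ) * ((q.2 + 1).factorial : ℚ) =
        ((j + 1).factorial : ℚ) := by exact_mod_cast h5
      have h7 : (q.1.factorial : ℚ) ≠ 0 := by positivity
      have h8 : ((q.2 + 1).factorial : ℚ) ≠ 0 := by positivity
      have h9 : ((j + 1).factorial : ℚ) ≠ 0 := by positivity
      field_simp
      linear_combination -h6
    linear_combination (cycleCoeff q.1 * MvPowerSeries.coeff (squarefreeExponent (range (q.2 + 1)))
      ((PowerSeries.coeff q.2 W : SymFunc ℚ[X]) : MvPowerSeries ℕ ℚ[X])) * h4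
  · have h3 : ((-(cycleCoeff (j + 1) • esym ℚ[X] (j + 1) * ((j : SymFunc ℚ[X]) + 1)) : SymFunc ℚ[X]) :
        MvPowerSeries ℕ ℚ[X]) = (-(cycleCoeff (j + 1) * ((j : ℚ[X]) + 1))) •
          (esym ℚ[X] (j + 1) : MvPowerSeries ℕ ℚ[X]) := by
      have h4 : (-(cycleCoeff (j + 1) • esym ℚ[X] (j + 1) * ((j : SymFunc ℚ[X]) + 1)) :
          SymFunc ℚ[X]) = (-(cycleCoeff (j + 1) * ((j : ℚ[X]) + 1))) • esym ℚ[X] (j + 1) := by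
        simp only [Algebra.smul_def, map_neg, map_mul, map_add, map_natCast, map_one]
        ring
      rw [h4]
      rfl
    rw [h3, map_smul, coeff_esym_squarefreeExponent]
    simp only [smul_eq_mul]
    ring

theorem cycleLogDeriv_inv_factorial :
    cycleLogDeriv (fun k => (Polynomial.C ((k.factorial : ℚ)⁻¹) : ℚ[X])) =
      PowerSeries.C Polynomial.X * (eulerianSeries - 1) := by
  ext1 j
  cases j with
  | zero =>
    -- There is no cycle of length one here; both sides vanish, as A_0 = 1 is cancelled by the
    -- subtracted 1.
    rw [coeff_zero_cycleLogDeriv, PowerSeries.coeff_C_mul, map_sub, eulerianSeries,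
      PowerSeries.coeff_mk]
    simp [eulerianPoly, permAsc]
  | succ j =>
    rw [cycleLogDeriv_inv_factorial_eq_mk, PowerSeries.coeff_mk,
      ← chromaticQSym_dirCycle_eq (by omega) 1, coeff_chromaticQSym_dirCycle_squarefree (by omega),
      PowerSeries.coeff_C_mul, map_sub, eulerianSeries, PowerSeries.coeff_mk, PowerSeries.coeff_one,
      if_neg (by omega), sub_zero, Nat.add_sub_cancel]
    have h : Polynomial.C (((j + 1 + 1).factorial : ℚ)⁻¹) * ((j + 1 + 1 : ℕ) : ℚ[X]) =
        Polynomial.C (((j + 1).factorial : ℚ)⁻¹) := by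
      rw [← Polynomial.C_eq_natCast, ← Polynomial.C_mul]
      congr 1
      rw [Nat.factorial_succ (j + 1)]
      push_cast
      have h7 : ((j + 1).factorial : ℚ) ≠ 0 := by positivity
      field_simp
    linear_combination (Polynomial.X * eulerianPoly (j + 1)) * h

theorem derivative_mul {A : Type*} [CommRing A] (f g : PowerSeries A) :
    PowerSeries.derivative A (f * g) =
      f * PowerSeries.derivative A g + g * PowerSeries.derivative A f :=
  Derivation.leibniz _ f g

/-- The classical generating function of the Eulerian polynomials, obtained from the cycles
themselves: for f_k = 1/k! one has (t-1) D = e^z (t - e^{(t-1)z}) and D · t(𝓐 - 1) = -D'.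
Eliminating D leaves the claim times t e^z. -/
theorem sub_rescale_exp_mul_eulerianSeries :
    (PowerSeries.C Polynomial.X - PowerSeries.rescale (Polynomial.X - 1)
      (PowerSeries.exp ℚ[X])) * eulerianSeries = PowerSeries.C (Polynomial.X - 1) := by
  have hf : PowerSeries.mk (fun k => (Polynomial.C ((k.factorial : ℚ)⁻¹) : ℚ[X])) =
      PowerSeries.exp ℚ[X] := by
    ext1 k
    rw [PowerSeries.coeff_mk, PowerSeries.coeff_exp, one_div]
    rfl
  have h1 := tConst_sub_one_mul_cycleSeries
    fun k => (Polynomial.C ((k.factorial : ℚ)⁻¹) : ℚ[X])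
  have h2 := cycleSeries_mul_cycleLogDeriv
    (f := fun k => (Polynomial.C ((k.factorial : ℚ)⁻¹) : ℚ[X])) (by simp)
  have ht : tConst ℚ[X] = PowerSeries.C Polynomial.X := rfl
  have h3 : PowerSeries.rescale Polynomial.X (PowerSeries.exp ℚ[X]) = PowerSeries.exp ℚ[X] *
      PowerSeries.rescale (Polynomial.X - 1) (PowerSeries.exp ℚ[X]) := by
    have := PowerSeries.exp_mul_exp_eq_exp_add (1 : ℚ[X]) (Polynomial.X - 1)
    rw [PowerSeries.rescale_one, RingHom.id_apply, add_sub_cancel] at this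
    exact this.symm
  have ht' : algebraMap ℚ[X] ℚ[X] Polynomial.X = Polynomial.X := rfl
  rw [hf, ht, ht', h3] at h1
  rw [cycleLogDeriv_inv_factorial] at h2
  have h4 := congrArg (PowerSeries.derivative ℚ[X]) h1
  have hC : PowerSeries.derivative ℚ[X] (PowerSeries.C (Polynomial.X : ℚ[X])) = 0 :=
    PowerSeries.derivative_C
  rw [map_sub, derivative_mul, derivative_mul, derivative_mul, map_sub, hC,
    PowerSeries.derivative_one, derivative_rescale, PowerSeries.derivative_exp] at h4
  simp only [mul_zero, add_zero, sub_zero] at h4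
  rw [map_sub, map_one] at h4 ⊢
  set F := PowerSeries.rescale (Polynomial.X - 1) (PowerSeries.exp ℚ[X])
  set e := PowerSeries.exp ℚ[X]
  set D := cycleSeries fun k => (Polynomial.C ((k.factorial : ℚ)⁻¹) : ℚ[X])
  have he : e ≠ 0 := (PowerSeries.isUnit_exp ℚ[X]).ne_zero
  have hX : (PowerSeries.C Polynomial.X : PowerSeries ℚ[X]) ≠ 0 := by
    rw [Ne, map_eq_zero_iff _ PowerSeries.C_injective]
    exact Polynomial.X_ne_zero
  apply mul_left_cancel₀ (mul_ne_zero hX he)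
  linear_combination (PowerSeries.C Polynomial.X - 1) * h2 - h4 -
    (PowerSeries.C Polynomial.X * (eulerianSeries - 1)) * h1

/-! ### Expansion over partitions -/

theorem count_eq_zero_of_notMem_Icc {n : ℕ} (lam : n.Partition) {i : ℕ} (hi : i ∉ Icc 1 n) :
    lam.parts.count i = 0 := by
  rw [Multiset.count_eq_zero]
  intro h
  exact hi (mem_Icc.2 ⟨lam.parts_pos h, lam.le_of_mem_parts h⟩)

theorem toFinset_parts_subset {n : ℕ} (lam : n.Partition) : lam.parts.toFinset ⊆ Icc 1 n := by
  intro i hi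
  rw [Multiset.mem_toFinset] at hi
  exact mem_Icc.2 ⟨lam.parts_pos hi, lam.le_of_mem_parts hi⟩

theorem prod_map_parts {A : Type*} [CommMonoid A] {n : ℕ} (lam : n.Partition) (f : ℕ → A) :
    (lam.parts.map f).prod = ∏ i ∈ Icc 1 n, f i ^ lam.parts.count i := by
  rw [prod_multiset_map_count]
  refine prod_subset (toFinset_parts_subset lam) fun i _ hi => ?_
  rw [Multiset.mem_toFinset, ← Multiset.count_eq_zero] at hi
  rw [hi, pow_zero]

theorem zPart_eq {n : ℕ} (lam : n.Partition) :
    zPart lam = ∏ i ∈ Icc 1 n, (lam.parts.count i).factorial * i ^ lam.parts.count i := by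
  refine prod_subset (toFinset_parts_subset lam) fun i _ hi => ?_
  rw [Multiset.mem_toFinset, ← Multiset.count_eq_zero] at hi
  rw [hi, pow_zero, Nat.factorial_zero, mul_one]

theorem zPart_ne_zero {n : ℕ} (lam : n.Partition) : zPart lam ≠ 0 := by
  rw [zPart_eq, prod_ne_zero_iff]
  intro i hi
  rw [mem_Icc] at hi
  exact mul_ne_zero (Nat.factorial_ne_zero _) (pow_ne_zero _ (by omega))

theorem card_parts_eq {n : ℕ} (lam : n.Partition) :
    lam.parts.card = ∑ i ∈ Icc 1 n, lam.parts.count i := by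
  rw [← Multiset.toFinset_sum_count_eq]
  refine sum_subset (toFinset_parts_subset lam) fun i _ hi => ?_
  rwa [Multiset.mem_toFinset, ← Multiset.count_eq_zero] at hi

theorem sum_parts_eq {n : ℕ} (lam : n.Partition) :
    ∑ i ∈ Icc 1 n, i * lam.parts.count i = n := by
  conv_rhs => rw [← lam.parts_sum, ← Multiset.map_id lam.parts, sum_multiset_map_count]
  symm
  rw [sum_subset (toFinset_parts_subset lam)]
  · exact sum_congr rfl fun i _ => by rw [smul_eq_mul, mul_comm, id]
  · intro i _ hi
    rw [Multiset.mem_toFinset, ← Multiset.count_eq_zero] at hi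
    rw [hi, zero_smul]

theorem coeff_pow_congr {A : Type*} [CommRing A] {f g : PowerSeries A} {n : ℕ}
    (h : ∀ k ≤ n, PowerSeries.coeff k f = PowerSeries.coeff k g) (d : ℕ) :
    ∀ k ≤ n, PowerSeries.coeff k (f ^ d) = PowerSeries.coeff k (g ^ d) := by
  induction d with
  | zero => simp
  | succ d ih =>
    intro k hk
    rw [pow_succ, pow_succ, PowerSeries.coeff_mul, PowerSeries.coeff_mul]
    refine sum_congr rfl fun q hq => ?_
    rw [HasAntidiagonal.mem_antidiagonal] at hq
    rw [ih _ (by omega), h _ (by omega)]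

/-- Multinomial theorem: the exponent vectors of total d and weight n are the multiplicity vectors
of the partitions of n with d parts. -/
theorem coeff_pow_eq_sum_partition {A : Type*} [CommRing A] {u : PowerSeries A}
    (hu : PowerSeries.constantCoeff u = 0) (n d : ℕ) :
    PowerSeries.coeff n (u ^ d) = ∑ lam : n.Partition with lam.parts.card = d,
      (Nat.multinomial (Icc 1 n) fun i => lam.parts.count i : A) *
        (lam.parts.map fun i => PowerSeries.coeff i u).prod := by
  classical
  -- Only the terms of degree 1 to n matter, so `u` is replaced by a finite sum.
  have h1 : ∀ k ≤ n, PowerSeries.coeff k u = PowerSeries.coeff k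
      (∑ i ∈ Icc 1 n, PowerSeries.monomial i (PowerSeries.coeff i u)) := by
    intro k hk
    rw [map_sum]
    simp only [PowerSeries.coeff_monomial]
    rw [sum_ite_eq]
    split_ifs with h
    · rfl
    · rw [mem_Icc] at h
      obtain rfl : k = 0 := by omega
      rw [PowerSeries.coeff_zero_eq_constantCoeff_apply, hu]
  have h2 : ∀ κ : ℕ → ℕ, PowerSeries.coeff n ((Nat.multinomial (Icc 1 n) κ : PowerSeries A) *
      ∏ i ∈ Icc 1 n, PowerSeries.monomial i (PowerSeries.coeff i u) ^ κ i) =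
      if ∑ i ∈ Icc 1 n, i * κ i = n then (Nat.multinomial (Icc 1 n) κ : A) *
        ∏ i ∈ Icc 1 n, PowerSeries.coeff i u ^ κ i else 0 := by
    intro κ
    have h3 : ∏ i ∈ Icc 1 n, PowerSeries.monomial i (PowerSeries.coeff i u) ^ κ i =
        PowerSeries.C (∏ i ∈ Icc 1 n, PowerSeries.coeff i u ^ κ i) *
          PowerSeries.X ^ ∑ i ∈ Icc 1 n, i * κ i := by
      rw [map_prod, ← prod_pow_eq_pow_sum, ← prod_mul_distrib]
      refine prod_congr rfl fun i _ => ?_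
      rw [← mul_one (PowerSeries.coeff i u), ← smul_eq_mul, map_smul, ← PowerSeries.X_pow_eq,
        PowerSeries.smul_eq_C_mul, mul_pow, map_pow, pow_mul, smul_eq_mul, mul_one]
    rw [h3, ← map_natCast PowerSeries.C, PowerSeries.coeff_C_mul, PowerSeries.coeff_C_mul,
      PowerSeries.coeff_X_pow]
    by_cases h : ∑ i ∈ Icc 1 n, i * κ i = n
    · rw [if_pos h, if_pos h.symm, mul_one]
    · rw [if_neg h, if_neg (Ne.symm h), mul_zero, mul_zero]
  rw [coeff_pow_congr h1 d n le_rfl, sum_pow_eq_sum_piAntidiag, map_sum, sum_congr rfl fun κ _ => h2 κ,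
    ← sum_filter]
  symm
  refine sum_bij (fun lam _ i => lam.parts.count i) ?_ ?_ ?_ ?_
  · intro lam hlam
    rw [mem_filter] at hlam
    rw [mem_filter, mem_piAntidiag]
    refine ⟨⟨by rw [← card_parts_eq, hlam.2], fun i hi => ?_⟩, sum_parts_eq lam⟩
    by_contra h
    exact hi (count_eq_zero_of_notMem_Icc lam h)
  · intro lam _ mu _ h
    apply Nat.Partition.ext
    ext i
    exact congrFun h i
  · intro κ hκ
    rw [mem_filter, mem_piAntidiag] at hκ
    obtain ⟨⟨hd, hsupp⟩, hn⟩ := hκ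
    have hcount : ∀ i, (∑ j ∈ Icc 1 n, Multiset.replicate (κ j) j).count i = κ i := by
      intro i
      rw [Multiset.count_sum']
      simp only [Multiset.count_replicate]
      rw [sum_ite_eq']
      split_ifs with h
      · rfl
      · by_contra h'
        exact h (hsupp i (Ne.symm h'))
    refine ⟨⟨∑ j ∈ Icc 1 n, Multiset.replicate (κ j) j, ?_, ?_⟩, ?_, ?_⟩
    · intro i hi
      rw [Multiset.mem_sum] at hi
      obtain ⟨j, hj, hij⟩ := hi
      rw [Multiset.eq_of_mem_replicate hij]
      exact (mem_Icc.1 hj).1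
    · rw [Multiset.sum_sum]
      simp only [Multiset.sum_replicate, smul_eq_mul]
      exact (sum_congr rfl fun i _ => mul_comm _ _).trans hn
    · rw [mem_filter]
      refine ⟨mem_univ _, ?_⟩
      simp only [Multiset.card_replicate, Multiset.card_sum]
      exact hd
    · funext i
      exact hcount i
  · intro lam _
    rw [prod_map_parts]

theorem multinomial_mul_prod_inv {n : ℕ} (lam : n.Partition) :
    (Nat.multinomial (Icc 1 n) fun i => lam.parts.count i : ℚ) *
      (lam.parts.map fun i : ℕ => ((i : ℚ)⁻¹)).prod =
    (lam.parts.card.factorial : ℚ) * (zPart lam : ℚ)⁻¹ := by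
  have h1 := Nat.multinomial_spec (Icc 1 n) fun i => lam.parts.count i
  rw [← card_parts_eq] at h1
  have h2 : (∏ i ∈ Icc 1 n, ((lam.parts.count i).factorial : ℚ)) *
      (Nat.multinomial (Icc 1 n) fun i => lam.parts.count i : ℚ) = (lam.parts.card.factorial : ℚ) := by
    exact_mod_cast h1
  rw [prod_map_parts, ← h2, zPart_eq]
  push_cast
  rw [prod_mul_distrib, mul_inv, ← mul_assoc, mul_comm (∏ i ∈ Icc 1 n, _ : ℚ) (_ : ℚ), mul_assoc,
    mul_assoc]
  congr 1
  rw [← mul_assoc, mul_inv_cancel₀, one_mul, ← prod_inv_distrib]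
  · exact prod_congr rfl fun i _ => inv_pow _ _
  · exact prod_ne_zero_iff.2 fun i _ => by positivity

theorem coeff_qPowerSeries_pow {A : Type*} [CommRing A] [Algebra ℚ[X] A] (p : ℕ → A) (n d : ℕ) :
    PowerSeries.coeff n (qPowerSeries p ^ d) = ∑ lam : n.Partition with lam.parts.card = d,
      (Polynomial.C ((d.factorial : ℚ) * (zPart lam : ℚ)⁻¹) * (lam.parts.map qInt).prod) •
        (lam.parts.map p).prod := by
  rw [coeff_pow_eq_sum_partition (constantCoeff_qPowerSeries p)]
  refine sum_congr rfl fun lam hlam => ?_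
  rw [mem_filter] at hlam
  have h1 : (lam.parts.map fun i => PowerSeries.coeff i (qPowerSeries p)).prod =
      algebraMap ℚ[X] A (Polynomial.C (lam.parts.map fun i : ℕ => ((i : ℚ)⁻¹)).prod *
        (lam.parts.map qInt).prod) * (lam.parts.map p).prod := by
    rw [map_mul, map_multiset_prod, map_multiset_prod, map_multiset_prod, Multiset.map_map,
      Multiset.map_map, Multiset.map_map, ← Multiset.prod_map_mul, ← Multiset.prod_map_mul]
    simp only [qPowerSeries, PowerSeries.coeff_mk, Algebra.smul_def, map_mul, Function.comp_apply]
  rw [h1, ← hlam.2, ← multinomial_mul_prod_inv, Algebra.smul_def, Polynomial.C_mul, map_mul, map_mul,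
    map_mul, Polynomial.C_eq_natCast, map_natCast, mul_assoc, mul_assoc, mul_assoc]

theorem card_parts_le {n : ℕ} (lam : n.Partition) : lam.parts.card ≤ n := by
  have h := Multiset.card_nsmul_le_sum (s := lam.parts) (a := 1) fun i hi => lam.parts_pos hi
  rwa [lam.parts_sum, smul_eq_mul, mul_one] at h

/-- The coefficient of `z_λ⁻¹ p_λ` in `ω` of the chromatic symmetric function of a cycle. -/
def cycleCoefficient {n : ℕ} (lam : n.Partition) : ℚ[X] :=
  open Classical in
  if lam = Nat.Partition.indiscrete n then (n : ℚ[X]) * Polynomial.X * qInt (n - 1)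
  else (n : ℚ[X]) * Polynomial.X * eulerianPoly (lam.parts.card - 1) * (lam.parts.map qInt).prod

/-- Q' 𝓐(Q) is the derivative of B(Q) with B = ∑_{d≥1} A_{d-1} z^d / d!. Differentiation brings down
the factor m + 1, and the d! cancels against the one in the expansion of Q^d over partitions with d
parts. -/
theorem coeff_derivative_qPowerSeries_mul {A : Type*} [CommRing A] [Algebra ℚ[X] A] (p : ℕ → A)
    (m : ℕ) :
    PowerSeries.coeff m (PowerSeries.derivative A (qPowerSeries p) *
      eulerianSeries.subst (qPowerSeries p)) = ∑ lam : (m + 1).Partition,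
        (((m + 1 : ℕ) : ℚ[X]) * eulerianPoly (lam.parts.card - 1) * (lam.parts.map qInt).prod *
          Polynomial.C ((zPart lam : ℚ)⁻¹)) • (lam.parts.map p).prod := by
  classical
  set B : PowerSeries ℚ[X] := PowerSeries.mk fun d =>
    if d = 0 then 0 else Polynomial.C ((d.factorial : ℚ)⁻¹) * eulerianPoly (d - 1) with hB
  have hB' : PowerSeries.derivative ℚ[X] B = eulerianSeries := by
    ext1 d
    rw [PowerSeries.coeff_derivative, hB, PowerSeries.coeff_mk, if_neg (by omega), eulerianSeries,
      PowerSeries.coeff_mk, Nat.add_sub_cancel]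
    have h : Polynomial.C (((d + 1).factorial : ℚ)⁻¹) * ((d : ℚ[X]) + 1) =
        Polynomial.C ((d.factorial : ℚ)⁻¹) := by
      have : ((d : ℚ[X]) + 1) = Polynomial.C ((d : ℚ) + 1) := by simp
      rw [this, ← Polynomial.C_mul, Nat.factorial_succ]
      congr 1
      push_cast
      have h7 : (d.factorial : ℚ) ≠ 0 := by positivity
      field_simp
    linear_combination eulerianPoly d * h
  have hu := hasSubst_qPowerSeries p
  rw [mul_comm, ← hB', ← derivative_subst_algebra hu, PowerSeries.coeff_derivative,
    PowerSeries.coeff_subst' hu, finsum_eq_sum_of_support_subset (s := range (m + 2))]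
  · rw [← sum_fiberwise_of_maps_to (s := univ) (t := range (m + 2))
      (g := fun lam : (m + 1).Partition => lam.parts.card), sum_mul]
    · refine sum_congr rfl fun d _ => ?_
      rw [coeff_qPowerSeries_pow, smul_sum, sum_mul]
      refine sum_congr rfl fun lam hlam => ?_
      rw [mem_filter] at hlam
      have hd : d ≠ 0 := by
        rintro rfl
        have := Multiset.card_eq_zero.1 hlam.2
        have h2 := lam.parts_sum
        rw [this] at h2
        simp at h2
      rw [hB, PowerSeries.coeff_mk, if_neg hd, hlam.2]
      simp only [Algebra.smul_def, map_mul]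
      have h : algebraMap ℚ[X] A (Polynomial.C ((d.factorial : ℚ)⁻¹)) *
          algebraMap ℚ[X] A (Polynomial.C (d.factorial : ℚ)) = 1 := by
        rw [← map_mul, ← Polynomial.C_mul, inv_mul_cancel₀ (by positivity), Polynomial.C_1, map_one]
      rw [map_natCast (algebraMap ℚ[X] A) (m + 1), Nat.cast_add, Nat.cast_one]
      linear_combination (algebraMap ℚ[X] A (eulerianPoly (d - 1)) *
        algebraMap ℚ[X] A (Polynomial.C (zPart lam : ℚ)⁻¹) *
        algebraMap ℚ[X] A (lam.parts.map qInt).prod * (lam.parts.map p).prod * ((m : A) + 1)) * h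
    · intro lam _
      have := card_parts_le lam
      rw [mem_range]
      omega
  · intro d hd
    rw [Function.mem_support] at hd
    rw [coe_range, Set.mem_Iio]
    by_contra h
    apply hd
    rw [coeff_qPowerSeries_pow, filter_eq_empty_iff.2, sum_empty, smul_zero]
    intro lam _ hlam
    have := card_parts_le lam
    omega

theorem zPart_indiscrete {n : ℕ} (hn : n ≠ 0) : zPart (Nat.Partition.indiscrete n) = n := by
  rw [zPart, Nat.Partition.indiscrete_parts hn]
  simp

/-- The summand t Q' 𝓐(Q) already has the right coefficients for all partitions with several parts.
The rest, -(t-1) Q' - P, contributes only multiples of p_n and corrects the one-part term. -/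
theorem coeff_cycleLogDeriv_eq_sum {A : Type*} [CommRing A] [Algebra ℚ[X] A] [IsDomain A]
    [CharZero A] [FaithfulSMul ℚ[X] A] {p h : ℕ → A}
    (hh : h 0 = 1) (hph : PowerSeries.derivative A (PowerSeries.mk h) =
      (PowerSeries.mk fun k => p (k + 1)) * PowerSeries.mk h) (m : ℕ) :
    PowerSeries.coeff m (cycleLogDeriv h) = ∑ lam : (m + 1).Partition,
      (cycleCoefficient lam * Polynomial.C ((zPart lam : ℚ)⁻¹)) • (lam.parts.map p).prod := by
  classical
  have h1 : ∀ U Q P : PowerSeries A, U * (tConst A * Q - tConst A + 1) - P =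
      tConst A * (U * Q) - (tConst A * U - U) - P := by
    intro U Q P
    ring
  rw [cycleLogDeriv_eq sub_rescale_exp_mul_eulerianSeries hh hph, h1, map_sub, map_sub, map_sub, tConst,
    PowerSeries.coeff_C_mul, PowerSeries.coeff_C_mul, coeff_derivative_qPowerSeries_mul,
    coeff_derivative_qPowerSeries, PowerSeries.coeff_mk, mul_sum,
    ← sum_erase_add _ _ (mem_univ (Nat.Partition.indiscrete (m + 1))),
    ← sum_erase_add _ _ (mem_univ (Nat.Partition.indiscrete (m + 1)))]
  have h2 : ∑ lam ∈ univ.erase (Nat.Partition.indiscrete (m + 1)),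
      algebraMap ℚ[X] A Polynomial.X * (((m + 1 : ℕ) : ℚ[X]) * eulerianPoly (lam.parts.card - 1) *
        (lam.parts.map qInt).prod * Polynomial.C ((zPart lam : ℚ)⁻¹)) • (lam.parts.map p).prod =
      ∑ lam ∈ univ.erase (Nat.Partition.indiscrete (m + 1)),
        (cycleCoefficient lam * Polynomial.C ((zPart lam : ℚ)⁻¹)) • (lam.parts.map p).prod := by
    refine sum_congr rfl fun lam hlam => ?_
    rw [cycleCoefficient, if_neg (ne_of_mem_erase hlam), Algebra.smul_def, Algebra.smul_def,
      ← mul_assoc, ← map_mul]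
    congr 2
    ring
  rw [h2, add_sub_assoc, add_sub_assoc]
  congr 1
  rw [cycleCoefficient, if_pos rfl, zPart_indiscrete (by omega),
    Nat.Partition.indiscrete_parts (by omega)]
  have h3 : (((m + 1 : ℕ) : ℚ[X]) * Polynomial.C (((m + 1 : ℕ) : ℚ)⁻¹)) = 1 := by
    rw [← Polynomial.C_eq_natCast, ← Polynomial.C_mul, mul_inv_cancel₀ (by positivity),
      Polynomial.C_1]
  have h4 : eulerianPoly 0 = 1 := by simp [eulerianPoly, permAsc]
  have h5 := X_sub_one_mul_qInt (m + 1)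
  have h6 : qInt (m + 1) = qInt m + Polynomial.X ^ m := by rw [qInt, qInt, sum_range_succ]
  -- With n = m + 1 this is t [n]_t - (t-1) [n]_t - 1 = t [n]_t - t^n = t [n-1]_t.
  have h7 : Polynomial.X * (((m + 1 : ℕ) : ℚ[X]) * eulerianPoly 0 * qInt (m + 1) *
      Polynomial.C (((m + 1 : ℕ) : ℚ)⁻¹)) - (Polynomial.X * qInt (m + 1) - qInt (m + 1)) - 1 =
      ((m + 1 : ℕ) : ℚ[X]) * Polynomial.X * qInt m * Polynomial.C (((m + 1 : ℕ) : ℚ)⁻¹) := by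
    rw [h4]
    linear_combination (Polynomial.X * qInt (m + 1) - Polynomial.X * qInt m) * h3 - h5 +
      Polynomial.X * h6
  simp only [Multiset.card_singleton, Multiset.map_singleton, Multiset.prod_singleton, Nat.sub_self,
    Nat.add_sub_cancel]
  rw [← h7]
  simp only [Algebra.smul_def, map_sub, map_mul, map_one]
  ring

/-! ### Independence of the power sum symmetric functions -/

/-- The e_k with k ≥ 1 are free generators, so their images can be prescribed. They are chosen so
that ∑ (-1)^k e_k z^k goes to the solution `f` of f' = -(∑ X_k z^k) f; comparing with its own
differential equation, whose coefficient is -∑ p_{k+1} z^k, gives the images of the power sums. -/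
theorem exists_algHom_psym : ∃ φ : SymFunc ℚ[X] →ₐ[ℚ[X]] MvPolynomial ℕ ℚ[X],
    ∀ k, φ (psym ℚ[X] (k + 1)) = MvPolynomial.X k := by
  obtain ⟨f, hf0, hf⟩ := exists_derivative_eq_mul
    (-(PowerSeries.mk fun k => (MvPolynomial.X k : MvPolynomial ℕ ℚ[X])))
  set E := AlgEquiv.ofBijective (esymHom ℚ[X]) ⟨esymHom_injective ℚ[X], esymHom_surjective ℚ[X]⟩
    with hE
  set φ : SymFunc ℚ[X] →ₐ[ℚ[X]] MvPolynomial ℕ ℚ[X] :=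
    (MvPolynomial.aeval fun i => (-1) ^ (i + 1) * PowerSeries.coeff (i + 1) f).comp
      (E.symm : SymFunc ℚ[X] →ₐ[ℚ[X]] _) with hφ
  have hφe : ∀ k, φ (esym ℚ[X] k) = (-1) ^ k * PowerSeries.coeff k f := by
    intro k
    cases k with
    | zero =>
      rw [esym_zero, map_one, PowerSeries.coeff_zero_eq_constantCoeff_apply, hf0, pow_zero, mul_one]
    | succ k =>
      have h1 : E (MvPolynomial.X k) = esym ℚ[X] (k + 1) := by
        have : E (MvPolynomial.X k) = esymHom ℚ[X] (MvPolynomial.X k) := rfl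
        rw [this, esymHom, MvPolynomial.aeval_X]
      rw [← h1, hφ]
      simp
  have h1 : PowerSeries.map (φ : SymFunc ℚ[X] →+* MvPolynomial ℕ ℚ[X]) (signedEsymSeries ℚ[X]) =
      f := by
    ext1 k
    rw [PowerSeries.coeff_map, signedEsymSeries, PowerSeries.coeff_mk, RingHom.coe_coe, map_mul, hφe,
      map_pow, map_neg, map_one, ← mul_assoc, neg_one_pow_mul_self, one_mul]
  have h2 := congrArg (PowerSeries.map (φ : SymFunc ℚ[X] →+* MvPolynomial ℕ ℚ[X]))
    (derivative_signedEsymSeries ℚ[X])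
  rw [map_derivative, map_mul, h1, hf, map_neg] at h2
  have hf' : f ≠ 0 := by
    rintro rfl
    simp at hf0
  have h3 := mul_right_cancel₀ hf' h2
  rw [neg_inj] at h3
  refine ⟨φ, fun k => ?_⟩
  have h4 := congrArg (PowerSeries.coeff k) h3
  rw [PowerSeries.coeff_map, PowerSeries.coeff_mk, PowerSeries.coeff_mk] at h4
  exact h4.symm

/-- The homomorphism sends the p_λ to distinct monomials; the predecessor appears because p_{k+1}
goes to X_k. -/
theorem linearIndependent_psymPart (n : ℕ) :
    LinearIndependent ℚ[X] fun lam : n.Partition => psymPart ℚ[X] lam := by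
  classical
  obtain ⟨φ, hφ⟩ := exists_algHom_psym
  apply LinearIndependent.of_comp φ.toLinearMap
  have h1 : φ.toLinearMap ∘ (fun lam : n.Partition => psymPart ℚ[X] lam) =
      (MvPolynomial.basisMonomials ℕ ℚ[X]) ∘
        fun lam : n.Partition => Multiset.toFinsupp (lam.parts.map Nat.pred) := by
    funext lam
    have h : ∀ s : Multiset ℕ, (∀ i ∈ s, 0 < i) →
        φ (s.map (psym ℚ[X])).prod =
          MvPolynomial.monomial (Multiset.toFinsupp (s.map Nat.pred)) 1 := by
      intro s
      induction s using Multiset.induction_on with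
      | empty =>
        intro _
        simp
      | cons a s ih =>
        intro hs
        obtain ⟨b, rfl⟩ : ∃ b, a = b + 1 :=
          ⟨a - 1, by have := hs a (Multiset.mem_cons_self a s); omega⟩
        rw [Multiset.map_cons, Multiset.prod_cons, map_mul, hφ,
          ih fun i hi => hs i (Multiset.mem_cons_of_mem hi), Multiset.map_cons, Nat.pred_succ,
          ← Multiset.singleton_add, map_add, Multiset.toFinsupp_singleton, MvPolynomial.X,
          MvPolynomial.monomial_mul, one_mul]
    rw [Function.comp_apply, Function.comp_apply, AlgHom.toLinearMap_apply, psymPart,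
      h _ fun i hi => lam.parts_pos hi, MvPolynomial.coe_basisMonomials]
  rw [h1]
  refine (MvPolynomial.basisMonomials ℕ ℚ[X]).linearIndependent.comp _ ?_
  intro lam mu h
  have h2 := Multiset.toFinsupp.injective h
  have h3 := congrArg (Multiset.map Nat.succ) h2
  have h4 : ∀ s : Multiset ℕ, (∀ i ∈ s, 0 < i) → (s.map Nat.pred).map Nat.succ = s := by
    intro s hs
    rw [Multiset.map_map]
    conv_rhs => rw [← Multiset.map_id s]
    exact Multiset.map_congr rfl fun i hi => Nat.succ_pred_eq_of_pos (hs i hi)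
  rw [h4 _ fun i hi => lam.parts_pos hi, h4 _ fun i hi => mu.parts_pos hi] at h3
  exact Nat.Partition.ext h3

/-! ### The power sum expansion and the main theorem. -/

theorem omega_chromaticQSym_dirCycle {m : ℕ} (hm : 2 ≤ m + 1) (v : Equiv.Perm (Fin (m + 1)))
    (hX : chromaticQSym (dirCycle v) ∈ SymFunc ℚ[X]) :
    omega ℚ[X] ⟨chromaticQSym (dirCycle v), hX⟩ = ∑ lam : (m + 1).Partition,
      (cycleCoefficient lam * Polynomial.C ((zPart lam : ℚ)⁻¹)) • psymPart ℚ[X] lam := by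
  have h1 : (⟨chromaticQSym (dirCycle v), hX⟩ : SymFunc ℚ[X]) =
      PowerSeries.coeff m (cycleLogDeriv (esym ℚ[X])) :=
    Subtype.ext (chromaticQSym_dirCycle_eq hm v)
  rw [h1, omega_coeff_cycleLogDeriv]
  exact coeff_cycleLogDeriv_eq_sum (hsym_zero ℚ[X]) (derivative_mk_hsym ℚ[X]) m

theorem omega_chromaticQSym_dirCycle_eq_iff {m : ℕ} (hm : 2 ≤ m + 1) (v : Equiv.Perm (Fin (m + 1)))
    (hX : chromaticQSym (dirCycle v) ∈ SymFunc ℚ[X]) (c : (m + 1).Partition → ℚ[X]) :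
    omega ℚ[X] ⟨chromaticQSym (dirCycle v), hX⟩ = ∑ lam : (m + 1).Partition,
      (c lam * Polynomial.C ((zPart lam : ℚ)⁻¹)) • psymPart ℚ[X] lam ↔ c = cycleCoefficient := by
  constructor
  · intro h
    rw [omega_chromaticQSym_dirCycle hm v hX] at h
    have h1 := Fintype.linearIndependent_iffₛ.1 (linearIndependent_psymPart (m + 1)) _ _ h
    funext lam
    refine (mul_right_cancel₀ ?_ (h1 lam)).symm
    rw [Polynomial.C_ne_zero]
    exact inv_ne_zero (Nat.cast_ne_zero.2 (zPart_ne_zero lam))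
  · rintro rfl
    exact omega_chromaticQSym_dirCycle hm v hX

theorem eq_cycleCoefficient_iff {n : ℕ} (c : n.Partition → ℚ[X]) :
    c = cycleCoefficient ↔
      c (Nat.Partition.indiscrete n) = (n : ℚ[X]) * Polynomial.X * qInt (n - 1) ∧
      ∀ lam : n.Partition, lam ≠ Nat.Partition.indiscrete n → c lam =
        (n : ℚ[X]) * Polynomial.X * eulerianPoly (lam.parts.card - 1) *
          (lam.parts.map qInt).prod := by
  constructor
  · rintro rfl
    exact ⟨if_pos rfl, fun lam hlam => if_neg hlam⟩
  · rintro ⟨h1, h2⟩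
    funext lam
    by_cases hlam : lam = Nat.Partition.indiscrete n
    · rw [hlam, h1, cycleCoefficient, if_pos rfl]
    · rw [h2 lam hlam, cycleCoefficient, if_neg hlam]

end

end CycleChromatic

theorem theorem4p5 (n : ℕ) (hn : 2 ≤ n) (v : Equiv.Perm (Fin n)) :
    -- partitions with at least two parts
    (∀ lam : n.Partition, 2 ≤ lam.parts.card →
      CycleChromatic.invSum (CycleChromatic.dirCycle v) lam =
        (n : ℚ[X]) * Polynomial.X * CycleChromatic.eulerianPoly (lam.parts.card - 1) *
          (lam.parts.map CycleChromatic.qInt).prod) ∧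
    -- the partition with one part
    CycleChromatic.invSum (CycleChromatic.dirCycle v) (Nat.Partition.indiscrete n) =
      (n : ℚ[X]) * Polynomial.X * CycleChromatic.qInt (n - 1) ∧
    -- the chromatic quasisymmetric function is symmetric, and the coefficients of its image
    -- under `ω` in the basis of the `z_λ⁻¹ p_λ` are the ones below
    ∃ hX : CycleChromatic.chromaticQSym (CycleChromatic.dirCycle v) ∈
        CycleChromatic.SymFunc ℚ[X],
      ∀ c : n.Partition → ℚ[X],
        CycleChromatic.omega ℚ[X]
            ⟨CycleChromatic.chromaticQSym (CycleChromatic.dirCycle v), hX⟩ =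
          ∑ lam : n.Partition, (c lam * Polynomial.C ((CycleChromatic.zPart lam : ℚ)⁻¹)) •
            CycleChromatic.psymPart ℚ[X] lam ↔
        (c (Nat.Partition.indiscrete n) =
            (n : ℚ[X]) * Polynomial.X * CycleChromatic.qInt (n - 1) ∧
          ∀ lam : n.Partition, lam ≠ Nat.Partition.indiscrete n →
            c lam = (n : ℚ[X]) * Polynomial.X *
              CycleChromatic.eulerianPoly (lam.parts.card - 1) *
              (lam.parts.map CycleChromatic.qInt).prod) := by
  obtain ⟨m, rfl⟩ : ∃ m, n = m + 1 := ⟨n - 1, by omega⟩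
  refine ⟨fun lam hlam => CycleChromatic.invSum_of_two_le_card hn v lam hlam,
    CycleChromatic.invSum_indiscrete hn v, ?_⟩
  have hX : CycleChromatic.chromaticQSym (CycleChromatic.dirCycle v) ∈
      CycleChromatic.SymFunc ℚ[X] := by
    -- Symmetry is immediate once X is a coefficient of a power series over the ring of symmetric
    -- functions.
    rw [CycleChromatic.chromaticQSym_dirCycle_eq hn v]
    exact Subtype.property _
  refine ⟨hX, fun c => ?_⟩
  rw [CycleChromatic.omega_chromaticQSym_dirCycle_eq_iff hn v hX c,
    CycleChromatic.eq_cycleCoefficient_iff]
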